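/- Let $1\le N\le M$ be integers and $\beta\in\mathbb C$. For $\boldsymbol z=(z_1,\dots,z_N)$ with pairwise distinct entries and integers $\lambda_1\ge\dots\ge\lambda_N\ge 0$ define the Grothendieck polynomial and its dual by $$G_\lambda(\boldsymbol z;\beta)=\frac{\det_N\big(z_j^{\lambda_k+N-k}(1+\beta z_j)^{k-1}\big)}{\prod_{1\le j<k\le N}(z_j-z_k)},\qquad \overline G_\lambda(\boldsymbol z;\beta)=\frac{\det_N\big(z_j^{\lambda_k+N-k}(1+\beta z_j^{-1})^{1-k}\big)}{\prod_{1\le j<k\le N}(z_j-z_k)} .$$ A solution of the Bethe equations is a set $\{z\}_N=\{z_1,\dots,z_N\}$ of $N$ distinct complex numbers with $1+\beta z_k\neq0$ and $$(1+\beta z_k)^N+(-1)^N z_k^M\prod_{j=1}^N(1+\beta z_j)=0\qquad(1\le k\le N).$$ Its weight is $$w(\{z\}_N)=\Bigg(1+\sum_{j=1}^N\frac{\beta z_j}{M+(M-N)\beta z_j}\Bigg)^{-1}\prod_{\substack{j,k=1\\ j\ne k}}^N(z_j-z_k)\prod_{j=1}^N\frac{z_j^{1-N}(1+\beta z_j)}{M+(M-N)\beta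 z_j}.$$ Call $\beta$ nondegenerate if $(-\beta)^M\ne1$ and if, for every $(z_1,\dots,z_N)\in\mathbb C^N$ (repeated entries allowed) such that all $1+\beta z_j\ne0$ and the polynomial $\prod_{j=1}^N(X-z_j)$ divides $(1+\beta X)^N+(-1)^N\prod_{j=1}^N(1+\beta z_j)\,X^M$, all the numbers $M+(M-N)\beta z_j$ and the number $1+\sum_{j=1}^N\frac{\beta z_j}{M+(M-N)\beta z_j}$ are nonzero. Then all but finitely many $\beta\in\mathbb C$ are nondegenerate. For every nondegenerate $\beta$ the set of solutions of the Bethe equations is finite, and for all $\lambda,\mu$ with $M-N\ge\lambda_1\ge\dots\ge\lambda_N\ge0$ and $M-N\ge\mu_1\ge\dots\ge\mu_N\ge0$, $$\sum_{\{z\}_N}w(\{z\}_N)\,\overline G_\lambda(\boldsymbol z^{-1};\beta)\,G_\mu(\boldsymbol z;\beta)=\delta_{\lambda\mu},$$ where $\boldsymbol z^{-1}=(z_1^{-1},\dots,z_N^{-1})$ and the sum is over all solutions of the Bethe equations. -/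

import Mathlib

open Finset Polynomial

noncomputable section

/-- The product `∏_{1 ≤ j < k ≤ N} (z_j - z_k)`. -/
def differenceProduct {N : ℕ} (z : Fin N → ℂ) : ℂ :=
  ∏ j : Fin N, ∏ k ∈ Finset.Ioi j, (z j - z k)

/-- The Grothendieck polynomial
`G_lam(z; β) = det (z_j ^ (lam_k + N - k) * (1 + β z_j) ^ (k - 1)) / ∏_{j < k} (z_j - z_k)`,
evaluated at pairwise distinct points. (Indices start at `0` here, at `1` in the formula.) -/
def grothendieck {N : ℕ} (lam : Fin N → ℕ) (z : Fin N → ℂ) (β : ℂ) : ℂ :=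
  (Matrix.of fun j k : Fin N =>
    z j ^ (lam k + (N - 1 - (k : ℕ))) * (1 + β * z j) ^ (k : ℕ)).det / differenceProduct z

/-- The dual Grothendieck polynomial
`det (z_j ^ (lam_k + N - k) * (1 + β z_j⁻¹) ^ (1 - k)) / ∏_{j < k} (z_j - z_k)`,
evaluated at pairwise distinct points. (Indices start at `0` here, at `1` in the formula.) -/
def dualGrothendieck {N : ℕ} (lam : Fin N → ℕ) (z : Fin N → ℂ) (β : ℂ) : ℂ :=
  (Matrix.of fun j k : Fin N =>
    z j ^ (lam k + (N - 1 - (k : ℕ))) * (1 + β * (z j)⁻¹) ^ (-((k : ℕ) : ℤ))).det /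
      differenceProduct z

/-- The factor `M + (M - N) β x`. -/
def betheDenominator (N M : ℕ) (β x : ℂ) : ℂ :=
  (M : ℂ) + ((M : ℂ) - (N : ℂ)) * β * x

/-- The factor `1 + ∑_j β z_j / (M + (M - N) β z_j)`. -/
def betheSumFactor {N : ℕ} (M : ℕ) (β : ℂ) (z : Fin N → ℂ) : ℂ :=
  1 + ∑ j, β * z j / betheDenominator N M β (z j)

/-- The weight `w(z)` of a solution of the Bethe equations. -/
def betheWeight {N : ℕ} (M : ℕ) (β : ℂ) (z : Fin N → ℂ) : ℂ :=
  (betheSumFactor M β z)⁻¹ *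
    (∏ j : Fin N, ∏ k ∈ Finset.univ.erase j, (z j - z k)) *
    ∏ j, z j ^ (1 - (N : ℤ)) * (1 + β * z j) / betheDenominator N M β (z j)

/-- A solution of the Bethe equations: a set of `N` (distinct) complex numbers `z` with
`1 + β z ≠ 0` and `(1 + β z) ^ N + (-1) ^ N z ^ M ∏_{y} (1 + β y) = 0`. -/
structure IsBetheSolution (N M : ℕ) (β : ℂ) (Z : Finset ℂ) : Prop where
  card_eq : Z.card = N
  regular : ∀ z ∈ Z, 1 + β * z ≠ 0
  equation : ∀ z ∈ Z, (1 + β * z) ^ N + (-1) ^ N * z ^ M * ∏ y ∈ Z, (1 + β * y) = 0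

/-- The set of all solutions of the Bethe equations. -/
def betheSolutions (N M : ℕ) (β : ℂ) : Set (Finset ℂ) :=
  {Z | IsBetheSolution N M β Z}

/-- The points `z_1, …, z_N` of a solution, listed in some order. Everything that is evaluated at
such a list below is symmetric in `z_1, …, z_N`. -/
def bethePoints {N M : ℕ} {β : ℂ} (Z : betheSolutions N M β) : Fin N → ℂ :=
  fun j => ((Z.1.equivFinOfCardEq Z.2.card_eq).symm j : ℂ)

/-- The polynomial `(1 + β X) ^ N + (-1) ^ N (∏_j (1 + β z_j)) X ^ M`. The Bethe equations say that
it vanishes at `z_1, …, z_N`. -/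
def bethePolynomial {N : ℕ} (M : ℕ) (β : ℂ) (z : Fin N → ℂ) : ℂ[X] :=
  (1 + C β * X) ^ N + C ((-1) ^ N * ∏ j, (1 + β * z j)) * X ^ M

/-- `β` is nondegenerate. First, `(-β) ^ M ≠ 1`. Second, the denominators of the weight do not
vanish at any solution `(z_1, …, z_N)` of the Bethe equations with `1 + β z_j ≠ 0`, where
solutions with repeated entries are admitted if each `z_j` is a root of the Bethe polynomial with
at least the multiplicity with which it occurs in the list. -/
structure BetheNondegenerate (N M : ℕ) (β : ℂ) : Prop where
  pow_ne_one : (-β) ^ M ≠ 1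
  denominators_ne_zero : ∀ z : Fin N → ℂ, (∀ j, 1 + β * z j ≠ 0) →
    (∏ j, (X - C (z j))) ∣ bethePolynomial M β z →
      (∀ j, betheDenominator N M β (z j) ≠ 0) ∧ betheSumFactor M β z ≠ 0

theorem differenceProduct_eq {N : ℕ} (z : Fin N → ℂ) :
    differenceProduct z = (∏ j : Fin N, ∏ _k ∈ Finset.Ioi j, (-1 : ℂ)) *
      (Matrix.vandermonde z).det := by
  rw [Matrix.det_vandermonde, differenceProduct, ← Finset.prod_mul_distrib]
  refine Finset.prod_congr rfl fun j _ => ?_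
  rw [← Finset.prod_mul_distrib]
  exact Finset.prod_congr rfl fun _ _ => by ring

theorem differenceProduct_perm {N : ℕ} (z : Fin N → ℂ) (σ : Equiv.Perm (Fin N)) :
    differenceProduct (z ∘ σ) = ((Equiv.Perm.sign σ : ℤ) : ℂ) * differenceProduct z := by
  rw [differenceProduct_eq, differenceProduct_eq]
  have h : Matrix.vandermonde (z ∘ σ) = (Matrix.vandermonde z).submatrix σ id := by
    ext i j; simp [Matrix.vandermonde]
  rw [h, Matrix.det_permute]
  ring

theorem sign_ne_zero_complex {N : ℕ} (σ : Equiv.Perm (Fin N)) :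
    ((Equiv.Perm.sign σ : ℤ) : ℂ) ≠ 0 := by
  exact_mod_cast (Equiv.Perm.sign σ).ne_zero

theorem grothendieck_perm {N : ℕ} (lam : Fin N → ℕ) (z : Fin N → ℂ) (β : ℂ)
    (σ : Equiv.Perm (Fin N)) : grothendieck lam (z ∘ σ) β = grothendieck lam z β := by
  unfold grothendieck
  rw [differenceProduct_perm, ← mul_div_mul_left _ (differenceProduct z) (sign_ne_zero_complex σ),
    ← Matrix.det_permute]
  rfl

theorem dualGrothendieck_perm {N : ℕ} (lam : Fin N → ℕ) (z : Fin N → ℂ) (β : ℂ)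
    (σ : Equiv.Perm (Fin N)) : dualGrothendieck lam (z ∘ σ) β = dualGrothendieck lam z β := by
  unfold dualGrothendieck
  rw [differenceProduct_perm, ← mul_div_mul_left _ (differenceProduct z) (sign_ne_zero_complex σ),
    ← Matrix.det_permute]
  rfl

theorem betheWeight_perm {N : ℕ} (M : ℕ) (β : ℂ) (z : Fin N → ℂ) (σ : Equiv.Perm (Fin N)) :
    betheWeight M β (z ∘ σ) = betheWeight M β z := by
  have h1 : betheSumFactor M β (z ∘ σ) = betheSumFactor M β z := by
    unfold betheSumFactor
    congr 1
    exact Equiv.sum_comp σ fun j => β * z j / betheDenominator N M β (z j)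
  have h2 : (∏ j : Fin N, ∏ k ∈ Finset.univ.erase j, ((z ∘ σ) j - (z ∘ σ) k)) =
      ∏ j : Fin N, ∏ k ∈ Finset.univ.erase j, (z j - z k) := by
    rw [← Equiv.prod_comp σ fun j => ∏ k ∈ Finset.univ.erase j, (z j - z k)]
    refine Finset.prod_congr rfl fun j _ => ?_
    exact Finset.prod_bij (fun k _ => σ k) (by simp) (by simp)
      (fun k hk => ⟨σ.symm k, by simpa [Equiv.symm_apply_eq] using hk, by simp⟩) (by simp)
  unfold betheWeight
  rw [h1, h2]
  congr 1
  exact Equiv.prod_comp σ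
    fun j => z j ^ (1 - (N : ℤ)) * (1 + β * z j) / betheDenominator N M β (z j)

end

/-!
The Bethe equations are read in the variables `y = z⁻¹`. For `c = ∏ (1 + β z_j)` they say that
every `y_j` is a root of `f + (-1) ^ N c`, where `f = X ^ (M - N) (X + β) ^ N` is the
`bethePotential`, and that `c ∏ y_j = ∏ (y_j + β)`. So the solutions of level `c` are the
`N`-element subsets `S` of the `M` roots of `f + (-1) ^ N c` whose `twist`, the function
`c ∏_{i ∈ S} y_i / (y_i + β)`, is `1`.

The numerators of the two Grothendieck polynomials are, up to powers of `y_j` and `y_j + β`, the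
determinants of `leftPoly` and `rightPoly` at the `y_j`. These powers, the difference products and
the denominators `M + (M - N) β z_j` of the weight combine to `1 / ∏ f'(y_j)`, and the factor
`1 + ∑ β z_j / (M + (M - N) β z_j)` is `c` times the derivative of the twist with respect to `c`.
Hence the sum over the solutions is the sum of the residues at the nonzero levels
(`tendsto_sub_mul_betheResolvent`, `weight_mul_eq_betheSummand`) of the `betheResolvent`

  `H(c) = ∑_S (product of the two minors at S) / ∏_{i ∈ S} f'(y_i) / (twist - 1)`,

which is a rational function of `c`, being symmetric in the roots. Nondegeneracy makes the roots in
a subset with twist `1` simple and the pole of its term simple. At the other subsets colliding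
roots do no harm: a colliding root is double, since `f` has only one critical point with a nonzero
value, which is nondegenerate, so that the minors over `∏ f'` grow more slowly than the inverse of
the increment of `c` (`tendsto_sub_mul_levelTerm`).

At level `0` there is no residue either (`tendsto_mul_betheResolvent_zero`). The sums
`∑_S (minors / ∏ f') * twist ^ m` are polynomials in `c`, since by Cauchy--Binet they are
determinants of traces `∑_i g(y_i) / f'(y_i)`; by the geometric series the terms of `H` may
therefore be multiplied by a high power of the twist. Then a subset with a root near `0` contributes
nothing because its twist is small, and the only other subset, that of the `N` roots near `-β`,
has a bounded numerator and a twist near `(-β) ^ M ≠ 1`.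

By the residue theorem on the sphere (`sum_residues_eq_of_tendsto`) the sum is the limit of
`c H(c)` at infinity (`tendsto_mul_betheResolvent`). Expanding in powers of `1 / twist`, only the
first term survives, and Cauchy--Binet turns it into a determinant of limits of traces. Its entry
`(k, l)` vanishes for degree reasons if `λ_k - k < μ_l - l`, it vanishes as the trace of a multiple
of `f` if `k ≤ l` and `μ_l < λ_k`, and it is `1` if `k = l` and `λ_k = μ_k`. Such a determinant is
`δ_{λμ}` (`det_eq_ite_of_comparison`).

That only finitely many `β` are degenerate (`finite_degenerate`) follows by scaling. For `β ≠ 0`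
the substitution `y = β v` turns the roots into those of the potential for `β = 1` at the level
`κ = c / β ^ M`. The vanishing of a denominator makes a symmetric polynomial function of these
roots vanish, which is a nonzero polynomial in `κ`; and for each of its finitely many zeros `κ`
the `N` chosen roots determine `c`, hence `β ^ M`.
-/

noncomputable section

/-! ### Residues on the Riemann sphere -/

open Filter Topology Bornology in
/-- Liouville for a function with removable singularities that vanishes at infinity. Its values at
the singularities are arbitrary. -/
theorem eq_zero_of_removable_of_tendsto_zero (B : Finset ℂ) : ∀ k : ℂ → ℂ,
    (∀ c ∉ B, DifferentiableAt ℂ k c) →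
    (∀ b ∈ B, Tendsto (fun c => (c - b) * k c) (𝓝[≠] b) (𝓝 0)) →
    Tendsto k (cobounded ℂ) (𝓝 0) → ∀ c ∉ B, k c = 0 := by
  induction B using Finset.induction_on with
  | empty =>
    intro k hd _ h0 c _
    have hd' : Differentiable ℂ k := fun c => hd c (by simp)
    rw [Metric.cobounded_eq_cocompact] at h0
    exact hd'.apply_eq_of_tendsto_cocompact c h0
  | insert b B hb ih =>
    intro k hd hres h0 c hc
    set k' := Function.update k b (limUnder (𝓝[≠] b) k) with hk'
    have hne : ∀ x, x ≠ b → k' =ᶠ[𝓝 x] k := fun x hx => by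
      filter_upwards [isOpen_ne.mem_nhds hx] with w hw
      simp [hk', Function.update_of_ne hw]
    have hcl : ((B : Set ℂ)ᶜ) ∈ 𝓝 b := B.finite_toSet.isClosed.isOpen_compl.mem_nhds (by simpa)
    have hdiff : DifferentiableOn ℂ k' ((B : Set ℂ)ᶜ) := by
      apply Complex.differentiableOn_update_limUnder_of_isLittleO hcl
      · intro x hx
        refine (hd x ?_).differentiableWithinAt
        simp only [Finset.mem_insert, not_or]
        exact ⟨hx.2, by simpa using hx.1⟩
      · have h1 := hres b (by simp)
        have h2 : Tendsto (fun c => (c - b) * k b) (𝓝[≠] b) (𝓝 0) := by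
          have : Tendsto (fun c => (c - b) * k b) (𝓝 b) (𝓝 ((b - b) * k b)) := by
            apply Continuous.tendsto; fun_prop
          simpa using this.mono_left nhdsWithin_le_nhds
        rw [Asymptotics.isLittleO_iff_tendsto']
        · have h3 := h1.sub h2
          simp only [sub_zero] at h3
          refine h3.congr fun x => ?_
          rw [div_inv_eq_mul]; ring
        · filter_upwards [self_mem_nhdsWithin] with x hx h
          simp [sub_eq_zero] at h
          exact absurd h hx
    have key := ih k' (fun x hx => (hdiff.differentiableAt
        (B.finite_toSet.isClosed.isOpen_compl.mem_nhds (by simpa)))) ?_ ?_ c ?_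
    · simp only [Finset.mem_insert, not_or] at hc
      simpa [hk', Function.update_of_ne hc.1] using key
    · intro x hx
      have hxb : x ≠ b := fun h => hb (h ▸ hx)
      refine (hres x (by simp [hx])).congr' ?_
      filter_upwards [nhdsWithin_le_nhds (hne x hxb)] with w hw
      rw [hw]
    · refine h0.congr' ?_
      have : ∀ᶠ x in cobounded ℂ, x ∈ ({b} : Set ℂ)ᶜ := by
        exact Bornology.isBounded_singleton (x := b)
      filter_upwards [this] with x hx
      simp [hk', Function.update_of_ne (show x ≠ b from hx)]
    · simp only [Finset.mem_insert, not_or] at hc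
      exact hc.2

open Filter Topology Bornology in
/-- The residue theorem on the Riemann sphere for a function with at most simple poles: the residues
at the finite poles add up to the limit of `c * H c` at infinity. -/
theorem sum_residues_eq_of_tendsto (B : Finset ℂ) (H : ℂ → ℂ) (ρ : ℂ → ℂ) (l : ℂ)
    (hd : ∀ c ∉ B, DifferentiableAt ℂ H c)
    (hres : ∀ b ∈ B, Tendsto (fun c => (c - b) * H c) (𝓝[≠] b) (𝓝 (ρ b)))
    (hinf : Tendsto (fun c => c * H c) (cobounded ℂ) (𝓝 l)) :
    ∑ b ∈ B, ρ b = l := by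
  have hinv : ∀ b : ℂ, Tendsto (fun c => (c - b)⁻¹) (cobounded ℂ) (𝓝 0) := fun b =>
    tendsto_inv₀_cobounded.comp (by
      simp only [sub_eq_add_neg]
      exact tendsto_add_const_cobounded (-b))
  have hB : ∀ᶠ c in cobounded ℂ, c ∉ B := B.finite_toSet.isBounded
  have hH0 : Tendsto H (cobounded ℂ) (𝓝 0) := by
    have := (hinv 0).mul hinf
    rw [zero_mul] at this
    refine this.congr' ?_
    have : ∀ᶠ x in cobounded ℂ, x ∈ ({0} : Set ℂ)ᶜ := Bornology.isBounded_singleton (x := (0:ℂ))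
    filter_upwards [this] with c hc
    have : c ≠ 0 := hc
    field_simp
    simp
  have hz := eq_zero_of_removable_of_tendsto_zero B
    (fun c => H c - ∑ b ∈ B, ρ b * (c - b)⁻¹) ?_ ?_ ?_
  · have h1 : Tendsto (fun c => ∑ b ∈ B, ρ b * (1 + b * (c - b)⁻¹)) (cobounded ℂ)
        (𝓝 (∑ b ∈ B, ρ b * (1 + b * 0))) :=
      tendsto_finsetSum _ fun b _ => ((hinv b).const_mul b |>.const_add 1).const_mul _
    simp only [mul_zero, add_zero, mul_one] at h1
    refine tendsto_nhds_unique (h1.congr' ?_) hinf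
    filter_upwards [hB] with c hc
    have := hz c hc
    rw [sub_eq_zero] at this
    rw [this, Finset.mul_sum]
    refine Finset.sum_congr rfl fun b hb => ?_
    have : c - b ≠ 0 := sub_ne_zero.2 fun h => hc (h ▸ hb)
    field_simp
    ring
  · intro c hc
    refine (hd c hc).sub (DifferentiableAt.fun_sum fun b hb => ?_)
    have : c - b ≠ 0 := sub_ne_zero.2 fun h => hc (h ▸ hb)
    fun_prop (disch := assumption)
  · intro b hb
    have h1 : Tendsto (fun c => ∑ a ∈ B, ρ a * ((c - b) * (c - a)⁻¹)) (𝓝[≠] b)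
        (𝓝 (∑ a ∈ B, if a = b then ρ b else 0)) := by
      refine tendsto_finsetSum _ fun a _ => ?_
      split_ifs with hab
      · subst hab
        refine (tendsto_const_nhds (x := ρ a)).congr' ?_
        filter_upwards [self_mem_nhdsWithin] with c hc
        rw [mul_inv_cancel₀ (sub_ne_zero.2 hc), mul_one]
      · have : ContinuousAt (fun c => ρ a * ((c - b) * (c - a)⁻¹)) b := by
          have : b - a ≠ 0 := sub_ne_zero.2 (Ne.symm hab)
          fun_prop (disch := assumption)
        have h := this.tendsto
        simp only [sub_self, zero_mul, mul_zero] at h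
        exact h.mono_left nhdsWithin_le_nhds
    rw [Finset.sum_ite_eq' B b, if_pos hb] at h1
    have h2 := (hres b hb).sub h1
    rw [sub_self] at h2
    refine h2.congr fun c => ?_
    rw [mul_sub, Finset.mul_sum]
    congr 1
    exact Finset.sum_congr rfl fun a _ => by ring
  · have : Tendsto (fun c => ∑ b ∈ B, ρ b * (c - b)⁻¹) (cobounded ℂ) (𝓝 (∑ b ∈ B, ρ b * 0)) :=
      tendsto_finsetSum _ fun b _ => (hinv b).const_mul _
    simpa using hH0.sub this

/-! ### Determinants and symmetric functions -/

/-- Cauchy--Binet, with each product of two minors written as a single determinant. -/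
theorem sum_powersetCard_det_eq {R ι : Type*} [CommRing R] [Fintype ι] [DecidableEq ι] {N : ℕ}
    (a b : Fin N → ι → R) :
    ∑ S ∈ (univ : Finset ι).powersetCard N,
      (Matrix.of fun k l => ∑ i ∈ S, a k i * b l i).det =
      (Matrix.of fun k l => ∑ i, a k i * b l i).det := by
  set g : (Fin N → ι) → R := fun p => (Matrix.of fun k l => a k (p l)).det * ∏ l, b l (p l) with hg
  have key : ∀ S : Finset ι, (Matrix.of fun k l => ∑ i ∈ S, a k i * b l i).det =
      ∑ p : Fin N → ι, if ∀ l, p l ∈ S then g p else 0 := by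
    intro S
    rw [← Finset.sum_filter]
    have hS : (univ.filter fun p : Fin N → ι => ∀ l, p l ∈ S) = Fintype.piFinset fun _ => S := by
      ext p; simp
    rw [hS, Matrix.det_apply]
    simp only [Matrix.of_apply]
    simp_rw [Finset.prod_univ_sum, hg, Matrix.det_apply, Matrix.of_apply, Finset.sum_mul]
    rw [Finset.sum_comm]
    refine Finset.sum_congr rfl fun σ _ => ?_
    rw [Finset.smul_sum]
    refine Finset.sum_congr rfl fun p _ => ?_
    rw [Finset.prod_mul_distrib, smul_mul_assoc]
  have hinj : ∀ p : Fin N → ι, ¬ Function.Injective p → g p = 0 := by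
    intro p hp
    simp only [Function.Injective, not_forall] at hp
    obtain ⟨i, j, hij, hne⟩ := hp
    simp only [hg]
    rw [Matrix.det_zero_of_column_eq hne (fun k => by simp [hij]), zero_mul]
  rw [Finset.sum_congr rfl fun S _ => key S, Finset.sum_comm]
  have hu := key univ
  simp only [Finset.mem_univ] at hu
  rw [hu]
  refine Finset.sum_congr rfl fun p _ => ?_
  by_cases hp : Function.Injective p
  · rw [Finset.sum_eq_single (univ.image p)]
    · simp
    · intro S hS hne
      rw [if_neg]
      intro h
      refine hne (Finset.eq_of_subset_of_card_le (fun x hx => ?_) ?_).symm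
      · obtain ⟨l, _, rfl⟩ := Finset.mem_image.1 hx
        exact h l
      · rw [(Finset.mem_powersetCard.1 hS).2, Finset.card_image_of_injective _ hp]; simp
    · intro h
      exact absurd (Finset.mem_powersetCard.2 ⟨Finset.subset_univ _, by
        rw [Finset.card_image_of_injective _ hp]; simp⟩) h
  · simp [hinj p hp]

/-- A symmetric polynomial in the roots of `f + a c`, for a fixed monic `f`, is a polynomial
in `c`. -/
theorem exists_polynomial_eq_eval_roots {M : ℕ} (f : ℂ[X]) (a : ℂ) (p : MvPolynomial (Fin M) ℂ)
    (hp : p.IsSymmetric) :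
    ∃ R : ℂ[X], ∀ (c : ℂ) (y : Fin M → ℂ), f + C (a * c) = ∏ i, (X - C (y i)) →
      MvPolynomial.eval y p = R.eval c := by
  obtain ⟨q, hq⟩ := MvPolynomial.esymmAlgHom_fin_surjective (n := M) (R := ℂ) le_rfl
    ⟨p, (MvPolynomial.mem_symmetricSubalgebra p).2 hp⟩
  have hq' : MvPolynomial.aeval (fun i : Fin M => MvPolynomial.esymm (Fin M) ℂ (i + 1)) q = p := by
    rw [← MvPolynomial.esymmAlgHom_apply, hq]
  refine ⟨MvPolynomial.aeval (fun i : Fin M => C ((-1) ^ ((i : ℕ) + 1)) *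
    (C (f.coeff (M - (i + 1))) + if M - ((i : ℕ) + 1) = 0 then C a * X else 0)) q, fun c y h => ?_⟩
  have hes : ∀ i : Fin M, MvPolynomial.eval y (MvPolynomial.esymm (Fin M) ℂ (i + 1)) =
      (-1) ^ ((i : ℕ) + 1) *
        (f.coeff (M - (i + 1)) + if M - ((i : ℕ) + 1) = 0 then a * c else 0) := by
    intro i
    have h1 := MvPolynomial.aeval_esymm_eq_multiset_esymm (Fin M) ℂ (S := ℂ) ((i : ℕ) + 1) y
    have h2 := Multiset.prod_X_sub_C_coeff (univ.val.map y) (k := M - (i + 1)) (by simp)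
    have h3 : (Multiset.map (fun t => X - C t) (univ.val.map y)).prod = f + C (a * c) := by
      rw [h, Multiset.map_map]; rfl
    rw [h3] at h2
    simp only [Multiset.card_map, Finset.card_val, Finset.card_univ, Fintype.card_fin] at h2
    rw [show M - (M - ((i : ℕ) + 1)) = i + 1 by omega, ← h1] at h2
    rw [coeff_add, coeff_C] at h2
    rw [h2, ← mul_assoc, ← mul_pow, neg_one_mul, neg_neg, one_pow, one_mul,
      ← MvPolynomial.coe_aeval_eq_eval]
    rfl
  rw [← hq']
  clear hq hq'
  induction q using MvPolynomial.induction_on with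
  | C r => simp
  | add p q h1 h2 => simp only [map_add, eval_add, h1, h2]
  | mul_X p i h1 =>
    simp only [map_mul, eval_mul, h1, MvPolynomial.aeval_X, hes]
    split_ifs <;> simp

/-- The determinant of a matrix whose zero pattern comes from comparing two decreasing
sequences. -/
theorem det_eq_ite_of_comparison {N : ℕ} (lam mu : Fin N → ℕ) (hl : Antitone lam) (hm : Antitone mu)
    (A : Matrix (Fin N) (Fin N) ℂ)
    (hupper : ∀ k l, k ≤ l → mu l < lam k → A k l = 0)
    (hlower : ∀ k l, l < k → lam k ≤ mu l → A k l = 0)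
    (hdiag : ∀ k, lam k = mu k → A k k = 1) (hdiag' : ∀ k, lam k < mu k → A k k = 0) :
    A.det = if lam = mu then 1 else 0 := by
  -- a permutation with a nonzero contribution maps the indices with `mu < lam` to smaller ones
  have hterm : ∀ σ : Equiv.Perm (Fin N), (∏ i, A (σ i) i) ≠ 0 → ∀ i, σ i = i ∧ lam i = mu i := by
    intro σ hσ
    have hne : ∀ i, A (σ i) i ≠ 0 := fun i => Finset.prod_ne_zero_iff.1 hσ i (mem_univ i)
    have h1 : ∀ i, mu i < lam i → i < σ i := fun i hi => by
      by_contra hc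
      exact hne i (hupper _ _ (not_lt.1 hc) (hi.trans_le (hl (not_lt.1 hc))))
    have h2 : ∀ i, lam i ≤ mu i → σ i ≤ i := fun i hi => by
      by_contra hc
      exact hne i (hlower _ _ (not_le.1 hc) ((hl (not_le.1 hc).le).trans hi))
    have h3 : ∀ i, mu i < lam i → mu (σ i) < lam (σ i) := fun i hi => by
      by_contra hc
      refine hne i (hlower _ _ (h1 i hi) ?_)
      exact (not_lt.1 hc).trans (hm (h1 i hi).le)
    have h4 : ∀ i, ¬ mu i < lam i := by
      intro i hi
      have hstep : ∀ n : ℕ, mu ((σ ^ n) i) < lam ((σ ^ n) i) := by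
        intro n
        induction n with
        | zero => simpa
        | succ n ih => rw [pow_succ']; exact h3 _ ih
      have hgrow : StrictMono fun n : ℕ => (σ ^ n) i := by
        refine strictMono_nat_of_lt_succ fun n => ?_
        rw [pow_succ']
        exact h1 _ (hstep n)
      exact not_injective_infinite_finite _ hgrow.injective
    have h5 : ∀ i, σ i ≤ i := fun i => h2 i (not_lt.1 (h4 i))
    have h6 : ∀ i, σ i = i := by
      intro i
      induction i using WellFoundedLT.induction with
      | _ i ih =>
        refine le_antisymm (h5 i) (not_lt.1 fun hi => ?_)
        exact hi.ne (σ.injective (ih _ hi))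
    intro i
    refine ⟨h6 i, le_antisymm (not_lt.1 (h4 i)) ?_⟩
    by_contra hc
    have := hne i
    rw [h6 i] at this
    exact this (hdiag' i (not_le.1 hc))
  rw [Matrix.det_apply]
  split_ifs with h
  · rw [Finset.sum_eq_single 1]
    · simp only [Equiv.Perm.sign_one, one_smul, Equiv.Perm.coe_one, id]
      exact Finset.prod_eq_one fun i _ => hdiag i (congrFun h i)
    · intro σ _ hσ
      by_contra hc
      exact hσ (Equiv.ext fun i => (hterm σ (fun h0 => hc (by rw [h0, smul_zero])) i).1)
    · simp
  · refine Finset.sum_eq_zero fun σ _ => ?_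
    by_contra hc
    exact h (funext fun i => (hterm σ (fun h0 => hc (by rw [h0, smul_zero])) i).2)

/-! ### Roots of a monic polynomial with varying constant term -/

theorem eval_derivative_of_eq_prod {M : ℕ} {f : ℂ[X]} {b : ℂ} {y : Fin M → ℂ}
    (h : f + C b = ∏ i, (X - C (y i))) (i : Fin M) :
    f.derivative.eval (y i) = ∏ j ∈ univ.erase i, (y i - y j) := by
  have h1 : f.derivative = (Lagrange.nodal univ y).derivative := by
    rw [Lagrange.nodal, ← h]; simp
  rw [h1, Lagrange.eval_nodal_derivative_eval_node_eq (mem_univ i), Lagrange.eval_nodal]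

theorem eval_of_eq_prod {M : ℕ} {f : ℂ[X]} {b : ℂ} {y : Fin M → ℂ}
    (h : f + C b = ∏ i, (X - C (y i))) (i : Fin M) : f.eval (y i) = -b := by
  have h1 := congrArg (eval (y i)) h
  rw [eval_prod, Finset.prod_eq_zero (mem_univ i) (by simp)] at h1
  simp only [eval_add, eval_C] at h1
  linear_combination h1

theorem exists_of_eval_eq {M : ℕ} {f : ℂ[X]} {b : ℂ} {y : Fin M → ℂ}
    (h : f + C b = ∏ i, (X - C (y i))) {w : ℂ} (hw : f.eval w = -b) : ∃ i, y i = w := by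
  have h1 := congrArg (eval w) h
  rw [eval_prod, eval_add, eval_C, hw, neg_add_cancel, eq_comm, Finset.prod_eq_zero_iff] at h1
  obtain ⟨i, _, hi⟩ := h1
  refine ⟨i, ?_⟩
  simp only [eval_sub, eval_X, eval_C] at hi
  linear_combination -hi

theorem injective_of_eval_derivative_ne_zero {M : ℕ} {f : ℂ[X]} {b : ℂ} {y : Fin M → ℂ}
    (h : f + C b = ∏ i, (X - C (y i))) {i j : Fin M} (hi : f.derivative.eval (y i) ≠ 0)
    (hij : y i = y j) : i = j := by
  by_contra hne
  refine hi ?_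
  rw [eval_derivative_of_eq_prod h]
  exact Finset.prod_eq_zero (Finset.mem_erase.2 ⟨Ne.symm hne, mem_univ j⟩) (by rw [hij, sub_self])

theorem exists_eq_prod_X_sub_C {M : ℕ} (hM : 1 ≤ M) {f : ℂ[X]} (hf : f.Monic)
    (hdeg : f.natDegree = M) (b : ℂ) : ∃ y : Fin M → ℂ, f + C b = ∏ i, (X - C (y i)) := by
  have hlt : (C b : ℂ[X]).degree < f.degree :=
    degree_C_le.trans_lt (natDegree_pos_iff_degree_pos.1 (by omega))
  have hmon : (f + C b).Monic := hf.add_of_left hlt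
  have hd : (f + C b).natDegree = M := by rw [natDegree_add_C, hdeg]
  have hsp := IsAlgClosed.splits (f + C b)
  have hcard : Multiset.card (f + C b).roots = M := by
    rw [← hd]; exact hsp.natDegree_eq_card_roots.symm
  have h1 := hsp.eq_prod_roots_of_monic hmon
  obtain ⟨l, hl⟩ := Quotient.exists_rep (f + C b).roots
  rw [← hl] at hcard h1
  obtain rfl : l.length = M := hcard
  refine ⟨l.get, ?_⟩
  rw [h1]
  have h2 : (⟦l⟧ : Multiset ℂ) = univ.val.map l.get := by
    rw [Fin.univ_val_map, List.ofFn_get]; rfl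
  rw [h2, Multiset.map_map]
  rfl

section Trace

variable {M : ℕ} {f : ℂ[X]}

/-- A trace `∑ g(y) / f'(y)` of low degree is a coefficient, by Lagrange interpolation. -/
theorem sum_eval_div_of_degree_lt {b : ℂ} {y : Fin M → ℂ}
    (h : f + C b = ∏ i, (X - C (y i))) (hy : Function.Injective y) {g : ℂ[X]}
    (hg : g.degree < M) :
    ∑ i, g.eval (y i) / f.derivative.eval (y i) = g.coeff (M - 1) := by
  have := Lagrange.coeff_eq_sum (s := (univ : Finset (Fin M))) (v := y) hy.injOn (P := g) (by simpa)
  simp only [Finset.card_univ, Fintype.card_fin] at this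
  rw [this]
  exact Finset.sum_congr rfl fun i _ => by rw [eval_derivative_of_eq_prod h]

/-- Division with remainder by `f`, which is the constant `-b` at the roots. -/
theorem sum_eval_div_step (hf : f.Monic) (hdeg : f.natDegree = M) {b : ℂ}
    {y : Fin M → ℂ} (h : f + C b = ∏ i, (X - C (y i))) (hy : Function.Injective y) (g : ℂ[X]) :
    ∑ i, g.eval (y i) / f.derivative.eval (y i) =
      -b * (∑ i, (g /ₘ f).eval (y i) / f.derivative.eval (y i)) + (g %ₘ f).coeff (M - 1) := by
  rw [← sum_eval_div_of_degree_lt h hy (g := g %ₘ f), Finset.mul_sum, ← Finset.sum_add_distrib]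
  · refine Finset.sum_congr rfl fun i _ => ?_
    have h1 := congrArg (eval (y i)) (modByMonic_add_div g f)
    simp only [eval_add, eval_mul, eval_of_eq_prod h] at h1
    rw [← h1]; ring
  · refine (degree_modByMonic_lt g hf).trans_le ?_
    rw [← hdeg]; exact degree_le_natDegree

/-- The trace `∑ g(y) / f'(y)` over the roots `y` of `f + a c` depends polynomially on `c`. -/
theorem exists_polynomial_eq_sum_eval_div (hM : 1 ≤ M) (hf : f.Monic) (hdeg : f.natDegree = M)
    (a : ℂ) (g : ℂ[X]) : ∃ R : ℂ[X], ∀ (c : ℂ) (y : Fin M → ℂ), f + C (a * c) = ∏ i, (X - C (y i)) →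
      Function.Injective y → ∑ i, g.eval (y i) / f.derivative.eval (y i) = R.eval c := by
  induction hn : g.natDegree using Nat.strong_induction_on generalizing g with
  | _ n ih =>
    by_cases hlt : g.natDegree < M
    · refine ⟨C (g.coeff (M - 1)), fun c y h hy => ?_⟩
      rw [sum_eval_div_of_degree_lt h hy, eval_C]
      exact degree_le_natDegree.trans_lt (by exact_mod_cast hlt)
    · obtain ⟨R, hR⟩ := ih (g /ₘ f).natDegree (by rw [natDegree_divByMonic g hf]; omega) _ rfl
      refine ⟨C (-a) * X * R + C ((g %ₘ f).coeff (M - 1)), fun c y h hy => ?_⟩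
      rw [sum_eval_div_step hf hdeg h hy, hR c y h hy]
      simp only [eval_add, eval_mul, eval_C, eval_X]; ring

/-- Up to degree `2 M - 2` the trace `∑ g / f'` does not depend on the level `b`. -/
theorem sum_eval_div_of_natDegree_le (hM : 1 ≤ M) (hf : f.Monic) (hdeg : f.natDegree = M) {b : ℂ}
    {y : Fin M → ℂ} (h : f + C b = ∏ i, (X - C (y i))) (hy : Function.Injective y) {g : ℂ[X]}
    (hg : g.natDegree ≤ 2 * M - 2) :
    ∑ i, g.eval (y i) / f.derivative.eval (y i) = (g %ₘ f).coeff (M - 1) := by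
  have hd : (g /ₘ f).natDegree < M - 1 ∨ g /ₘ f = 0 := by
    rw [natDegree_divByMonic g hf]
    by_cases h1 : M = 1
    · right
      rw [divByMonic_eq_zero_iff hf]
      refine degree_lt_degree ?_
      omega
    · left; omega
  rw [sum_eval_div_step hf hdeg h hy, sum_eval_div_of_degree_lt h hy]
  · rw [show (g /ₘ f).coeff (M - 1) = 0 from ?_]
    · ring
    · rcases hd with hd | hd
      · exact coeff_eq_zero_of_natDegree_lt hd
      · simp [hd]
  · rcases hd with hd | hd
    · exact degree_le_natDegree.trans_lt (by exact_mod_cast (by omega))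
    · rw [hd, degree_zero]; exact WithBot.bot_lt_coe M

end Trace

/-! ### The polynomial whose level sets contain the inverse Bethe roots -/

/-- The polynomial `X ^ (M - N) (X + β) ^ N`. In the variables `y = z⁻¹` the Bethe equations say
that it takes the value `-(-1) ^ N c` at every `y`, where `c = ∏ (1 + β z)`. -/
def bethePotential (N M : ℕ) (β : ℂ) : ℂ[X] := X ^ (M - N) * (X + C β) ^ N

/-- `y` lists, with multiplicities, the roots of `bethePotential N M β + (-1) ^ N c`. -/
def IsLevelList (N M : ℕ) (β c : ℂ) (y : Fin M → ℂ) : Prop :=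
  bethePotential N M β + C ((-1) ^ N * c) = ∏ i, (X - C (y i))

variable {N M : ℕ} {β c : ℂ} {y : Fin M → ℂ}

theorem bethePotential_monic (N M : ℕ) (β : ℂ) : (bethePotential N M β).Monic :=
  (monic_X_pow _).mul ((monic_X_add_C β).pow N)

theorem natDegree_bethePotential (hNM : N ≤ M) : (bethePotential N M β).natDegree = M := by
  rw [bethePotential, (monic_X_pow _).natDegree_mul ((monic_X_add_C β).pow N), natDegree_X_pow,
    (monic_X_add_C β).natDegree_pow, natDegree_X_add_C]
  omega

theorem eval_bethePotential (w : ℂ) :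
    (bethePotential N M β).eval w = w ^ (M - N) * (w + β) ^ N := by
  simp [bethePotential]

theorem exists_isLevelList (hN : 1 ≤ N) (hNM : N ≤ M) (β c : ℂ) :
    ∃ y : Fin M → ℂ, IsLevelList N M β c y :=
  exists_eq_prod_X_sub_C (hN.trans hNM) (bethePotential_monic N M β)
    (natDegree_bethePotential hNM) _

/-- `M w + (M - N) β`, the denominator of the weight in the variable `w = z⁻¹`. -/
def invDenominator (N M : ℕ) (β w : ℂ) : ℂ := M * w + (M - N) * β

theorem mul_eval_derivative_bethePotential (hNM : N ≤ M) (w : ℂ) :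
    w * (w + β) * (bethePotential N M β).derivative.eval w =
      (bethePotential N M β).eval w * invDenominator N M β w := by
  obtain ⟨L, rfl⟩ := Nat.exists_eq_add_of_le hNM
  simp only [bethePotential, derivative_mul, derivative_pow, derivative_add,
    derivative_X, derivative_C, eval_add, eval_mul, eval_pow, eval_X, eval_C, invDenominator,
    add_tsub_cancel_left]
  rcases L with _ | L <;> rcases N with _ | N <;> simp <;> ring

theorem IsLevelList.pow_mul_pow (h : IsLevelList N M β c y) (i : Fin M) :
    y i ^ (M - N) * (y i + β) ^ N = -((-1) ^ N * c) := by
  rw [← eval_bethePotential]; exact eval_of_eq_prod h i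

theorem IsLevelList.prod_add (hN : 1 ≤ N) (h : IsLevelList N M β c y) :
    ∏ i, (y i + β) = (-1) ^ (M + N) * c := by
  have h1 := congrArg (eval (-β)) h
  rw [eval_prod, eval_add, eval_bethePotential, eval_C, neg_add_cancel, zero_pow (by omega),
    mul_zero, zero_add] at h1
  have h2 : ∏ i, (X - C (y i)).eval (-β) = (-1) ^ M * ∏ i, (y i + β) := by
    simp only [eval_sub, eval_X, eval_C]
    rw [show (-1 : ℂ) ^ M = ∏ _i : Fin M, (-1 : ℂ) by simp, ← Finset.prod_mul_distrib]
    exact Finset.prod_congr rfl fun i _ => by ring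
  rw [h2] at h1
  rw [pow_add, mul_assoc, h1, ← mul_assoc, ← mul_pow]
  simp

theorem IsLevelList.add_ne_zero (hN : 1 ≤ N) (hc : c ≠ 0) (h : IsLevelList N M β c y)
    (i : Fin M) : y i + β ≠ 0 := by
  intro h0
  have := h.pow_mul_pow i
  rw [h0, zero_pow (by omega), mul_zero, eq_comm, neg_eq_zero] at this
  simp [hc] at this

/-- The quotient `c ∏_{i ∈ S} y_i / ∏_{i ∈ S} (y_i + β)` in polynomial form. The Bethe equations for
the subset `S` of the level set say that it is `1`. -/
def twist (N : ℕ) {M : ℕ} (β : ℂ) (S : Finset (Fin M)) (y : Fin M → ℂ) : ℂ :=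
  (-1) ^ (M + N) * ((∏ i ∈ S, y i) * ∏ i ∈ Sᶜ, (y i + β))

theorem IsLevelList.twist_mul (hN : 1 ≤ N) (h : IsLevelList N M β c y) (S : Finset (Fin M)) :
    twist N β S y * ∏ i ∈ S, (y i + β) = c * ∏ i ∈ S, y i := by
  have h1 := h.prod_add hN
  rw [← Finset.prod_mul_prod_compl S] at h1
  have h2 : ((-1 : ℂ) ^ (M + N)) * (-1) ^ (M + N) = 1 := by rw [← mul_pow]; simp
  rw [twist]
  linear_combination ((-1 : ℂ) ^ (M + N) * ∏ i ∈ S, y i) * h1 + (c * ∏ i ∈ S, y i) * h2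

/-! ### High levels -/

open Filter Topology Bornology in
/-- All roots are large at a high level. -/
theorem eventually_lt_norm_levelList (N M : ℕ) (β : ℂ) (r : ℝ) :
    ∀ᶠ c in cobounded ℂ, ∀ y : Fin M → ℂ, IsLevelList N M β c y → ∀ i, r < ‖y i‖ := by
  obtain ⟨K, hK⟩ := (isCompact_closedBall (0 : ℂ) r).exists_bound_of_continuousOn
    (bethePotential N M β).continuous.continuousOn
  filter_upwards [(hasBasis_cobounded_norm (E := ℂ)).mem_of_mem (i := K + 1) trivial]
    with c hc y hy i
  by_contra hlt
  have h1 := hK (y i) (by simpa using hlt)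
  rw [eval_of_eq_prod hy] at h1
  simp only [norm_neg, norm_mul, norm_pow, norm_one, one_pow, one_mul] at h1
  have : K + 1 ≤ ‖c‖ := hc
  linarith

theorem invDenominator_ne_zero_of_lt (hN : 1 ≤ N) (hNM : N ≤ M) {w : ℂ} (hw : ‖β‖ < ‖w‖) :
    invDenominator N M β w ≠ 0 := by
  intro h
  rw [invDenominator, ← Nat.cast_sub hNM] at h
  have h1 : (M : ℝ) * ‖w‖ = ((M - N : ℕ) : ℝ) * ‖β‖ := by
    have := congrArg norm (eq_neg_of_add_eq_zero_left h)
    simpa using this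
  have h2 : ((M - N : ℕ) : ℝ) ≤ M := by exact_mod_cast Nat.sub_le _ _
  have h3 : (0 : ℝ) < M := by exact_mod_cast (by omega)
  nlinarith [norm_nonneg β]

theorem IsLevelList.eval_derivative_ne_zero (hNM : N ≤ M) (hc : c ≠ 0)
    (h : IsLevelList N M β c y) {i : Fin M} (hd : invDenominator N M β (y i) ≠ 0) :
    (bethePotential N M β).derivative.eval (y i) ≠ 0 := by
  intro h0
  have h1 := mul_eval_derivative_bethePotential (β := β) hNM (y i)
  rw [h0, mul_zero, eval_of_eq_prod h, eq_comm] at h1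
  simp [hc, hd] at h1

open Filter Topology Bornology in
/-- At a high level the twist grows at least linearly with the level. -/
theorem eventually_le_norm_twist (hN : 1 ≤ N) (β : ℂ) :
    ∀ᶠ c in cobounded ℂ, ∀ y : Fin M → ℂ, IsLevelList N M β c y →
      ∀ S ∈ (univ : Finset (Fin M)).powersetCard N, ‖c‖ ≤ 2 ^ N * ‖twist N β S y‖ := by
  filter_upwards [eventually_lt_norm_levelList N M β ‖β‖] with c hc y hy S hS
  have h1 := congrArg norm (hy.twist_mul hN S)
  rw [norm_mul, norm_mul] at h1
  have h0 : ∀ i, 0 < ‖y i‖ := fun i => (norm_nonneg β).trans_lt (hc y hy i)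
  have h2 : ‖∏ i ∈ S, (y i + β)‖ ≤ 2 ^ N * ‖∏ i ∈ S, y i‖ := by
    rw [← (Finset.mem_powersetCard.1 hS).2, ← Finset.prod_const, norm_prod, norm_prod,
      ← Finset.prod_mul_distrib]
    refine Finset.prod_le_prod (fun _ _ => norm_nonneg _) fun i _ => ?_
    have := norm_add_le (y i) β
    linarith [hc y hy i]
  have h3 : 0 < ‖∏ i ∈ S, y i‖ := by
    rw [norm_prod]; exact Finset.prod_pos fun i _ => h0 i
  have h4 := mul_le_mul_of_nonneg_left h2 (norm_nonneg (twist N β S y))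
  rw [h1] at h4
  nlinarith

open Filter Topology Bornology in
/-- At a high level the roots are simple and no subset solves the Bethe equations. -/
theorem eventually_generic (hN : 1 ≤ N) (hNM : N ≤ M) (β : ℂ) :
    ∀ᶠ c in cobounded ℂ, ∀ y : Fin M → ℂ, IsLevelList N M β c y →
      (∀ i, (bethePotential N M β).derivative.eval (y i) ≠ 0) ∧
      ∀ S ∈ (univ : Finset (Fin M)).powersetCard N, twist N β S y ≠ 1 := by
  filter_upwards [eventually_lt_norm_levelList N M β ‖β‖, eventually_le_norm_twist hN β,
    (hasBasis_cobounded_norm (E := ℂ)).mem_of_mem (i := 2 ^ N + 1) trivial] with c h1 h2 h3 y hy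
  have hc : (2 : ℝ) ^ N + 1 ≤ ‖c‖ := h3
  have hc0 : c ≠ 0 := by
    rintro rfl
    rw [norm_zero] at hc
    have : (0 : ℝ) < 2 ^ N := by positivity
    linarith
  refine ⟨fun i => hy.eval_derivative_ne_zero hNM hc0
    (invDenominator_ne_zero_of_lt hN hNM (h1 y hy i)), fun S hS h => ?_⟩
  have := h2 y hy S hS
  rw [h, norm_one] at this
  linarith

/-! ### Symmetric polynomial functions of the roots -/

/-- The algebra of polynomial functions on `ℂ ^ M`. -/
def coordinateAlgebra (M : ℕ) : Subalgebra ℂ ((Fin M → ℂ) → ℂ) :=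
  (MvPolynomial.aeval fun (i : Fin M) (y : Fin M → ℂ) => y i).range

theorem coord_mem (i : Fin M) : (fun y : Fin M → ℂ => y i) ∈ coordinateAlgebra M :=
  ⟨MvPolynomial.X i, by simp⟩

theorem const_mem (a : ℂ) : (fun _ : Fin M → ℂ => a) ∈ coordinateAlgebra M :=
  (coordinateAlgebra M).algebraMap_mem a

theorem sum_fun_mem {ι : Type*} {s : Finset ι} {F : ι → (Fin M → ℂ) → ℂ}
    (h : ∀ i ∈ s, F i ∈ coordinateAlgebra M) :
    (fun y => ∑ i ∈ s, F i y) ∈ coordinateAlgebra M := by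
  have := Subalgebra.sum_mem (coordinateAlgebra M) h
  convert this using 1
  ext y; simp

theorem prod_fun_mem {ι : Type*} {s : Finset ι} {F : ι → (Fin M → ℂ) → ℂ}
    (h : ∀ i ∈ s, F i ∈ coordinateAlgebra M) :
    (fun y => ∏ i ∈ s, F i y) ∈ coordinateAlgebra M := by
  have := Subalgebra.prod_mem (coordinateAlgebra M) h
  convert this using 1
  ext y; simp

theorem eval_mem (g : ℂ[X]) (i : Fin M) : (fun y : Fin M → ℂ => g.eval (y i)) ∈
    coordinateAlgebra M := by
  have : (fun y : Fin M → ℂ => g.eval (y i)) =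
      fun y => ∑ n ∈ range (g.natDegree + 1), g.coeff n * y i ^ n := by
    ext y; rw [eval_eq_sum_range]
  rw [this]
  exact sum_fun_mem fun n _ => Subalgebra.mul_mem _ (const_mem _)
    (Subalgebra.pow_mem _ (coord_mem i) n)

theorem det_fun_mem {n : ℕ} {A : Fin n → Fin n → (Fin M → ℂ) → ℂ}
    (h : ∀ k l, A k l ∈ coordinateAlgebra M) :
    (fun y => (Matrix.of fun k l => A k l y).det) ∈ coordinateAlgebra M := by
  simp only [Matrix.det_apply', Matrix.of_apply]
  exact sum_fun_mem fun σ _ => Subalgebra.mul_mem _ (const_mem _) (prod_fun_mem fun k _ => h _ _)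

theorem twist_mem (S : Finset (Fin M)) : twist N β S ∈ coordinateAlgebra M :=
  Subalgebra.mul_mem _ (const_mem _) (Subalgebra.mul_mem _ (prod_fun_mem fun i _ => coord_mem i)
    (prod_fun_mem fun i _ => Subalgebra.add_mem _ (coord_mem i) (const_mem β)))

/-- A symmetric polynomial function of the roots of `bethePotential N M β + (-1) ^ N c` is a
polynomial in `c`. -/
theorem exists_polynomial_of_symmetric {F : (Fin M → ℂ) → ℂ} (hF : F ∈ coordinateAlgebra M)
    (hs : ∀ (σ : Equiv.Perm (Fin M)) (y : Fin M → ℂ), F (y ∘ σ) = F y) (N : ℕ) (β : ℂ) :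
    ∃ R : ℂ[X], ∀ (c : ℂ) (y : Fin M → ℂ), IsLevelList N M β c y → F y = R.eval c := by
  obtain ⟨p, hp⟩ := hF
  have hev : ∀ y, MvPolynomial.eval y p = F y := by
    intro y
    rw [← hp]
    clear hp hs
    induction p using MvPolynomial.induction_on with
    | C r => simp
    | add p q h1 h2 => simp [h1, h2]
    | mul_X p i h1 => simp [h1]
  obtain ⟨R, hR⟩ := exists_polynomial_eq_eval_roots (bethePotential N M β) ((-1) ^ N) p
    (fun σ => MvPolynomial.funext fun y => by
      rw [MvPolynomial.eval_rename, hev, hev, hs])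
  exact ⟨R, fun c y hy => by rw [← hev, hR c y hy]⟩

theorem compl_map_perm (σ : Equiv.Perm (Fin M)) (S : Finset (Fin M)) :
    (S.map σ.toEmbedding)ᶜ = Sᶜ.map σ.toEmbedding := by
  ext i
  simp [Finset.mem_map_equiv]

theorem twist_comp_perm (σ : Equiv.Perm (Fin M)) (S : Finset (Fin M)) (y : Fin M → ℂ) :
    twist N β S (y ∘ σ) = twist N β (S.map σ.toEmbedding) y := by
  rw [twist, twist, compl_map_perm, Finset.prod_map, Finset.prod_map]
  rfl

theorem sum_powersetCard_map {R : Type*} [AddCommMonoid R] (σ : Equiv.Perm (Fin M))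
    (G : Finset (Fin M) → R) :
    ∑ S ∈ (univ : Finset (Fin M)).powersetCard N, G (S.map σ.toEmbedding) =
      ∑ S ∈ (univ : Finset (Fin M)).powersetCard N, G S :=
  Finset.sum_equiv (Equiv.finsetCongr σ) (fun S => by simp [Finset.mem_powersetCard])
    (fun S _ => rfl)

theorem prod_powersetCard_map {R : Type*} [CommMonoid R] (σ : Equiv.Perm (Fin M))
    (G : Finset (Fin M) → R) :
    ∏ S ∈ (univ : Finset (Fin M)).powersetCard N, G (S.map σ.toEmbedding) =
      ∏ S ∈ (univ : Finset (Fin M)).powersetCard N, G S :=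
  Finset.prod_equiv (Equiv.finsetCongr σ) (fun S => by simp [Finset.mem_powersetCard])
    (fun S _ => rfl)

/-! ### The resolvent -/

/-- The polynomial `y ^ λ_k (y + β) ^ (N - 1 - k)`. -/
def leftPoly (β : ℂ) (lam : Fin N → ℕ) (k : Fin N) : ℂ[X] :=
  X ^ lam k * (X + C β) ^ (N - 1 - (k : ℕ))

/-- The polynomial `y ^ (M - N - μ_l) (y + β) ^ l`. -/
def rightPoly (M : ℕ) (β : ℂ) (mu : Fin N → ℕ) (l : Fin N) : ℂ[X] :=
  X ^ (M - N - mu l) * (X + C β) ^ (l : ℕ)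

/-- The product of the minors of `leftPoly` and `rightPoly` at the points `y_i`, `i ∈ S`,
written as a single determinant. -/
def minorProduct (β : ℂ) (lam mu : Fin N → ℕ) (S : Finset (Fin M)) (y : Fin M → ℂ) : ℂ :=
  (Matrix.of fun k l => ∑ i ∈ S,
    (leftPoly β lam k).eval (y i) * (rightPoly M β mu l).eval (y i)).det

/-- `minorProduct` divided by the derivatives of the potential at the chosen points. -/
def levelTerm (β : ℂ) (lam mu : Fin N → ℕ) (S : Finset (Fin M)) (y : Fin M → ℂ) : ℂ :=
  minorProduct β lam mu S y / ∏ i ∈ S, (bethePotential N M β).derivative.eval (y i)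

/-- The sum of `levelTerm / (twist - 1)` over all `N`-element subsets of a level set. As a function
of the level it is rational, with simple poles at the solutions of the Bethe equations. -/
def betheResolvent (β : ℂ) (lam mu : Fin N → ℕ) (y : Fin M → ℂ) : ℂ :=
  ∑ S ∈ (univ : Finset (Fin M)).powersetCard N, levelTerm β lam mu S y / (twist N β S y - 1)

theorem minorProduct_comp_perm (lam mu : Fin N → ℕ) (σ : Equiv.Perm (Fin M)) (S : Finset (Fin M))
    (y : Fin M → ℂ) :
    minorProduct β lam mu S (y ∘ σ) = minorProduct β lam mu (S.map σ.toEmbedding) y := by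
  simp only [minorProduct, Finset.sum_map]
  rfl

theorem minorProduct_mem (lam mu : Fin N → ℕ) (S : Finset (Fin M)) :
    minorProduct β lam mu S ∈ coordinateAlgebra M :=
  det_fun_mem fun _ _ => sum_fun_mem fun _ _ => Subalgebra.mul_mem _ (eval_mem _ _) (eval_mem _ _)

/-- The polynomial function that clears the denominators of `betheResolvent`. -/
def resolventDenominator (N : ℕ) {M : ℕ} (β : ℂ) (y : Fin M → ℂ) : ℂ :=
  (∏ i, (bethePotential N M β).derivative.eval (y i)) *
    ∏ S ∈ (univ : Finset (Fin M)).powersetCard N, (twist N β S y - 1)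

theorem exists_polynomial_resolventDenominator (N M : ℕ) (β : ℂ) :
    ∃ D : ℂ[X], ∀ (c : ℂ) (y : Fin M → ℂ), IsLevelList N M β c y →
      resolventDenominator N β y = D.eval c := by
  refine exists_polynomial_of_symmetric (F := resolventDenominator N β)
    (Subalgebra.mul_mem _ (prod_fun_mem fun i _ => eval_mem _ i)
      (prod_fun_mem fun S _ => Subalgebra.sub_mem _ (twist_mem S) (const_mem 1))) ?_ N β
  intro σ y
  simp only [resolventDenominator, twist_comp_perm]
  rw [prod_powersetCard_map σ fun S => twist N β S y - 1]
  congr 1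
  exact Equiv.prod_comp σ fun i => (bethePotential N M β).derivative.eval (y i)

/-- The product of `betheResolvent` and `resolventDenominator`, as a polynomial function. -/
def resolventNumerator (β : ℂ) (lam mu : Fin N → ℕ) (y : Fin M → ℂ) : ℂ :=
  ∑ S ∈ (univ : Finset (Fin M)).powersetCard N, minorProduct β lam mu S y *
    ((∏ i ∈ Sᶜ, (bethePotential N M β).derivative.eval (y i)) *
      ∏ T ∈ ((univ : Finset (Fin M)).powersetCard N).erase S, (twist N β T y - 1))

theorem exists_polynomial_resolventNumerator (β : ℂ) (lam mu : Fin N → ℕ) (M : ℕ) :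
    ∃ P : ℂ[X], ∀ (c : ℂ) (y : Fin M → ℂ), IsLevelList N M β c y →
      resolventNumerator β lam mu y = P.eval c := by
  refine exists_polynomial_of_symmetric (F := resolventNumerator β lam mu)
    (sum_fun_mem fun S _ => Subalgebra.mul_mem _ (minorProduct_mem lam mu S)
      (Subalgebra.mul_mem _ (prod_fun_mem fun i _ => eval_mem _ i)
        (prod_fun_mem fun T _ => Subalgebra.sub_mem _ (twist_mem T) (const_mem 1)))) ?_ N β
  intro σ y
  rw [resolventNumerator, resolventNumerator]
  refine Eq.trans ?_ (sum_powersetCard_map σ _)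
  refine Finset.sum_congr rfl fun S _ => ?_
  rw [minorProduct_comp_perm]
  congr 2
  · rw [compl_map_perm, Finset.prod_map]
    rfl
  · simp only [twist_comp_perm]
    refine Finset.prod_equiv (Equiv.finsetCongr σ) (fun T => ?_) (fun T _ => rfl)
    simp [Finset.mem_powersetCard]

theorem betheResolvent_eq_div (lam mu : Fin N → ℕ) (h0 : resolventDenominator N β y ≠ 0) :
    betheResolvent β lam mu y = resolventNumerator β lam mu y / resolventDenominator N β y := by
  rw [betheResolvent, resolventNumerator, Finset.sum_div]
  refine Finset.sum_congr rfl fun S hS => ?_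
  rw [resolventDenominator] at h0 ⊢
  rw [← Finset.prod_mul_prod_compl S, ← Finset.mul_prod_erase _ _ hS] at h0 ⊢
  simp only [mul_ne_zero_iff] at h0
  obtain ⟨⟨h1, h2⟩, h3, h4⟩ := h0
  rw [levelTerm]
  field_simp

/-! ### Weighted sums over subsets -/

theorem det_sum_eq_mul {R ι : Type*} [CommRing R] {N : ℕ} (a b : Fin N → ι → R) (S : Finset ι)
    (e : Fin N ≃ S) :
    (Matrix.of fun k l => ∑ i ∈ S, a k i * b l i).det =
      (Matrix.of fun k j => a k (e j)).det * (Matrix.of fun j l => b l (e j)).det := by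
  rw [← Matrix.det_mul]
  congr 1
  ext k l
  simp only [Matrix.mul_apply, Matrix.of_apply]
  rw [← Finset.sum_coe_sort S fun i => a k i * b l i]
  exact (Equiv.sum_comp e fun i : S => a k i * b l i).symm

/-- A weight in the sum scales each minor by the product of the weights. -/
theorem det_sum_mul_eq {R ι : Type*} [CommRing R] {N : ℕ} (a b : Fin N → ι → R) (w : ι → R)
    {S : Finset ι} (hS : S.card = N) :
    (Matrix.of fun k l => ∑ i ∈ S, a k i * b l i * w i).det =
      (Matrix.of fun k l => ∑ i ∈ S, a k i * b l i).det * ∏ i ∈ S, w i := by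
  have e : Fin N ≃ S := (S.equivFinOfCardEq hS).symm
  have h1 := det_sum_eq_mul (fun k i => w i * a k i) b S e
  have h2 : (Matrix.of fun k j => w (e j) * a k (e j)).det =
      (∏ j, w (e j)) * (Matrix.of fun k j => a k (e j)).det :=
    Matrix.det_mul_row (fun j => w (e j)) (Matrix.of fun k j => a k (e j))
  have h3 : ∏ j, w (e j) = ∏ i ∈ S, w i := by
    rw [← Finset.prod_coe_sort S w]
    exact Equiv.prod_comp e fun i : S => w i
  rw [h2, h3] at h1
  rw [det_sum_eq_mul a b S e]
  have h4 : (Matrix.of fun k l => ∑ i ∈ S, a k i * b l i * w i) =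
      Matrix.of fun k l => ∑ i ∈ S, w i * a k i * b l i := by
    ext k l
    exact Finset.sum_congr rfl fun i _ => by ring
  rw [h4, h1]
  ring

/-- Cauchy--Binet for sums of `levelTerm` weighted by a product over the subset. -/
theorem sum_levelTerm_mul_prod (lam mu : Fin N → ℕ) (y w : Fin M → ℂ) :
    ∑ S ∈ (univ : Finset (Fin M)).powersetCard N, levelTerm β lam mu S y * ∏ i ∈ S, w i =
      (Matrix.of fun k l => ∑ i, (leftPoly β lam k).eval (y i) * (rightPoly M β mu l).eval (y i) *
        (w i / (bethePotential N M β).derivative.eval (y i))).det := by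
  simp_rw [mul_assoc]
  rw [← sum_powersetCard_det_eq]
  refine Finset.sum_congr rfl fun S hS => ?_
  simp_rw [← mul_assoc]
  rw [det_sum_mul_eq _ _ _ (Finset.mem_powersetCard.1 hS).2, levelTerm, minorProduct,
    Finset.prod_div_distrib]
  ring

/-! ### Behaviour at infinity -/

section Infinity
open Filter Topology Bornology Asymptotics

theorem exists_norm_le_of_mem {F : (Fin M → ℂ) → ℂ} (hF : F ∈ coordinateAlgebra M) :
    ∃ (A : ℕ) (K : ℝ), ∀ (y : Fin M → ℂ) (r : ℝ), 1 ≤ r → (∀ i, ‖y i‖ ≤ r) →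
      ‖F y‖ ≤ K * r ^ A := by
  obtain ⟨p, rfl⟩ := hF
  induction p using MvPolynomial.induction_on with
  | C a => exact ⟨0, ‖a‖, fun y r _ _ => by simp⟩
  | add p q h1 h2 =>
    obtain ⟨A, K, h1⟩ := h1
    obtain ⟨B, L, h2⟩ := h2
    refine ⟨A + B, |K| + |L|, fun y r hr hy => ?_⟩
    simp only [map_add, Pi.add_apply] at h1 h2 ⊢
    have h3 : r ^ A ≤ r ^ (A + B) := pow_le_pow_right₀ hr (by omega)
    have h4 : r ^ B ≤ r ^ (A + B) := pow_le_pow_right₀ hr (by omega)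
    have h5 : 0 ≤ r ^ A := by positivity
    have h6 : 0 ≤ r ^ B := by positivity
    calc _ ≤ _ := norm_add_le _ _
      _ ≤ K * r ^ A + L * r ^ B := add_le_add (h1 y r hr hy) (h2 y r hr hy)
      _ ≤ |K| * r ^ A + |L| * r ^ B := by gcongr <;> exact le_abs_self _
      _ ≤ |K| * r ^ (A + B) + |L| * r ^ (A + B) := by gcongr
      _ = _ := by ring
  | mul_X p i h1 =>
    obtain ⟨A, K, h1⟩ := h1
    refine ⟨A + 1, K, fun y r hr hy => ?_⟩
    have hX : (MvPolynomial.aeval fun (i : Fin M) (y : Fin M → ℂ) => y i).toRingHom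
        (MvPolynomial.X (R := ℂ) i) y = y i := by simp
    rw [map_mul, Pi.mul_apply, norm_mul, hX, pow_succ, ← mul_assoc]
    exact mul_le_mul (h1 y r hr hy) (hy i) (norm_nonneg _) ((norm_nonneg _).trans (h1 y r hr hy))

theorem tendsto_eval_div_pow {r : ℂ[X]} {n : ℕ} (hr : r.degree < n) :
    Tendsto (fun w => r.eval w / w ^ n) (cobounded ℂ) (𝓝 0) := by
  have h1 : Tendsto (fun w : ℂ => ∑ m ∈ range n, r.coeff m * (w⁻¹) ^ (n - m)) (cobounded ℂ)
      (𝓝 (∑ m ∈ range n, r.coeff m * 0 ^ (n - m))) :=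
    tendsto_finsetSum _ fun m _ => (tendsto_inv₀_cobounded.pow _).const_mul _
  have h2 : ∑ m ∈ range n, r.coeff m * (0 : ℂ) ^ (n - m) = 0 :=
    Finset.sum_eq_zero fun m hm => by
      rw [zero_pow (by have := Finset.mem_range.1 hm; omega), mul_zero]
  rw [h2] at h1
  refine h1.congr' ?_
  filter_upwards [(hasBasis_cobounded_norm (E := ℂ)).mem_of_mem (i := 1) trivial] with w hw
  have hw0 : w ≠ 0 := by
    rintro rfl
    have : (1 : ℝ) ≤ ‖(0 : ℂ)‖ := hw
    norm_num at this
  by_cases h0 : r = 0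
  · simp [h0]
  rw [eval_eq_sum_range' ((natDegree_lt_iff_degree_lt h0).2 hr), Finset.sum_div]
  refine Finset.sum_congr rfl fun m hm => ?_
  rw [inv_pow, mul_div_assoc]
  congr 1
  have : w ^ n = w ^ (n - m) * w ^ m := by
    rw [← pow_add, Nat.sub_add_cancel (Finset.mem_range.1 hm).le]
  rw [this]
  field_simp

theorem isBigO_inv_eval_derivative {f : ℂ[X]} {M : ℕ} (hM : 1 ≤ M)
    (hdeg : f.natDegree = M) :
    (fun w => (f.derivative.eval w)⁻¹) =O[cobounded ℂ] fun _ => (1 : ℝ) := by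
  by_cases h1 : M = 1
  · have : f.derivative = C (f.derivative.coeff 0) := by
      apply eq_C_of_natDegree_eq_zero
      have := natDegree_derivative_le f
      omega
    rw [this]
    simp only [eval_C]
    exact isBigO_const_const _ one_ne_zero _
  · have h2 : 0 < f.derivative.degree := by
      rw [← natDegree_pos_iff_degree_pos, natDegree_derivative]
      omega
    have h3 := f.derivative.tendsto_norm_atTop h2 (tendsto_norm_cobounded_atTop (E := ℂ))
    have h4 := h3.inv_tendsto_atTop
    exact ((h4.isBigO_one ℝ).congr_left fun w => (norm_inv _).symm).of_norm_left

theorem tendsto_levelList {y : ℂ → Fin M → ℂ} (hy : ∀ c, IsLevelList N M β c (y c)) (i : Fin M) :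
    Tendsto (fun c => y c i) (cobounded ℂ) (cobounded ℂ) := by
  rw [(hasBasis_cobounded_norm (E := ℂ)).tendsto_right_iff]
  intro r _
  filter_upwards [eventually_lt_norm_levelList N M β r] with c hc
  exact (hc _ (hy c) i).le

/-- The limit at infinity of a trace `∑ g(y) / (y ^ n f'(y))` over a level set. -/
theorem tendsto_sum_eval_div (hN : 1 ≤ N) (hNM : N ≤ M) {y : ℂ → Fin M → ℂ}
    (hy : ∀ c, IsLevelList N M β c (y c)) (g : ℂ[X]) (n : ℕ)
    (hg : g.natDegree ≤ 2 * M - 2 + n) :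
    Tendsto (fun c => ∑ i, g.eval (y c i) / y c i ^ n /
      (bethePotential N M β).derivative.eval (y c i)) (cobounded ℂ)
      (𝓝 (((g /ₘ X ^ n) %ₘ bethePotential N M β).coeff (M - 1))) := by
  set f := bethePotential N M β with hf
  have hM : 1 ≤ M := hN.trans hNM
  have hmon : f.Monic := bethePotential_monic N M β
  have hdeg : f.natDegree = M := natDegree_bethePotential hNM
  have h1 : Tendsto (fun c => ((g /ₘ X ^ n) %ₘ f).coeff (M - 1) +
      ∑ i, (g %ₘ X ^ n).eval (y c i) / y c i ^ n * (f.derivative.eval (y c i))⁻¹) (cobounded ℂ)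
      (𝓝 (((g /ₘ X ^ n) %ₘ f).coeff (M - 1) + ∑ i : Fin M, 0)) := by
    refine (tendsto_finsetSum _ fun i _ => ?_).const_add _
    have h2 := (tendsto_eval_div_pow (r := g %ₘ X ^ n) (n := n)
      ((degree_modByMonic_lt g (monic_X_pow n)).trans_eq (degree_X_pow n))).comp
        (tendsto_levelList hy i)
    have h3 := (isBigO_inv_eval_derivative hM hdeg).comp_tendsto (tendsto_levelList hy i)
    have h4 := (isLittleO_one_iff ℝ).2 h2
    have h5 := h4.mul_isBigO h3
    simp only [one_mul] at h5
    exact (isLittleO_one_iff ℝ).1 h5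
  simp only [Finset.sum_const_zero, add_zero] at h1
  refine h1.congr' ?_
  filter_upwards [eventually_generic hN hNM β, eventually_lt_norm_levelList N M β 0] with c hc hc0
  have hinj : Function.Injective (y c) := fun i j hij =>
    injective_of_eval_derivative_ne_zero (hy c) ((hc _ (hy c)).1 i) hij
  have hq : (g /ₘ X ^ n).natDegree ≤ 2 * M - 2 := by
    rw [natDegree_divByMonic g (monic_X_pow n), natDegree_X_pow]
    omega
  rw [← sum_eval_div_of_natDegree_le hM hmon hdeg (hy c) hinj hq, ← Finset.sum_add_distrib]
  refine Finset.sum_congr rfl fun i _ => ?_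
  have hd := (hc _ (hy c)).1 i
  have h0 : y c i ≠ 0 := norm_pos_iff.1 (hc0 _ (hy c) i)
  have h6 := congrArg (eval (y c i)) (modByMonic_add_div g (X ^ n))
  simp only [eval_add, eval_mul, eval_pow, eval_X] at h6
  rw [← h6]
  field_simp
  ring

/-- A crude bound, enough to discard the remainder of the geometric series at infinity. -/
theorem isBigO_levelTerm (hN : 1 ≤ N) (hNM : N ≤ M) {y : ℂ → Fin M → ℂ}
    (hy : ∀ c, IsLevelList N M β c (y c)) (lam mu : Fin N → ℕ) :
    ∃ A : ℕ, ∀ S ∈ (univ : Finset (Fin M)).powersetCard N,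
      (fun c => levelTerm β lam mu S (y c)) =O[cobounded ℂ] fun c => c ^ A := by
  have hM : 1 ≤ M := hN.trans hNM
  have hbound : ∀ S : Finset (Fin M), ∃ (A : ℕ) (K : ℝ), ∀ (y : Fin M → ℂ) (r : ℝ), 1 ≤ r →
      (∀ i, ‖y i‖ ≤ r) → ‖minorProduct β lam mu S y‖ ≤ K * r ^ A := fun S =>
    exists_norm_le_of_mem (minorProduct_mem lam mu S)
  choose A K hAK using hbound
  have hlarge : ∀ᶠ c in cobounded ℂ, 1 ≤ ‖c‖ ∧ ‖β‖ ≤ ‖c‖ := by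
    filter_upwards [(hasBasis_cobounded_norm (E := ℂ)).mem_of_mem (i := max 1 ‖β‖) trivial]
      with c hc
    exact max_le_iff.1 hc
  have hy2 : ∀ᶠ c in cobounded ℂ, ∀ i, ‖y c i‖ ≤ 2 * ‖c‖ := by
    filter_upwards [hlarge, eventually_lt_norm_levelList N M β (‖β‖ + 1)] with c hc hlt i
    have h1 := congrArg norm ((hy c).pow_mul_pow i)
    simp only [norm_neg, norm_mul, norm_pow, norm_one, one_pow, one_mul] at h1
    have h2 := hlt _ (hy c) i
    have h3 := norm_sub_norm_le (y c i) (-β)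
    rw [sub_neg_eq_add, norm_neg] at h3
    have h4 : 1 ≤ ‖y c i + β‖ := by linarith
    have h5 : 1 ≤ ‖y c i‖ := by linarith [norm_nonneg β]
    have h6 : ‖y c i + β‖ ≤ ‖c‖ := by
      rw [← h1]
      calc _ ≤ ‖y c i + β‖ ^ N := le_self_pow₀ h4 (by omega)
        _ ≤ _ := le_mul_of_one_le_left (by positivity) (one_le_pow₀ h5)
    linarith
  refine ⟨∑ S, A S, fun S _ => ?_⟩
  have h1 : (fun c => minorProduct β lam mu S (y c)) =O[cobounded ℂ] fun c => c ^ ∑ S, A S := by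
    refine IsBigO.of_bound (|K S| * 2 ^ A S) ?_
    filter_upwards [hlarge, hy2] with c hc hc2
    calc _ ≤ K S * (2 * ‖c‖) ^ A S := hAK S _ _ (by linarith) hc2
      _ ≤ |K S| * (2 * ‖c‖) ^ A S := by gcongr; exact le_abs_self _
      _ = |K S| * 2 ^ A S * ‖c‖ ^ A S := by rw [mul_pow]; ring
      _ ≤ |K S| * 2 ^ A S * ‖c‖ ^ ∑ S, A S := by
        gcongr
        · exact hc.1
        · exact Finset.single_le_sum (f := A) (fun _ _ => Nat.zero_le _) (mem_univ S)
      _ = _ := by rw [norm_pow]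
  have h2 : (fun c => ∏ i ∈ S, ((bethePotential N M β).derivative.eval (y c i))⁻¹) =O[cobounded ℂ]
      fun _ => ∏ _i ∈ S, (1 : ℝ) :=
    IsBigO.finsetProd fun i _ => (isBigO_inv_eval_derivative hM
      (natDegree_bethePotential hNM)).comp_tendsto (tendsto_levelList hy i)
  simp only [Finset.prod_const_one] at h2
  have h3 := h1.norm_right.mul h2
  simp only [mul_one] at h3
  refine (h3.of_norm_right).congr_left fun c => ?_
  rw [levelTerm, Finset.prod_inv_distrib, div_eq_mul_inv]

theorem natDegree_leftPoly_mul_rightPoly (lam mu : Fin N → ℕ) (k l : Fin N) (n : ℕ) :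
    (leftPoly β lam k * rightPoly M β mu l * (X + C β) ^ n).natDegree =
      lam k + (N - 1 - (k : ℕ)) + (M - N - mu l + l) + n := by
  have h1 := monic_X_add_C β
  have h2 : (leftPoly β lam k).Monic := (monic_X_pow _).mul (h1.pow _)
  have h3 : (rightPoly M β mu l).Monic := (monic_X_pow _).mul (h1.pow _)
  rw [(h2.mul h3).natDegree_mul (h1.pow n), h2.natDegree_mul h3, leftPoly, rightPoly,
    (monic_X_pow _).natDegree_mul (h1.pow _), (monic_X_pow _).natDegree_mul (h1.pow _)]
  simp [h1.natDegree_pow]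

/-- The limit at infinity of the pairing of `leftPoly k` with `rightPoly l`, weighted by
`((y + β) / y) ^ n`. -/
def pairingLimit (M : ℕ) (β : ℂ) (lam mu : Fin N → ℕ) (n : ℕ) (k l : Fin N) : ℂ :=
  (((leftPoly β lam k * rightPoly M β mu l * (X + C β) ^ n) /ₘ X ^ n) %ₘ
    bethePotential N M β).coeff (M - 1)

/-- The moments of the inverse twist, without their factor `c ^ n`, converge at infinity to
determinants of `pairingLimit`. -/
theorem tendsto_sum_levelTerm (hN : 1 ≤ N) (hNM : N ≤ M) {y : ℂ → Fin M → ℂ}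
    (hy : ∀ c, IsLevelList N M β c (y c)) (lam mu : Fin N → ℕ) (hlam : ∀ k, lam k ≤ M - N) (n : ℕ) :
    Tendsto (fun c => ∑ S ∈ (univ : Finset (Fin M)).powersetCard N, levelTerm β lam mu S (y c) *
      ∏ i ∈ S, ((y c i + β) / y c i) ^ n) (cobounded ℂ)
      (𝓝 (Matrix.of (pairingLimit M β lam mu n)).det) := by
  simp_rw [sum_levelTerm_mul_prod]
  have hcont : Continuous fun A : Matrix (Fin N) (Fin N) ℂ => A.det := continuous_id.matrix_det
  refine (hcont.tendsto _).comp ?_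
  refine tendsto_pi_nhds.2 fun k => tendsto_pi_nhds.2 fun l => ?_
  refine (tendsto_sum_eval_div hN hNM hy
    (leftPoly β lam k * rightPoly M β mu l * (X + C β) ^ n) n ?_).congr fun c => ?_
  · rw [natDegree_leftPoly_mul_rightPoly]
    have := hlam k
    have := k.2
    have := l.2
    omega
  · refine Finset.sum_congr rfl fun i _ => ?_
    simp only [eval_mul, eval_pow, eval_add, eval_X, eval_C, div_pow]
    ring

/-- The first moment at infinity. An entry vanishes if its degree is below `M - 1`, and also if the
quotient by `X` is a multiple of the potential. -/
theorem det_pairingLimit_one (hN : 1 ≤ N) (hNM : N ≤ M) (lam mu : Fin N → ℕ)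
    (hl : Antitone lam) (hlam : ∀ k, lam k ≤ M - N) (hm : Antitone mu) (hmu : ∀ k, mu k ≤ M - N) :
    (Matrix.of (pairingLimit M β lam mu 1)).det = if lam = mu then 1 else 0 := by
  have hM : 1 ≤ M := hN.trans hNM
  have hmon := bethePotential_monic N M β
  have hdeg := natDegree_bethePotential (β := β) hNM
  have hx := monic_X_add_C β
  have hdeg' : ((bethePotential N M β).degree : WithBot ℕ) = M := by
    rw [degree_eq_natDegree hmon.ne_zero, hdeg]
  have hdiv : ∀ k l, ((leftPoly β lam k * rightPoly M β mu l * (X + C β) ^ 1) /ₘ X ^ 1).natDegree =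
      lam k + (N - 1 - (k : ℕ)) + (M - N - mu l + l) := by
    intro k l
    rw [natDegree_divByMonic _ (monic_X_pow 1), natDegree_leftPoly_mul_rightPoly, natDegree_X_pow]
    omega
  -- below degree `M - 1` the coefficient vanishes
  have hsmall : ∀ k l : Fin N, lam k + l < mu l + k → pairingLimit M β lam mu 1 k l = 0 := by
    intro k l hkl
    have h1 := hdiv k l
    have := hmu l
    have := k.2
    have h2 : ((leftPoly β lam k * rightPoly M β mu l * (X + C β) ^ 1) /ₘ X ^ 1).natDegree <
        M - 1 := by
      omega
    rw [pairingLimit, (modByMonic_eq_self_iff hmon).2]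
    · exact coeff_eq_zero_of_natDegree_lt h2
    · rw [hdeg']
      exact degree_le_natDegree.trans_lt (by exact_mod_cast (by omega))
  refine det_eq_ite_of_comparison lam mu hl hm _ ?_ ?_ ?_ ?_
  · intro k l hkl hlt
    have hkl' : (k : ℕ) ≤ l := hkl
    have := hmu l
    have := hlam k
    have := k.2
    -- the quotient is a multiple of the potential
    have h1 : leftPoly β lam k * rightPoly M β mu l * (X + C β) ^ 1 =
        X ^ 1 * (bethePotential N M β * (X ^ (lam k - mu l - 1) * (X + C β) ^ ((l : ℕ) - k))) := by
      have e1 : lam k + (M - N - mu l) = 1 + (M - N) + (lam k - mu l - 1) := by omega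
      have e2 : N - 1 - (k : ℕ) + l + 1 = N + (l - k) := by omega
      calc _ = X ^ (lam k + (M - N - mu l)) * (X + C β) ^ (N - 1 - (k : ℕ) + l + 1) := by
            rw [leftPoly, rightPoly]; ring
        _ = _ := by rw [e1, e2, bethePotential]; ring
    simp only [Matrix.of_apply, pairingLimit]
    rw [h1, mul_divByMonic_cancel_left _ (monic_X_pow 1), (modByMonic_eq_zero_iff_dvd hmon).2
      (dvd_mul_right _ _), coeff_zero]
  · intro k l hkl hle
    have hkl' : (l : ℕ) < k := hkl
    exact hsmall k l (by omega)
  · intro k hk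
    have := hmu k
    have h0 := k.2
    simp only [Matrix.of_apply, pairingLimit]
    have h1 := hdiv k k
    have h2 : lam k + (N - 1 - (k : ℕ)) + (M - N - mu k + k) = M - 1 := by omega
    rw [h2] at h1
    rw [(modByMonic_eq_self_iff hmon).2]
    · nth_rewrite 1 [← h1]
      rw [coeff_natDegree, leadingCoeff_divByMonic_of_monic (monic_X_pow 1)]
      · exact (((monic_X_pow _).mul (hx.pow _)).mul ((monic_X_pow _).mul (hx.pow _))).mul (hx.pow 1)
      · have h3 := natDegree_leftPoly_mul_rightPoly (M := M) (β := β) lam mu k k 1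
        rw [degree_X_pow, degree_eq_natDegree fun h => ?_, h3]
        · exact_mod_cast (by omega)
        · rw [h, natDegree_zero] at h3
          omega
    · rw [hdeg']
      exact degree_le_natDegree.trans_lt (by rw [h1]; exact_mod_cast (by omega))
  · intro k hk
    exact hsmall k k (by omega)

theorem inv_sub_one_eq_sum {t : ℂ} (h0 : t ≠ 0) (h1 : t - 1 ≠ 0) (K : ℕ) :
    (t - 1)⁻¹ = t⁻¹ + ∑ n ∈ range K, (t⁻¹) ^ (n + 2) + (t⁻¹) ^ (K + 1) * (t - 1)⁻¹ := by
  induction K with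
  | zero => simp; field_simp; ring
  | succ K ih =>
    rw [Finset.sum_range_succ]
    have : (t⁻¹) ^ (K + 1) * (t - 1)⁻¹ =
        (t⁻¹) ^ (K + 2) + (t⁻¹) ^ (K + 2) * (t - 1)⁻¹ := by
      rw [pow_succ _ (K + 1)]
      field_simp
      ring
    rw [this] at ih
    rw [← add_assoc] at ih ⊢
    exact ih

/-- At infinity the residue of `betheResolvent` is `δ`. -/
theorem tendsto_mul_betheResolvent (hN : 1 ≤ N) (hNM : N ≤ M) {y : ℂ → Fin M → ℂ}
    (hy : ∀ c, IsLevelList N M β c (y c)) (lam mu : Fin N → ℕ)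
    (hl : Antitone lam) (hlam : ∀ k, lam k ≤ M - N) (hm : Antitone mu) (hmu : ∀ k, mu k ≤ M - N) :
    Tendsto (fun c => c * betheResolvent β lam mu (y c)) (cobounded ℂ)
      (𝓝 (if lam = mu then 1 else 0)) := by
  obtain ⟨A, hA⟩ := isBigO_levelTerm hN hNM hy lam mu
  rw [← det_pairingLimit_one hN hNM lam mu hl hlam hm hmu (β := β)]
  set D : ℕ → ℂ → ℂ := fun n c => ∑ S ∈ (univ : Finset (Fin M)).powersetCard N,
    levelTerm β lam mu S (y c) * ∏ i ∈ S, ((y c i + β) / y c i) ^ n with hD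
  have hDlim := fun n => tendsto_sum_levelTerm hN hNM hy lam mu hlam n
  have hinv : Tendsto (fun c : ℂ => c⁻¹) (cobounded ℂ) (𝓝 0) := tendsto_inv₀_cobounded
  -- the terms of the geometric series after the first tend to zero
  have hmain : Tendsto (fun c => D 1 c + ∑ n ∈ range (A + 1), (c⁻¹) ^ (n + 1) * D (n + 2) c)
      (cobounded ℂ) (𝓝 ((Matrix.of (pairingLimit M β lam mu 1)).det + 0)) := by
    refine (hDlim 1).add ?_
    have : Tendsto (fun c => ∑ n ∈ range (A + 1), (c⁻¹) ^ (n + 1) * D (n + 2) c) (cobounded ℂ)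
        (𝓝 (∑ n ∈ range (A + 1),
          0 ^ (n + 1) * (Matrix.of (pairingLimit M β lam mu (n + 2))).det)) :=
      tendsto_finsetSum _ fun n _ => (hinv.pow _).mul (hDlim (n + 2))
    simpa using this
  have htwist : ∀ S ∈ (univ : Finset (Fin M)).powersetCard N,
      (fun c => (twist N β S (y c))⁻¹) =O[cobounded ℂ] fun c => c⁻¹ := by
    intro S hS
    refine IsBigO.of_bound (2 ^ N) ?_
    filter_upwards [eventually_le_norm_twist hN β,
      (hasBasis_cobounded_norm (E := ℂ)).mem_of_mem (i := 1) trivial] with c hc hc1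
    have h1 := hc _ (hy c) S hS
    have hc1 : 1 ≤ ‖c‖ := hc1
    have h2 : 0 < ‖twist N β S (y c)‖ := by
      by_contra h
      have : ‖twist N β S (y c)‖ = 0 := le_antisymm (not_lt.1 h) (norm_nonneg _)
      rw [this] at h1
      linarith
    rw [norm_inv, norm_inv, ← div_eq_mul_inv, le_div_iff₀ (by linarith), inv_mul_le_iff₀ h2]
    linarith
  have htwist1 : ∀ S ∈ (univ : Finset (Fin M)).powersetCard N,
      (fun c => (twist N β S (y c) - 1)⁻¹) =O[cobounded ℂ] fun _ => (1 : ℝ) := by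
    intro S hS
    refine IsBigO.of_bound 1 ?_
    filter_upwards [eventually_le_norm_twist hN β,
      (hasBasis_cobounded_norm (E := ℂ)).mem_of_mem (i := 2 ^ N * 2) trivial] with c hc hc1
    have h1 := hc _ (hy c) S hS
    have hc1 : 2 ^ N * 2 ≤ ‖c‖ := hc1
    have h2 : 2 ≤ ‖twist N β S (y c)‖ := by
      have h3 : (0 : ℝ) < 2 ^ N := by positivity
      exact le_of_mul_le_mul_left (hc1.trans h1) h3
    have h4 := norm_sub_norm_le (twist N β S (y c)) 1
    rw [norm_one] at h4
    rw [norm_inv, norm_one, one_mul]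
    exact inv_le_one_of_one_le₀ (by linarith)
  have hrem : Tendsto (fun c => ∑ S ∈ (univ : Finset (Fin M)).powersetCard N,
      c * (levelTerm β lam mu S (y c) * ((twist N β S (y c))⁻¹ ^ (A + 2) *
        (twist N β S (y c) - 1)⁻¹))) (cobounded ℂ)
      (𝓝 (∑ S ∈ (univ : Finset (Fin M)).powersetCard N, 0)) := by
    refine tendsto_finsetSum _ fun S hS => ?_
    have h1 := (isBigO_refl (fun c : ℂ => c) (cobounded ℂ)).mul
      ((hA S hS).mul (((htwist S hS).pow (A + 2)).mul ((htwist1 S hS).trans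
        (isBigO_const_const (1 : ℝ) (one_ne_zero' ℂ) _))))
    refine (h1.trans_tendsto ?_)
    refine hinv.congr' ?_
    filter_upwards [(hasBasis_cobounded_norm (E := ℂ)).mem_of_mem (i := 1) trivial] with c hc1
    have hc0 : c ≠ 0 := by
      rintro rfl
      have : (1 : ℝ) ≤ ‖(0 : ℂ)‖ := hc1
      norm_num at this
    rw [mul_one, pow_succ, pow_succ, inv_pow]
    field_simp
  have hsum := hmain.add hrem
  simp only [Finset.sum_const_zero, add_zero] at hsum
  refine hsum.congr' ?_
  filter_upwards [eventually_generic hN hNM β, eventually_lt_norm_levelList N M β 0,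
    eventually_le_norm_twist hN β,
    (hasBasis_cobounded_norm (E := ℂ)).mem_of_mem (i := 1) trivial] with c hc hy0 htw hc1
  have hc1 : 1 ≤ ‖c‖ := hc1
  have hc0 : c ≠ 0 := norm_pos_iff.1 (by linarith)
  have hyne : ∀ i, y c i ≠ 0 := fun i => norm_pos_iff.1 (hy0 _ (hy c) i)
  rw [betheResolvent, Finset.mul_sum]
  simp only [hD]
  simp_rw [Finset.mul_sum]
  rw [Finset.sum_comm, ← Finset.sum_add_distrib, ← Finset.sum_add_distrib]
  refine Finset.sum_congr rfl fun S hS => ?_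
  have ht1 : twist N β S (y c) - 1 ≠ 0 := sub_ne_zero.2 ((hc _ (hy c)).2 S hS)
  have ht0 : twist N β S (y c) ≠ 0 := by
    intro h
    have := htw _ (hy c) S hS
    rw [h, norm_zero, mul_zero] at this
    linarith
  have hu : ∏ i ∈ S, ((y c i + β) / y c i) = c * (twist N β S (y c))⁻¹ := by
    have h1 := (hy c).twist_mul hN S
    have h2 : ∏ i ∈ S, y c i ≠ 0 := Finset.prod_ne_zero_iff.2 fun i _ => hyne i
    rw [Finset.prod_div_distrib]
    field_simp
    linear_combination h1
  simp_rw [Finset.prod_pow, hu]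
  set t := twist N β S (y c)
  have hpow : ∀ n, (c⁻¹) ^ (n + 1) * (c * t⁻¹) ^ (n + 2) = c * (t⁻¹) ^ (n + 2) := by
    intro n
    rw [mul_pow, pow_succ c (n + 1), inv_pow]
    field_simp
  have hg := inv_sub_one_eq_sum ht0 ht1 (A + 1)
  calc _ = levelTerm β lam mu S (y c) * (c * (t⁻¹ + ∑ n ∈ range (A + 1), (t⁻¹) ^ (n + 2) +
        (t⁻¹) ^ (A + 2) * (t - 1)⁻¹)) := by
        simp only [mul_left_comm _ (levelTerm β lam mu S (y c)), hpow, ← Finset.mul_sum]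
        ring
    _ = _ := by rw [← hg]; ring

end Infinity

/-! ### Limits of level sets -/

section Limits
open Filter Topology Bornology

/-- The roots stay bounded near a level, so along an ultrafilter the lists converge to a list of
roots at the limit level. This replaces continuity of the roots, for which no
continuous labelling is available. -/
theorem exists_ultrafilter_limit (hN : 1 ≤ N) (hNM : N ≤ M) {y : ℂ → Fin M → ℂ}
    (hy : ∀ c, IsLevelList N M β c (y c)) {b : ℂ} {u : Ultrafilter ℂ} (hu : (u : Filter ℂ) ≤ 𝓝 b) :
    ∃ x : Fin M → ℂ, IsLevelList N M β b x ∧ Tendsto y u (𝓝 x) := by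
  have hdeg : 0 < (bethePotential N M β).degree := by
    rw [← natDegree_pos_iff_degree_pos, natDegree_bethePotential hNM]; omega
  have h1 := (bethePotential N M β).tendsto_norm_atTop hdeg (tendsto_norm_cobounded_atTop (E := ℂ))
  obtain ⟨r, _, hr⟩ := (hasBasis_cobounded_norm (E := ℂ)).eventually_iff.1
    (h1.eventually_ge_atTop (‖b‖ + 1))
  have h2 : ∀ᶠ c in (u : Filter ℂ), y c ∈ Metric.closedBall (0 : Fin M → ℂ) |r| := by
    have h3 : ∀ᶠ c in 𝓝 b, ‖c‖ < ‖b‖ + 1 :=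
      (continuous_norm.tendsto b).eventually_lt_const (by linarith)
    filter_upwards [hu h3] with c hc
    rw [mem_closedBall_zero_iff, pi_norm_le_iff_of_nonneg (abs_nonneg r)]
    intro i
    by_contra hlt
    have h4 := hr (show r ≤ ‖y c i‖ from (le_abs_self r).trans (not_le.1 hlt).le)
    rw [eval_of_eq_prod (hy c)] at h4
    simp only [norm_neg, norm_mul, norm_pow, norm_one, one_pow, one_mul] at h4
    exact absurd hc (not_lt.2 h4)
  obtain ⟨x, _, hx⟩ := (isCompact_closedBall (0 : Fin M → ℂ) |r|).ultrafilter_le_nhds (u.map y)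
    (le_principal_iff.2 h2)
  have hx' : Tendsto y u (𝓝 x) := hx
  refine ⟨x, Polynomial.funext fun w => ?_, hx'⟩
  have h5 : Tendsto (fun c => (bethePotential N M β).eval w + (-1) ^ N * c) u
      (𝓝 ((bethePotential N M β).eval w + (-1) ^ N * b)) :=
    ((tendsto_id.mono_left hu).const_mul _).const_add _
  have h6 : Tendsto (fun c => ∏ i, (w - y c i)) u (𝓝 (∏ i, (w - x i))) :=
    tendsto_finsetProd _ fun i _ => ((tendsto_pi_nhds.1 hx' i).const_sub w)
  have h7 : ∀ c, (bethePotential N M β).eval w + (-1) ^ N * c = ∏ i, (w - y c i) := fun c => by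
    have := congrArg (eval w) (hy c)
    simpa [eval_prod] using this
  have := tendsto_nhds_unique (h5.congr h7) h6
  simpa [eval_prod] using this

theorem exists_finset_generic (hN : 1 ≤ N) (hNM : N ≤ M) (β : ℂ) :
    ∃ B : Finset ℂ, ∀ c ∉ B, ∀ y : Fin M → ℂ, IsLevelList N M β c y →
      resolventDenominator N β y ≠ 0 := by
  obtain ⟨D, hD⟩ := exists_polynomial_resolventDenominator N M β
  have h0 : D ≠ 0 := by
    rintro rfl
    obtain ⟨c, hc⟩ := (eventually_generic hN hNM β).exists
    obtain ⟨y, hy⟩ := exists_isLevelList hN hNM β c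
    have h1 := hD c y hy
    rw [eval_zero, resolventDenominator, mul_eq_zero, Finset.prod_eq_zero_iff,
      Finset.prod_eq_zero_iff] at h1
    rcases h1 with ⟨i, _, hi⟩ | ⟨S, hS, h⟩
    · exact (hc y hy).1 i hi
    · exact (hc y hy).2 S hS (sub_eq_zero.1 h)
  refine ⟨D.roots.toFinset, fun c hc y hy h => hc ?_⟩
  rw [hD c y hy] at h
  simp [h0, h]

theorem resolventDenominator_ne_zero_iff : resolventDenominator N β y ≠ 0 ↔
    (∀ i, (bethePotential N M β).derivative.eval (y i) ≠ 0) ∧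
      ∀ S ∈ (univ : Finset (Fin M)).powersetCard N, twist N β S y - 1 ≠ 0 := by
  rw [resolventDenominator, mul_ne_zero_iff, Finset.prod_ne_zero_iff, Finset.prod_ne_zero_iff]
  simp

theorem eventually_resolventDenominator_ne_zero (hN : 1 ≤ N) (hNM : N ≤ M) (β b : ℂ) :
    ∀ᶠ c in 𝓝[≠] b, ∀ y : Fin M → ℂ, IsLevelList N M β c y → resolventDenominator N β y ≠ 0 := by
  obtain ⟨B, hB⟩ := exists_finset_generic hN hNM β
  have h1 : ∀ᶠ c in 𝓝[≠] b, c ∉ B := by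
    have := (B.erase b).finite_toSet.isClosed.isOpen_compl.mem_nhds (x := b) (by simp)
    filter_upwards [nhdsWithin_le_nhds this, self_mem_nhdsWithin] with c h1 h2 h3
    exact h1 (Finset.mem_coe.2 (Finset.mem_erase.2 ⟨h2, h3⟩))
  filter_upwards [h1] with c hc using hB c hc

end Limits

/-! ### Behaviour at level zero -/

theorem sum_add_div (hN : 1 ≤ N) (m : ℕ) : ∑ k ∈ range N, (m + k) / N = m := by
  induction m with
  | zero =>
    refine Finset.sum_eq_zero fun k hk => ?_
    rw [zero_add]
    exact Nat.div_eq_of_lt (Finset.mem_range.1 hk)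
  | succ m ih =>
    have h1 := Finset.sum_range_succ (fun k => (m + k) / N) N
    rw [Finset.sum_range_succ' (fun k => (m + k) / N) N, ih, Nat.add_div_right _ (by omega)] at h1
    simp only [add_zero] at h1
    have h2 : ∑ k ∈ range N, (m + 1 + k) / N = ∑ k ∈ range N, (m + (k + 1)) / N :=
      Finset.sum_congr rfl fun k _ => by congr 1; omega
    omega

/-- The moments of the twist are polynomials in the level. By Cauchy--Binet the moment is a
determinant of traces with `(y + β) ^ m` in the denominator; the factor `c ^ m` contained in
`twist ^ m` is distributed over the rows and clears these denominators, as `c` is a multiple of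
`(y + β) ^ N` at each root. -/
theorem exists_polynomial_sum_levelTerm_mul_twist_pow (hN : 1 ≤ N) (hNM : N ≤ M)
    (lam mu : Fin N → ℕ) (m : ℕ) :
    ∃ R : ℂ[X], ∀ (c : ℂ) (y : Fin M → ℂ), c ≠ 0 → IsLevelList N M β c y → Function.Injective y →
      ∑ S ∈ (univ : Finset (Fin M)).powersetCard N, levelTerm β lam mu S y * twist N β S y ^ m =
        R.eval c := by
  have hM : 1 ≤ M := hN.trans hNM
  -- `m + k = j N + r`; the factor `c ^ j` turns `(y + β) ^ (-j N)` into a power of `y`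
  set j : Fin N → ℕ := fun k => (m + k) / N with hj
  set r : Fin N → ℕ := fun k => (m + k) % N with hr
  have hjr : ∀ k, N * j k + r k = m + k := fun k => Nat.div_add_mod _ _
  have hrN : ∀ k, r k < N := fun k => Nat.mod_lt _ (by omega)
  set g : Fin N → Fin N → ℂ[X] := fun k l => C ((-(-1) ^ N) ^ j k) *
    X ^ ((M - N) * j k + lam k + (M - N - mu l) + m) * (X + C β) ^ (N - 1 - r k + l) with hg
  have htr := fun k l => exists_polynomial_eq_sum_eval_div hM (bethePotential_monic N M β)
    (natDegree_bethePotential hNM) ((-1) ^ N) (g k l)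
  choose R hR using htr
  refine ⟨(Matrix.of R).det, fun c y hc hy hinj => ?_⟩
  have hx : ∀ i, y i + β ≠ 0 := hy.add_ne_zero hN hc
  have htw : ∀ S, twist N β S y ^ m = c ^ m * ∏ i ∈ S, (y i / (y i + β)) ^ m := by
    intro S
    have h1 := hy.twist_mul hN S
    have h2 : ∏ i ∈ S, (y i + β) ≠ 0 := Finset.prod_ne_zero_iff.2 fun i _ => hx i
    rw [Finset.prod_pow, ← mul_pow, Finset.prod_div_distrib, mul_div_assoc', ← h1,
      mul_div_cancel_right₀ _ h2]
  simp_rw [htw, mul_left_comm _ (c ^ m), ← Finset.mul_sum]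
  rw [sum_levelTerm_mul_prod]
  have hcm : c ^ m = ∏ k : Fin N, c ^ j k := by
    rw [Finset.prod_pow_eq_pow_sum]
    congr 1
    rw [← sum_add_div hN m, ← Fin.sum_univ_eq_sum_range (fun k => (m + k) / N)]
  rw [hcm, ← Matrix.det_mul_column, ← Polynomial.coe_evalRingHom, RingHom.map_det]
  congr 1
  ext k l
  simp only [Matrix.of_apply, RingHom.mapMatrix_apply, Matrix.map_apply, coe_evalRingHom]
  rw [← hR k l c y hy hinj, Finset.mul_sum]
  refine Finset.sum_congr rfl fun i _ => ?_
  rw [← mul_div_assoc, ← mul_div_assoc]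
  congr 1
  have h1 := hy.pow_mul_pow i
  have h2 : c ^ j k = (-(-1) ^ N) ^ j k * (y i ^ ((M - N) * j k) * (y i + β) ^ (N * j k)) := by
    rw [pow_mul, pow_mul, ← mul_pow, h1, ← mul_pow]
    congr 1
    have : ((-1 : ℂ) ^ N) * (-1) ^ N = 1 := by rw [← mul_pow]; simp
    linear_combination (-c) * this
  have h3 : (y i + β) ^ (N * j k) * (y i + β) ^ (N - 1 - (k : ℕ)) =
      (y i + β) ^ (N - 1 - r k) * (y i + β) ^ m := by
    rw [← pow_add, ← pow_add]
    congr 1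
    have := hjr k
    have := hrN k
    have := k.2
    omega
  simp only [hg, leftPoly, rightPoly, eval_mul, eval_pow, eval_X, eval_add, eval_C]
  rw [h2, div_pow, pow_add _ (N - 1 - r k), pow_add (y i) _ m, pow_add (y i), pow_add (y i)]
  field_simp [hx i]
  linear_combination (y i ^ ((M - N) * j k) * y i ^ lam k * y i ^ (M - N - mu l) * y i ^ m) * h3

section Zero
open Filter Topology Bornology

theorem tendsto_twist {y : ℂ → Fin M → ℂ} {u : Filter ℂ} {x : Fin M → ℂ} (hx : Tendsto y u (𝓝 x))
    (S : Finset (Fin M)) : Tendsto (fun c => twist N β S (y c)) u (𝓝 (twist N β S x)) :=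
  ((tendsto_finsetProd _ fun i _ => tendsto_pi_nhds.1 hx i).mul
    (tendsto_finsetProd _ fun i _ => (tendsto_pi_nhds.1 hx i).add_const β)).const_mul _

theorem tendsto_minorProduct {y : ℂ → Fin M → ℂ} {u : Filter ℂ} {x : Fin M → ℂ}
    (hx : Tendsto y u (𝓝 x)) (lam mu : Fin N → ℕ) (S : Finset (Fin M)) :
    Tendsto (fun c => minorProduct β lam mu S (y c)) u (𝓝 (minorProduct β lam mu S x)) := by
  have hcont : Continuous fun A : Matrix (Fin N) (Fin N) ℂ => A.det := continuous_id.matrix_det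
  refine (hcont.tendsto _).comp ?_
  refine tendsto_pi_nhds.2 fun k => tendsto_pi_nhds.2 fun l => tendsto_finsetSum _ fun i _ => ?_
  exact (((leftPoly β lam k).continuous.tendsto _).comp (tendsto_pi_nhds.1 hx i)).mul
    (((rightPoly M β mu l).continuous.tendsto _).comp (tendsto_pi_nhds.1 hx i))

/-- For `β = 0` every twist equals `c`, so that the resolvent is a polynomial divided by `c - 1`. -/
theorem tendsto_mul_betheResolvent_zero_of_eq_zero (hN : 1 ≤ N) (hNM : N ≤ M) {y : ℂ → Fin M → ℂ}
    (hy : ∀ c, IsLevelList N M 0 c (y c)) (lam mu : Fin N → ℕ) :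
    Tendsto (fun c => c * betheResolvent 0 lam mu (y c)) (𝓝[≠] 0) (𝓝 0) := by
  obtain ⟨R, hR⟩ := exists_polynomial_sum_levelTerm_mul_twist_pow (β := 0) hN hNM lam mu 0
  have h1 : ContinuousAt (fun c : ℂ => c * (R.eval c / (c - 1))) 0 := by
    have := R.continuous.continuousAt (x := (0 : ℂ))
    exact continuousAt_id.mul (this.div (by fun_prop) (by norm_num))
  have h2 : Tendsto (fun c : ℂ => c * (R.eval c / (c - 1))) (𝓝[≠] 0) (𝓝 0) := by
    have := h1.tendsto
    rw [zero_mul] at this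
    exact this.mono_left nhdsWithin_le_nhds
  refine h2.congr' ?_
  filter_upwards [eventually_resolventDenominator_ne_zero hN hNM 0 0, self_mem_nhdsWithin]
    with c hc h0
  have h3 := resolventDenominator_ne_zero_iff.1 (hc _ (hy c))
  have hinj : Function.Injective (y c) := fun i j hij =>
    injective_of_eval_derivative_ne_zero (hy c) (h3.1 i) hij
  rw [← hR c (y c) h0 (hy c) hinj, betheResolvent, Finset.sum_div]
  congr 1
  refine Finset.sum_congr rfl fun S _ => ?_
  rw [pow_zero, mul_one]
  congr 2
  have h4 := (hy c).prod_add hN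
  have h5 : ((-1 : ℂ) ^ (M + N)) * (-1) ^ (M + N) = 1 := by rw [← mul_pow]; simp
  rw [← Finset.prod_mul_prod_compl S] at h4
  simp only [twist, add_zero] at h4 ⊢
  rw [h4, ← mul_assoc, h5, one_mul]

/-- A subset of a level set whose limit at level zero contains the root `0`: its twist tends to
zero like a power of the level, which compensates any pole of the `levelTerm`. -/
theorem tendsto_levelTerm_of_limit_eq_zero (hN : 1 ≤ N) (hNM : N ≤ M) (hβ : β ≠ 0)
    {y : ℂ → Fin M → ℂ} (hy : ∀ c, IsLevelList N M β c (y c)) {u : Filter ℂ} [u.NeBot]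
    (hu : u ≤ 𝓝[≠] 0) {x : Fin M → ℂ} (hx0 : IsLevelList N M β 0 x) (hx : Tendsto y u (𝓝 x))
    (lam mu : Fin N → ℕ) {S : Finset (Fin M)} (hS : S.card = N) {p : Fin M} (hp : p ∈ S)
    (hxp : x p = 0) :
    Tendsto (fun c => c * (levelTerm β lam mu S (y c) * twist N β S (y c) ^ ((M - N) * N) /
      (twist N β S (y c) - 1))) u (𝓝 0) := by
  have hxi : ∀ i, Tendsto (fun c => y c i) u (𝓝 (x i)) := tendsto_pi_nhds.1 hx
  have hid : Tendsto (fun c : ℂ => c) u (𝓝 0) :=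
    tendsto_id.mono_left (hu.trans nhdsWithin_le_nhds)
  have hne : ∀ᶠ c in u, c ≠ 0 := hu self_mem_nhdsWithin
  have hMN : M - N ≠ 0 := by
    intro h
    have h1 := hx0.pow_mul_pow p
    rw [h, hxp, pow_zero, one_mul, zero_add, mul_zero, neg_zero] at h1
    exact pow_ne_zero _ hβ h1
  have hnum : ∀ i, invDenominator N M β (x i) ≠ 0 := by
    intro i
    have h1 := hx0.pow_mul_pow i
    rw [mul_zero, neg_zero, mul_eq_zero, pow_eq_zero_iff hMN, pow_eq_zero_iff (by omega)] at h1
    rcases h1 with h1 | h1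
    · rw [h1, invDenominator, mul_zero, zero_add, ← Nat.cast_sub hNM]
      exact mul_ne_zero (Nat.cast_ne_zero.2 hMN) hβ
    · have h2 : invDenominator N M β (x i) = -(N * β) := by
        rw [invDenominator, eq_neg_of_add_eq_zero_left h1]; ring
      rw [h2, neg_ne_zero]
      exact mul_ne_zero (Nat.cast_ne_zero.2 (by omega)) hβ
  have hsq : ((-1 : ℂ) ^ N) * (-1) ^ N = 1 := by rw [← mul_pow]; simp
  -- `c / f'(y_i)` converges
  have hder : ∀ i, Tendsto (fun c => c / (bethePotential N M β).derivative.eval (y c i)) u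
      (𝓝 (-(-1) ^ N * (x i * (x i + β) / invDenominator N M β (x i)))) := by
    intro i
    have h0 : Tendsto (fun c => invDenominator N M β (y c i)) u
        (𝓝 (invDenominator N M β (x i))) := ((hxi i).const_mul _).add_const _
    have h1 : Tendsto (fun c => -(-1) ^ N * (y c i * (y c i + β) / invDenominator N M β (y c i))) u
        (𝓝 (-(-1) ^ N * (x i * (x i + β) / invDenominator N M β (x i)))) :=
      (((hxi i).mul ((hxi i).add_const β)).div h0 (hnum i)).const_mul _
    refine h1.congr' ?_
    filter_upwards [h0.eventually_ne (hnum i),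
      hu (eventually_resolventDenominator_ne_zero hN hNM β 0)] with c h2 h3
    have h4 := (resolventDenominator_ne_zero_iff.1 (h3 _ (hy c))).1 i
    have h5 := mul_eval_derivative_bethePotential (β := β) hNM (y c i)
    rw [eval_of_eq_prod (hy c)] at h5
    field_simp
    linear_combination (-(-1) ^ N) * h5 + (c * invDenominator N M β (y c i)) * hsq
  -- `twist ^ (M - N) / c` converges
  have htw : ∃ a, Tendsto (fun c => twist N β S (y c) ^ (M - N) / c) u (𝓝 a) := by
    have h1 : Tendsto (fun c => ((-1) ^ (M + N) * ((∏ i ∈ S.erase p, y c i) *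
        ∏ i ∈ Sᶜ, (y c i + β))) ^ (M - N) * (-(-1) ^ N * ((y c p + β) ^ N)⁻¹)) u
        (𝓝 (((-1) ^ (M + N) * ((∏ i ∈ S.erase p, x i) *
        ∏ i ∈ Sᶜ, (x i + β))) ^ (M - N) * (-(-1) ^ N * ((x p + β) ^ N)⁻¹))) := by
      refine ((((tendsto_finsetProd _ fun i _ => hxi i).mul
        (tendsto_finsetProd _ fun i _ => (hxi i).add_const β)).const_mul _).pow _).mul ?_
      refine ((((hxi p).add_const β).pow N).inv₀ ?_).const_mul _
      rw [hxp, zero_add]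
      exact pow_ne_zero _ hβ
    refine ⟨_, h1.congr' ?_⟩
    filter_upwards [hne] with c hc
    have h2 : (y c p + β) ^ N ≠ 0 := pow_ne_zero _ ((hy c).add_ne_zero hN hc p)
    have h3 := (hy c).pow_mul_pow p
    have h4 : twist N β S (y c) = ((-1) ^ (M + N) * ((∏ i ∈ S.erase p, y c i) *
        ∏ i ∈ Sᶜ, (y c i + β))) * y c p := by
      rw [twist, ← Finset.mul_prod_erase S _ hp]; ring
    rw [h4, mul_pow _ (y c p), mul_div_assoc]
    congr 1
    rw [eq_div_iff hc]
    apply mul_right_cancel₀ h2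
    rw [h3]
    field_simp
  obtain ⟨a, ha⟩ := htw
  have ht0 : twist N β S x - 1 ≠ 0 := by
    rw [twist, Finset.prod_eq_zero hp hxp]; simp
  have hmain := hid.mul ((((tendsto_minorProduct (β := β) hx lam mu S).mul
    (tendsto_finsetProd S fun i _ => hder i)).mul (ha.pow N)).div
      ((tendsto_twist (N := N) (β := β) hx S).sub_const 1) ht0)
  rw [zero_mul] at hmain
  refine hmain.congr' ?_
  filter_upwards [hne] with c hc
  simp only [Pi.div_apply]
  rw [levelTerm, Finset.prod_div_distrib, Finset.prod_const, hS, div_pow, ← pow_mul]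
  field_simp

/-- A subset of a level set all of whose points tend to the root `-β`: its `levelTerm` stays
bounded, because all differences `y_i + β` have the same order of magnitude. -/
theorem tendsto_levelTerm_of_limit_ne_zero (hN : 1 ≤ N) (hNM : N ≤ M) (hβ : β ≠ 0)
    (hβM : (-β) ^ M ≠ 1)
    {y : ℂ → Fin M → ℂ} (hy : ∀ c, IsLevelList N M β c (y c)) {u : Ultrafilter ℂ}
    (hu : (u : Filter ℂ) ≤ 𝓝[≠] 0) {x : Fin M → ℂ} (hx0 : IsLevelList N M β 0 x)
    (hx : Tendsto y u (𝓝 x)) (lam mu : Fin N → ℕ) {S : Finset (Fin M)} (hS : S.card = N)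
    (hxS : ∀ i ∈ S, x i ≠ 0) (K : ℕ) :
    Tendsto (fun c => c * (levelTerm β lam mu S (y c) * twist N β S (y c) ^ K /
      (twist N β S (y c) - 1))) u (𝓝 0) := by
  have hxi : ∀ i, Tendsto (fun c => y c i) u (𝓝 (x i)) := tendsto_pi_nhds.1 hx
  have hid : Tendsto (fun c : ℂ => c) u (𝓝 0) :=
    tendsto_id.mono_left (hu.trans nhdsWithin_le_nhds)
  have hne : ∀ᶠ c in (u : Filter ℂ), c ≠ 0 := hu self_mem_nhdsWithin
  have hxβ : ∀ i ∈ S, x i = -β := by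
    intro i hi
    have h1 := hx0.pow_mul_pow i
    rw [mul_zero, neg_zero, mul_eq_zero, pow_eq_zero_iff (by omega : N ≠ 0)] at h1
    exact eq_neg_of_add_eq_zero_left (h1.resolve_left (pow_ne_zero _ (hxS i hi)))
  -- the root `-β` has multiplicity `N`, so the remaining points tend to `0`
  have hxc : ∀ i ∈ Sᶜ, x i = 0 := by
    intro i hi
    by_contra h0
    have hiS : i ∉ S := Finset.mem_compl.1 hi
    have h1 := hx0.pow_mul_pow i
    rw [mul_zero, neg_zero, mul_eq_zero, pow_eq_zero_iff (by omega : N ≠ 0)] at h1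
    have h2 : x i = -β := eq_neg_of_add_eq_zero_left (h1.resolve_left (pow_ne_zero _ h0))
    have h3 : ∏ j ∈ insert i S, (X - C (x j)) = (X + C β) ^ (N + 1) := by
      rw [← hS, ← Finset.card_insert_of_notMem hiS]
      refine Finset.prod_eq_pow_card fun j hj => ?_
      rcases Finset.mem_insert.1 hj with rfl | hj
      · rw [h2]; simp
      · rw [hxβ j hj]; simp
    have h4 : (X + C β) ^ (N + 1) ∣ bethePotential N M β := by
      have h5 : bethePotential N M β = ∏ j, (X - C (x j)) := by
        rw [← hx0]; simp
      rw [← h3, h5]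
      exact Finset.prod_dvd_prod_of_subset _ _ _ (Finset.subset_univ _)
    rw [bethePotential, pow_succ', mul_dvd_mul_iff_right (pow_ne_zero _ (X_add_C_ne_zero β))] at h4
    have h6 := eval_dvd (x := -β) h4
    simp only [eval_add, eval_X, eval_C, neg_add_cancel, eval_pow, zero_dvd_iff] at h6
    exact pow_ne_zero _ (neg_ne_zero.2 hβ) h6
  have ht : twist N β S x = (-β) ^ M := by
    rw [twist, Finset.prod_congr rfl hxβ, Finset.prod_const, hS,
      Finset.prod_congr rfl fun i hi => by rw [hxc i hi, zero_add], Finset.prod_const,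
      Finset.card_compl, hS, Fintype.card_fin]
    obtain ⟨L, rfl⟩ := Nat.exists_eq_add_of_le hNM
    have h1 : ((-1 : ℂ) ^ N) * (-1) ^ N = 1 := by rw [← mul_pow]; simp
    rw [add_tsub_cancel_left, neg_pow β (N + L), neg_pow β N, pow_add (-1) N L,
      pow_add (-1) (N + L) N, pow_add (-1) N L, pow_add β]
    linear_combination ((-1) ^ N * (-1) ^ L * β ^ N * β ^ L) * h1
  have ht0 : twist N β S x - 1 ≠ 0 := by rw [ht]; exact sub_ne_zero.2 hβM
  obtain ⟨p, hp⟩ : S.Nonempty := by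
    rw [← Finset.card_pos]; omega
  -- the ratios `(y_i + β) / (y_p + β)` converge to roots of unity
  have hrat : ∀ i, ∃ v : ℂ, i ∈ S → v ≠ 0 ∧
      Tendsto (fun c => (y c i + β) / (y c p + β)) u (𝓝 v) := by
    intro i
    by_cases hi : i ∈ S
    swap
    · exact ⟨0, fun h => absurd h hi⟩
    have h1 : Tendsto (fun c => y c p ^ (M - N) / y c i ^ (M - N)) u (𝓝 1) := by
      have h2 := ((hxi p).pow (M - N)).div ((hxi i).pow (M - N)) (pow_ne_zero _ (hxS i hi))
      rwa [hxβ i hi, hxβ p hp, div_self (pow_ne_zero _ (neg_ne_zero.2 hβ))] at h2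
    have h3 : Tendsto (fun c => ((y c i + β) / (y c p + β)) ^ N) u (𝓝 1) := by
      refine h1.congr' ?_
      filter_upwards [hne, (hxi i).eventually_ne (hxS i hi)] with c hc h4
      have h5 := (hy c).pow_mul_pow i
      rw [← (hy c).pow_mul_pow p] at h5
      have h6 := (hy c).add_ne_zero hN hc p
      rw [div_pow, div_eq_div_iff (pow_ne_zero _ h4) (pow_ne_zero _ h6)]
      linear_combination -h5
    have h4 : ∀ᶠ c in (u : Filter ℂ), (y c i + β) / (y c p + β) ∈ Metric.closedBall (0 : ℂ) 2 := by
      have h5 := (continuous_norm.tendsto _).comp h3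
      rw [norm_one] at h5
      filter_upwards [h5.eventually_lt_const one_lt_two] with c hc
      rw [mem_closedBall_zero_iff]
      by_contra hlt
      have h6 := not_le.1 hlt
      simp only [Function.comp, norm_pow] at hc
      have h7 := le_self_pow₀ (a := ‖(y c i + β) / (y c p + β)‖) (by linarith) (by omega : N ≠ 0)
      linarith
    obtain ⟨v, _, hv⟩ := (isCompact_closedBall (0 : ℂ) 2).ultrafilter_le_nhds
      (u.map fun c => (y c i + β) / (y c p + β)) (le_principal_iff.2 h4)
    have hv' : Tendsto (fun c => (y c i + β) / (y c p + β)) u (𝓝 v) := hv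
    refine ⟨v, fun _ => ⟨?_, hv'⟩⟩
    rintro rfl
    have h5 := tendsto_nhds_unique h3 (hv'.pow N)
    rw [zero_pow (by omega)] at h5
    exact one_ne_zero h5
  choose v hv using hrat
  have hminor : ∃ a, Tendsto (fun c => minorProduct β lam mu S (y c) /
      ((y c p + β) ^ (N - 1)) ^ N) u (𝓝 a) := by
    have hcont : Continuous fun A : Matrix (Fin N) (Fin N) ℂ => A.det := continuous_id.matrix_det
    have h1 : Tendsto (fun c => (Matrix.of fun k l : Fin N => ∑ i ∈ S,
        y c i ^ lam k * y c i ^ (M - N - mu l) *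
          (((y c i + β) / (y c p + β)) ^ (N - 1 - (k : ℕ)) *
            ((y c i + β) / (y c p + β)) ^ (l : ℕ))).det) u
        (𝓝 (Matrix.of fun k l : Fin N => ∑ i ∈ S,
          x i ^ lam k * x i ^ (M - N - mu l) *
            (v i ^ (N - 1 - (k : ℕ)) * v i ^ (l : ℕ))).det) := by
      refine (hcont.tendsto _).comp ?_
      refine tendsto_pi_nhds.2 fun k => tendsto_pi_nhds.2 fun l =>
        tendsto_finsetSum _ fun i hi => ?_
      exact (((hxi i).pow _).mul ((hxi i).pow _)).mul
        (((hv i hi).2.pow _).mul ((hv i hi).2.pow _))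
    refine ⟨_, h1.congr' ?_⟩
    filter_upwards [hne] with c hc
    set ρ := y c p + β with hρ
    have hρ0 : ρ ≠ 0 := (hy c).add_ne_zero hN hc p
    have h2 : minorProduct β lam mu S (y c) = (Matrix.of fun k l : Fin N => ρ ^ (N - 1 - (k : ℕ)) *
        (Matrix.of fun k l : Fin N => ρ ^ (l : ℕ) * ((Matrix.of fun k l : Fin N => ∑ i ∈ S,
        y c i ^ lam k * y c i ^ (M - N - mu l) *
          (((y c i + β) / ρ) ^ (N - 1 - (k : ℕ)) *
            ((y c i + β) / ρ) ^ (l : ℕ))) k l)) k l).det := by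
      rw [minorProduct]
      congr 1
      ext k l
      simp only [Matrix.of_apply, Finset.mul_sum, leftPoly, rightPoly, eval_mul, eval_pow, eval_add,
        eval_X, eval_C]
      refine Finset.sum_congr rfl fun i _ => ?_
      rw [div_pow, div_pow]
      field_simp
    rw [h2, Matrix.det_mul_column, Matrix.det_mul_row]
    have h3 : (∏ k : Fin N, ρ ^ (N - 1 - (k : ℕ))) * ∏ l : Fin N, ρ ^ (l : ℕ) =
        (ρ ^ (N - 1)) ^ N := by
      rw [← Finset.prod_mul_distrib]
      have : ∀ k : Fin N, ρ ^ (N - 1 - (k : ℕ)) * ρ ^ (k : ℕ) = ρ ^ (N - 1) := fun k => by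
        rw [← pow_add]; congr 1; have := k.2; omega
      simp [this]
    rw [← mul_assoc, h3, mul_div_cancel_left₀ _ (pow_ne_zero _ (pow_ne_zero _ hρ0))]
  -- the derivative is `(y + β) ^ (N - 1)` times a factor that does not vanish at `-β`
  set h : ℂ[X] := derivative (X ^ (M - N)) * (X + C β) + (N : ℂ[X]) * X ^ (M - N) with hh
  have hder : ∀ w, (bethePotential N M β).derivative.eval w = (w + β) ^ (N - 1) * h.eval w := by
    intro w
    obtain ⟨n, rfl⟩ := Nat.exists_eq_add_of_le' hN
    simp only [hh, bethePotential, derivative_mul, derivative_X_add_C_pow, eval_add, eval_mul,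
      eval_pow, eval_X, eval_C, add_tsub_cancel_right, eval_natCast, Nat.cast_add, Nat.cast_one,
      eval_one]
    ring
  have hhβ : h.eval (-β) ≠ 0 := by
    simp only [hh, eval_add, eval_mul, eval_X, eval_C, eval_natCast, eval_pow, neg_add_cancel,
      mul_zero, zero_add]
    exact mul_ne_zero (Nat.cast_ne_zero.2 (by omega)) (pow_ne_zero _ (neg_ne_zero.2 hβ))
  have hprod : ∃ a, Tendsto (fun c => (∏ i ∈ S, (bethePotential N M β).derivative.eval (y c i)) /
      ((y c p + β) ^ (N - 1)) ^ N) u (𝓝 a) ∧ a ≠ 0 := by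
    refine ⟨∏ i ∈ S, (v i ^ (N - 1) * h.eval (x i)), ?_, Finset.prod_ne_zero_iff.2 fun i hi =>
      mul_ne_zero (pow_ne_zero _ (hv i hi).1) (by rw [hxβ i hi]; exact hhβ)⟩
    have h1 : Tendsto (fun c => ∏ i ∈ S, (((y c i + β) / (y c p + β)) ^ (N - 1) * h.eval (y c i))) u
        (𝓝 (∏ i ∈ S, (v i ^ (N - 1) * h.eval (x i)))) :=
      tendsto_finsetProd _ fun i hi => ((hv i hi).2.pow _).mul
        ((h.continuous.tendsto _).comp (hxi i))
    refine h1.congr fun c => ?_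
    have h2 : ((y c p + β) ^ (N - 1)) ^ N = ∏ _i ∈ S, (y c p + β) ^ (N - 1) := by
      rw [Finset.prod_const, hS]
    rw [h2, ← Finset.prod_div_distrib]
    refine Finset.prod_congr rfl fun i _ => ?_
    rw [hder, div_pow]
    ring
  obtain ⟨a, ha⟩ := hminor
  obtain ⟨b, hb, hb0⟩ := hprod
  have hmain := hid.mul (((ha.div hb hb0).mul ((tendsto_twist (N := N) (β := β) hx S).pow K)).div
      ((tendsto_twist (N := N) (β := β) hx S).sub_const 1) ht0)
  rw [zero_mul] at hmain
  refine hmain.congr' ?_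
  filter_upwards [hne] with c hc
  simp only [Pi.div_apply]
  rw [levelTerm, div_div_div_cancel_right₀]
  exact pow_ne_zero _ (pow_ne_zero _ ((hy c).add_ne_zero hN hc p))

/-- At level zero `betheResolvent` has no residue. -/
theorem tendsto_mul_betheResolvent_zero (hN : 1 ≤ N) (hNM : N ≤ M) (hβM : (-β) ^ M ≠ 1)
    {y : ℂ → Fin M → ℂ} (hy : ∀ c, IsLevelList N M β c (y c)) (lam mu : Fin N → ℕ) :
    Tendsto (fun c => c * betheResolvent β lam mu (y c)) (𝓝[≠] 0) (𝓝 0) := by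
  rcases eq_or_ne β 0 with rfl | hβ
  · exact tendsto_mul_betheResolvent_zero_of_eq_zero hN hNM hy lam mu
  rw [tendsto_iff_ultrafilter]
  intro u hu
  obtain ⟨x, hx0, hx⟩ := exists_ultrafilter_limit hN hNM hy (hu.trans nhdsWithin_le_nhds)
  have hid : Tendsto (fun c : ℂ => c) u (𝓝 0) :=
    tendsto_id.mono_left (hu.trans nhdsWithin_le_nhds)
  choose R hR using exists_polynomial_sum_levelTerm_mul_twist_pow (β := β) hN hNM lam mu
  set K := (M - N) * N with hK
  have h1 : Tendsto (fun c => ∑ S ∈ (univ : Finset (Fin M)).powersetCard N,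
      c * (levelTerm β lam mu S (y c) * twist N β S (y c) ^ K / (twist N β S (y c) - 1))) u
      (𝓝 (∑ S ∈ (univ : Finset (Fin M)).powersetCard N, 0)) := by
    refine tendsto_finsetSum _ fun S hS => ?_
    have hS' := (Finset.mem_powersetCard.1 hS).2
    by_cases h : ∀ i ∈ S, x i ≠ 0
    · exact tendsto_levelTerm_of_limit_ne_zero hN hNM hβ hβM hy hu hx0 hx lam mu hS' h K
    · push Not at h
      obtain ⟨p, hp, hxp⟩ := h
      exact tendsto_levelTerm_of_limit_eq_zero hN hNM hβ hy hu hx0 hx lam mu hS' hp hxp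
  have h2 : Tendsto (fun c => c * ∑ m ∈ range K, (R m).eval c) u
      (𝓝 (0 * ∑ m ∈ range K, (R m).eval 0)) :=
    hid.mul (tendsto_finsetSum _ fun m _ => ((R m).continuous.tendsto 0).comp hid)
  have h3 := h1.sub h2
  simp only [Finset.sum_const_zero, zero_mul, sub_zero] at h3
  refine h3.congr' ?_
  filter_upwards [hu (eventually_resolventDenominator_ne_zero hN hNM β 0),
    hu self_mem_nhdsWithin] with c hc hc0
  have h4 := resolventDenominator_ne_zero_iff.1 (hc _ (hy c))
  have hinj : Function.Injective (y c) := fun i j hij =>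
    injective_of_eval_derivative_ne_zero (hy c) (h4.1 i) hij
  simp_rw [← hR _ c (y c) hc0 (hy c) hinj]
  rw [Finset.sum_comm, Finset.mul_sum, betheResolvent, Finset.mul_sum, ← Finset.sum_sub_distrib]
  refine Finset.sum_congr rfl fun S hS => ?_
  have h5 := h4.2 S hS
  rw [← Finset.mul_sum, ← mul_sub]
  congr 1
  rw [geom_sum_eq (sub_ne_zero.1 h5)]
  field_simp
  ring

end Zero

/-! ### Behaviour at a nonzero level -/

theorem exists_eq_mul_of_eval_eq_zero {p : ℂ[X]} {a : ℂ} (h : p.eval a = 0) :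
    ∃ q : ℂ[X], p = (X - C a) * q ∧ q.eval a = p.derivative.eval a := by
  obtain ⟨q, hq⟩ := dvd_iff_isRoot.2 h
  refine ⟨q, hq, ?_⟩
  rw [hq]
  simp

/-- A critical point of the potential with nonzero value is nondegenerate. -/
theorem eval_second_derivative_ne_zero (hN : 1 ≤ N) (hNM : N ≤ M) {w : ℂ}
    (h0 : (bethePotential N M β).eval w ≠ 0) (h1 : (bethePotential N M β).derivative.eval w = 0) :
    (bethePotential N M β).derivative.derivative.eval w ≠ 0 := by
  have h2 : X * (X + C β) * (bethePotential N M β).derivative =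
      bethePotential N M β * (C (M : ℂ) * X + C (((M : ℂ) - N) * β)) := by
    refine Polynomial.funext fun v => ?_
    have := mul_eval_derivative_bethePotential (β := β) hNM v
    simpa [invDenominator] using this
  have h3 := congrArg (fun p => (derivative p).eval w) h2
  simp only [derivative_mul, derivative_X, derivative_add, derivative_C, eval_add, eval_mul, eval_X,
    eval_C, eval_one, h1, mul_zero, zero_mul, zero_add, add_zero, mul_one] at h3
  intro h4
  rw [h4, mul_zero, eq_comm, mul_eq_zero] at h3
  rcases h3 with h3 | h3
  · exact h0 h3
  · rw [Nat.cast_eq_zero] at h3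
    omega

/-- The only critical point of the potential with nonzero value is the zero of `invDenominator`. -/
theorem eq_of_eval_derivative_eq_zero (hN : 1 ≤ N) (hNM : N ≤ M) {v w : ℂ}
    (hv : (bethePotential N M β).eval v ≠ 0) (hv' : (bethePotential N M β).derivative.eval v = 0)
    (hw : (bethePotential N M β).eval w ≠ 0) (hw' : (bethePotential N M β).derivative.eval w = 0) :
    v = w := by
  have h1 := mul_eval_derivative_bethePotential (β := β) hNM v
  have h2 := mul_eval_derivative_bethePotential (β := β) hNM w
  rw [hv', mul_zero, eq_comm, mul_eq_zero] at h1
  rw [hw', mul_zero, eq_comm, mul_eq_zero] at h2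
  have h3 := h1.resolve_left hv
  have h4 := h2.resolve_left hw
  rw [invDenominator] at h3 h4
  have hM : (M : ℂ) ≠ 0 := Nat.cast_ne_zero.2 (by omega)
  apply mul_left_cancel₀ hM
  linear_combination h3 - h4

theorem minorProduct_eq_zero_of_eq (lam mu : Fin N → ℕ) {S : Finset (Fin M)} (hS : S.card = N)
    {i j : Fin M} (hi : i ∈ S) (hj : j ∈ S) (hij : i ≠ j) (hy : y i = y j) :
    minorProduct β lam mu S y = 0 := by
  set e := S.equivFinOfCardEq hS
  rw [minorProduct, det_sum_eq_mul _ _ S e.symm]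
  rw [Matrix.det_zero_of_column_eq (i := e ⟨i, hi⟩) (j := e ⟨j, hj⟩), zero_mul]
  · intro h
    exact hij (congrArg Subtype.val (e.injective h))
  · intro k
    simp [hy]

section Residues
open Filter Topology Bornology

theorem eval_sub_eval_of_isLevelList {b : ℂ} {x : Fin M → ℂ} (hx : IsLevelList N M β b x)
    (hy : IsLevelList N M β c y) (i : Fin M) :
    c - b = -(-1) ^ N *
      ((bethePotential N M β).eval (y i) - (bethePotential N M β).eval (x i)) := by
  rw [eval_of_eq_prod hx, eval_of_eq_prod hy]
  have hsq : ((-1 : ℂ) ^ N) * (-1) ^ N = 1 := by rw [← mul_pow]; simp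
  linear_combination (-(c - b)) * hsq

/-- Near a double root the product of the level increment and the inverse derivative tends to zero,
and that of the level increment and the inverse square of the derivative converges. -/
theorem tendsto_div_derivative (hN : 1 ≤ N) (hNM : N ≤ M) {y : ℂ → Fin M → ℂ}
    (hy : ∀ c, IsLevelList N M β c (y c)) {b : ℂ} (hb : b ≠ 0) {u : Filter ℂ}
    (hu : u ≤ 𝓝[≠] b) {x : Fin M → ℂ} (hxb : IsLevelList N M β b x) (hx : Tendsto y u (𝓝 x))
    {i : Fin M} (hi : (bethePotential N M β).derivative.eval (x i) = 0) :
    Tendsto (fun c => (c - b) / (bethePotential N M β).derivative.eval (y c i)) u (𝓝 0) ∧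
    ∃ a, Tendsto (fun c => (c - b) / (bethePotential N M β).derivative.eval (y c i) ^ 2) u
      (𝓝 a) := by
  have hxi : Tendsto (fun c => y c i) u (𝓝 (x i)) := tendsto_pi_nhds.1 hx i
  have hf0 : (bethePotential N M β).eval (x i) ≠ 0 := by
    rw [eval_of_eq_prod hxb]; simpa using hb
  obtain ⟨h, hh, hh'⟩ := exists_eq_mul_of_eval_eq_zero hi
  have hh0 : h.eval (x i) ≠ 0 := by
    rw [hh']; exact eval_second_derivative_ne_zero hN hNM hf0 hi
  obtain ⟨q, hq, hq'⟩ := exists_eq_mul_of_eval_eq_zero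
    (p := bethePotential N M β - C ((bethePotential N M β).eval (x i))) (a := x i) (by simp)
  rw [derivative_sub, derivative_C, sub_zero, hi] at hq'
  obtain ⟨g, hg, -⟩ := exists_eq_mul_of_eval_eq_zero hq'
  have hlim : ∀ p : ℂ[X], Tendsto (fun c => p.eval (y c i)) u (𝓝 (p.eval (x i))) := fun p =>
    (p.continuous.tendsto _).comp hxi
  have hcb : ∀ c, c - b = -(-1) ^ N * ((y c i - x i) ^ 2 * g.eval (y c i)) := by
    intro c
    have h1 := congrArg (eval (y c i)) hq
    rw [hg] at h1
    simp only [eval_sub, eval_mul, eval_X, eval_C] at h1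
    rw [eval_sub_eval_of_isLevelList hxb (hy c) i, h1]
    ring
  have hd : ∀ c, (bethePotential N M β).derivative.eval (y c i) =
      (y c i - x i) * h.eval (y c i) := by
    intro c
    rw [hh]
    simp
  have hne : ∀ᶠ c in u, y c i - x i ≠ 0 := by
    filter_upwards [hu self_mem_nhdsWithin] with c hc h0
    have h1 := hcb c
    rw [h0] at h1
    exact hc (sub_eq_zero.1 (by simpa using h1))
  have hsub : Tendsto (fun c => y c i - x i) u (𝓝 0) := by
    simpa using hxi.sub_const (x i)
  constructor
  · have h1 := (hsub.mul ((hlim g).div (hlim h) hh0)).const_mul (-(-1) ^ N)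
    rw [zero_mul, mul_zero] at h1
    refine h1.congr' ?_
    filter_upwards [hne, (hlim h).eventually_ne hh0] with c h2 h3
    rw [hd, hcb, Pi.div_apply]
    field_simp
  · refine ⟨_, (((hlim g).div ((hlim h).pow 2) (pow_ne_zero 2 hh0)).const_mul
      (-(-1) ^ N)).congr' ?_⟩
    filter_upwards [hne, (hlim h).eventually_ne hh0] with c h2 h3
    rw [hd, hcb, Pi.div_apply]
    field_simp

/-- At a nonzero level at most two roots, counted with multiplicity, are critical points. -/
theorem card_filter_eval_derivative_le_two (hN : 1 ≤ N) (hNM : N ≤ M) {b : ℂ} (hb : b ≠ 0)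
    {x : Fin M → ℂ} (hxb : IsLevelList N M β b x) (S : Finset (Fin M)) :
    (S.filter fun i => (bethePotential N M β).derivative.eval (x i) = 0).card ≤ 2 := by
  have hf0 : ∀ i, (bethePotential N M β).eval (x i) ≠ 0 := fun i => by
    rw [eval_of_eq_prod hxb]; simpa using hb
  by_contra hlt
  obtain ⟨i, hi, j, hj, k, hk, hij, hik, hjk⟩ := Finset.two_lt_card.1 (not_le.1 hlt)
  have hi' := (Finset.mem_filter.1 hi).2
  have hxj := eq_of_eval_derivative_eq_zero hN hNM (hf0 j) (Finset.mem_filter.1 hj).2 (hf0 i) hi'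
  have hxk := eq_of_eval_derivative_eq_zero hN hNM (hf0 k) (Finset.mem_filter.1 hk).2 (hf0 i) hi'
  have h1 : ∏ l ∈ {i, j, k}, (X - C (x l)) ∣ bethePotential N M β + C ((-1) ^ N * b) := by
    rw [hxb]
    exact Finset.prod_dvd_prod_of_subset _ _ _ (Finset.subset_univ _)
  rw [Finset.prod_insert (by simp [hij, hik]), Finset.prod_pair hjk, hxj, hxk] at h1
  obtain ⟨q, hq⟩ := h1
  have h2 := congrArg (fun p => (derivative (derivative p)).eval (x i)) hq
  simp only [derivative_add, derivative_C, add_zero, derivative_mul, derivative_sub, derivative_X,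
    sub_zero, eval_add, eval_mul, eval_sub, eval_X, eval_C, sub_self, mul_zero, zero_mul,
    eval_one] at h2
  exact eval_second_derivative_ne_zero hN hNM (hf0 i) hi' h2

/-- At a nonzero level `levelTerm` has no pole of order one or more, not even where the level set
has a double root: there the minors vanish if both roots are chosen. -/
theorem tendsto_sub_mul_levelTerm (hN : 1 ≤ N) (hNM : N ≤ M) {y : ℂ → Fin M → ℂ}
    (hy : ∀ c, IsLevelList N M β c (y c)) {b : ℂ} (hb : b ≠ 0) {u : Filter ℂ}
    (hu : u ≤ 𝓝[≠] b) {x : Fin M → ℂ} (hxb : IsLevelList N M β b x) (hx : Tendsto y u (𝓝 x))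
    (lam mu : Fin N → ℕ) {S : Finset (Fin M)} (hS : S.card = N) :
    Tendsto (fun c => (c - b) * levelTerm β lam mu S (y c)) u (𝓝 0) := by
  have hlim : ∀ (p : ℂ[X]) i, Tendsto (fun c => p.eval (y c i)) u (𝓝 (p.eval (x i))) := fun p i =>
    (p.continuous.tendsto _).comp (tendsto_pi_nhds.1 hx i)
  have hid : Tendsto (fun c : ℂ => c - b) u (𝓝 0) := by
    have : Tendsto (fun c : ℂ => c - b) u (𝓝 (b - b)) :=
      (tendsto_id.mono_left (hu.trans nhdsWithin_le_nhds)).sub_const b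
    rwa [sub_self] at this
  have hmin := tendsto_minorProduct (β := β) hx lam mu S
  set f' := (bethePotential N M β).derivative with hf'
  set I := S.filter fun i => f'.eval (x i) = 0 with hI
  have hIS : I ⊆ S := Finset.filter_subset _ _
  have hcard : I.card ≤ 2 := card_filter_eval_derivative_le_two hN hNM hb hxb S
  have hf0 : ∀ i, (bethePotential N M β).eval (x i) ≠ 0 := fun i => by
    rw [eval_of_eq_prod hxb]; simpa using hb
  have hrest : Tendsto (fun c => ∏ i ∈ S \ I, (f'.eval (y c i))⁻¹) u
      (𝓝 (∏ i ∈ S \ I, (f'.eval (x i))⁻¹)) := by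
    refine tendsto_finsetProd _ fun i hi => (hlim f' i).inv₀ fun h0 => ?_
    rw [Finset.mem_sdiff] at hi
    exact hi.2 (Finset.mem_filter.2 ⟨hi.1, h0⟩)
  have key : Tendsto (fun c => (c - b) * minorProduct β lam mu S (y c) *
      ∏ i ∈ I, (f'.eval (y c i))⁻¹) u (𝓝 0) := by
    have h012 : I.card = 0 ∨ I.card = 1 ∨ I.card = 2 := by omega
    rcases h012 with h | h | h
    · rw [Finset.card_eq_zero] at h
      simp only [h, Finset.prod_empty, mul_one]
      have := hid.mul hmin
      rwa [zero_mul] at this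
    · obtain ⟨i, h⟩ := Finset.card_eq_one.1 h
      have hi : f'.eval (x i) = 0 :=
        (Finset.mem_filter.1 (h ▸ Finset.mem_singleton_self i : i ∈ I)).2
      have h1 := (tendsto_div_derivative hN hNM hy hb hu hxb hx hi).1.mul hmin
      rw [zero_mul] at h1
      refine h1.congr fun c => ?_
      rw [h, Finset.prod_singleton]
      ring
    · obtain ⟨i, j, hij, h⟩ := Finset.card_eq_two.1 h
      have hiI : i ∈ I := h ▸ by simp
      have hjI : j ∈ I := h ▸ by simp
      have hi : f'.eval (x i) = 0 := (Finset.mem_filter.1 hiI).2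
      have hj : f'.eval (x j) = 0 := (Finset.mem_filter.1 hjI).2
      obtain ⟨a, ha⟩ := (tendsto_div_derivative hN hNM hy hb hu hxb hx hi).2
      obtain ⟨a', ha'⟩ := (tendsto_div_derivative hN hNM hy hb hu hxb hx hj).2
      rw [minorProduct_eq_zero_of_eq lam mu hS (hIS hiI) (hIS hjI) hij
        (eq_of_eval_derivative_eq_zero hN hNM (hf0 i) hi (hf0 j) hj)] at hmin
      -- the square of the expression converges to zero
      have h1 := (hmin.pow 2).mul (ha.mul ha')
      rw [zero_pow two_ne_zero, zero_mul] at h1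
      rw [tendsto_zero_iff_norm_tendsto_zero] at h1 ⊢
      have h2 := (Real.continuous_sqrt.tendsto 0).comp h1
      rw [Real.sqrt_zero] at h2
      refine h2.congr fun c => ?_
      rw [h, Finset.prod_pair hij, Function.comp]
      rw [show minorProduct β lam mu S (y c) ^ 2 * ((c - b) / eval (y c i) f' ^ 2 *
        ((c - b) / eval (y c j) f' ^ 2)) = ((c - b) * minorProduct β lam mu S (y c) *
        ((eval (y c i) f')⁻¹ * (eval (y c j) f')⁻¹)) ^ 2 by ring, norm_pow,
        Real.sqrt_sq (norm_nonneg _)]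
  have h1 := key.mul hrest
  rw [zero_mul] at h1
  refine h1.congr fun c => ?_
  rw [levelTerm, div_eq_mul_inv, ← Finset.prod_inv_distrib, ← Finset.prod_sdiff hIS]
  ring

theorem tendsto_prod_sub_div {ι : Type*} {u : Filter ℂ} {b : ℂ} {a : ι → ℂ → ℂ} {a₀ d : ι → ℂ}
    (S : Finset ι) (ha : ∀ i ∈ S, Tendsto (a i) u (𝓝 (a₀ i)))
    (hd : ∀ i ∈ S, Tendsto (fun c => (a i c - a₀ i) / (c - b)) u (𝓝 (a₀ i * d i))) :
    Tendsto (fun c => (∏ i ∈ S, a i c - ∏ i ∈ S, a₀ i) / (c - b)) u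
      (𝓝 ((∏ i ∈ S, a₀ i) * ∑ i ∈ S, d i)) := by
  classical
  induction S using Finset.induction_on with
  | empty => simpa using tendsto_const_nhds
  | insert i S hi ih =>
    have h1 := ih (fun j hj => ha j (by simp [hj])) (fun j hj => hd j (by simp [hj]))
    have h2 : Tendsto (fun c => ∏ j ∈ S, a j c) u (𝓝 (∏ j ∈ S, a₀ j)) :=
      tendsto_finsetProd _ fun j hj => ha j (by simp [hj])
    have h3 := ((hd i (by simp)).mul h2).add (h1.const_mul (a₀ i))
    simp only [Finset.prod_insert hi, Finset.sum_insert hi]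
    rw [show a₀ i * d i * ∏ j ∈ S, a₀ j + a₀ i * ((∏ j ∈ S, a₀ j) * ∑ j ∈ S, d j) =
      a₀ i * (∏ j ∈ S, a₀ j) * (d i + ∑ j ∈ S, d j) by ring] at h3
    refine h3.congr fun c => ?_
    ring

/-- The derivative of a simple root with respect to the level. -/
theorem tendsto_root_sub_div (hNM : N ≤ M) {y : ℂ → Fin M → ℂ}
    (hy : ∀ c, IsLevelList N M β c (y c)) {b : ℂ} (hb : b ≠ 0) {u : Filter ℂ}
    (hu : u ≤ 𝓝[≠] b) {x : Fin M → ℂ} (hxb : IsLevelList N M β b x) (hx : Tendsto y u (𝓝 x))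
    {i : Fin M} (hi : invDenominator N M β (x i) ≠ 0) :
    Tendsto (fun c => (y c i - x i) / (c - b)) u
      (𝓝 (x i * (x i + β) / (b * invDenominator N M β (x i)))) := by
  have hxi : Tendsto (fun c => y c i) u (𝓝 (x i)) := tendsto_pi_nhds.1 hx i
  have hsq : ((-1 : ℂ) ^ N) * (-1) ^ N = 1 := by rw [← mul_pow]; simp
  have hd := hxb.eval_derivative_ne_zero hNM hb hi
  obtain ⟨q, hq, hq'⟩ := exists_eq_mul_of_eval_eq_zero
    (p := bethePotential N M β - C ((bethePotential N M β).eval (x i))) (a := x i) (by simp)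
  rw [derivative_sub, derivative_C, sub_zero] at hq'
  have hq0 : q.eval (x i) ≠ 0 := by rwa [hq']
  have hlim : Tendsto (fun c => q.eval (y c i)) u (𝓝 (q.eval (x i))) :=
    (q.continuous.tendsto _).comp hxi
  have h1 := (hlim.inv₀ hq0).const_mul (-(-1) ^ N)
  have h2 : -(-1) ^ N * (q.eval (x i))⁻¹ = x i * (x i + β) / (b * invDenominator N M β (x i)) := by
    have h3 := mul_eval_derivative_bethePotential (β := β) hNM (x i)
    rw [eval_of_eq_prod hxb, ← hq'] at h3
    field_simp
    linear_combination -h3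
  rw [h2] at h1
  refine h1.congr' ?_
  filter_upwards [hu self_mem_nhdsWithin, hlim.eventually_ne hq0] with c hc h3
  have hc' : c - b ≠ 0 := sub_ne_zero.2 hc
  have h4 := congrArg (eval (y c i)) hq
  simp only [eval_sub, eval_mul, eval_X, eval_C] at h4
  have h5 := eval_sub_eval_of_isLevelList hxb (hy c) i
  rw [h4] at h5
  rw [eq_div_iff hc', h5]
  field_simp
  linear_combination (y c i - x i) * hsq

/-- The derivative of the twist at a solution of the Bethe equations. -/
theorem tendsto_twist_sub_one_div (hN : 1 ≤ N) (hNM : N ≤ M) {y : ℂ → Fin M → ℂ}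
    (hy : ∀ c, IsLevelList N M β c (y c)) {b : ℂ} (hb : b ≠ 0) {u : Filter ℂ}
    (hu : u ≤ 𝓝[≠] b) {x : Fin M → ℂ} (hxb : IsLevelList N M β b x) (hx : Tendsto y u (𝓝 x))
    {S : Finset (Fin M)} (hS : twist N β S x = 1)
    (hi : ∀ i ∈ S, invDenominator N M β (x i) ≠ 0) :
    Tendsto (fun c => (twist N β S (y c) - 1) / (c - b)) u
      (𝓝 (b⁻¹ * (1 + ∑ i ∈ S, β / invDenominator N M β (x i)))) := by
  have hxi : ∀ i, Tendsto (fun c => y c i) u (𝓝 (x i)) := tendsto_pi_nhds.1 hx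
  have hxβ : ∀ i, x i + β ≠ 0 := hxb.add_ne_zero hN hb
  have hroot := fun i hiS => tendsto_root_sub_div hNM hy hb hu hxb hx (hi i hiS)
  have h1 := tendsto_prod_sub_div (b := b) (a := fun i c => y c i) (a₀ := x)
    (d := fun i => (x i + β) / (b * invDenominator N M β (x i))) S (fun i _ => hxi i)
    (fun i hiS => by simpa only [mul_div_assoc] using hroot i hiS)
  have h2 := tendsto_prod_sub_div (b := b) (a := fun i c => y c i + β) (a₀ := fun i => x i + β)
    (d := fun i => x i / (b * invDenominator N M β (x i))) S (fun i _ => (hxi i).add_const β)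
    (fun i hiS => by
      refine ((hroot i hiS).congr fun c => ?_).trans_eq ?_
      · rw [add_sub_add_right_eq_sub]
      · congr 1; ring)
  have h3 : Tendsto (fun c => ∏ i ∈ S, y c i) u (𝓝 (∏ i ∈ S, x i)) :=
    tendsto_finsetProd _ fun i _ => hxi i
  have hX0 : ∏ i ∈ S, (x i + β) ≠ 0 := Finset.prod_ne_zero_iff.2 fun i _ => hxβ i
  have h4 : Tendsto (fun c => ∏ i ∈ S, (y c i + β)) u (𝓝 (∏ i ∈ S, (x i + β))) :=
    tendsto_finsetProd _ fun i _ => (hxi i).add_const β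
  have hbal := hxb.twist_mul hN S
  rw [hS, one_mul] at hbal
  have h5 := ((h3.add (h1.const_mul b)).sub h2).mul (h4.inv₀ hX0)
  have h6 : (∏ i ∈ S, x i +
      b * ((∏ i ∈ S, x i) * ∑ i ∈ S, (x i + β) / (b * invDenominator N M β (x i))) -
      (∏ i ∈ S, (x i + β)) * ∑ i ∈ S, x i / (b * invDenominator N M β (x i))) *
      (∏ i ∈ S, (x i + β))⁻¹ = b⁻¹ * (1 + ∑ i ∈ S, β / invDenominator N M β (x i)) := by
    have h7 : ∑ i ∈ S, β / invDenominator N M β (x i) =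
        b * (∑ i ∈ S, (x i + β) / (b * invDenominator N M β (x i)) -
          ∑ i ∈ S, x i / (b * invDenominator N M β (x i))) := by
      rw [← Finset.sum_sub_distrib, Finset.mul_sum]
      refine Finset.sum_congr rfl fun i hiS => ?_
      have := hi i hiS
      field_simp
      ring
    rw [h7]
    set s1 := ∑ i ∈ S, (x i + β) / (b * invDenominator N M β (x i))
    set s2 := ∑ i ∈ S, x i / (b * invDenominator N M β (x i))
    rw [hbal] at hX0 ⊢
    have hP0 := (mul_ne_zero_iff.1 hX0).2
    field_simp
    ring
  rw [h6] at h5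
  refine h5.congr' ?_
  filter_upwards [hu self_mem_nhdsWithin, h4.eventually_ne hX0] with c hc h7
  have hc' : c - b ≠ 0 := sub_ne_zero.2 hc
  have h8 := (hy c).twist_mul hN S
  rw [← div_eq_mul_inv, div_eq_div_iff h7 hc']
  field_simp
  linear_combination -h8 + hbal

end Residues

/-! ### Level lists and solutions of the Bethe equations -/

/-- The Bethe polynomial is, up to rescaling the variable, the reverse of the polynomial that
defines a level list. -/
theorem IsLevelList.reverse_eq (hN : 1 ≤ N) (hNM : N ≤ M) {κ : ℂ} (h : IsLevelList N M β κ y)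
    (s : ℂ) :
    (1 + C (s * β) * X) ^ N + C ((-1) ^ N * (κ * s ^ M)) * X ^ M = ∏ i, (1 - C (s * y i) * X) := by
  refine Polynomial.funext fun w => ?_
  simp only [eval_add, eval_pow, eval_mul, eval_one, eval_C, eval_X, eval_prod, eval_sub]
  rw [show s * β * w = β * (s * w) by ring,
    show (-1) ^ N * (κ * s ^ M) * w ^ M = (-1) ^ N * κ * (s * w) ^ M by rw [mul_pow]; ring,
    Finset.prod_congr rfl fun i _ => show 1 - s * y i * w = 1 - y i * (s * w) by ring]
  generalize s * w = v
  rcases eq_or_ne v 0 with rfl | hv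
  · simp [show M ≠ 0 by omega]
  · have h1 := congrArg (eval v⁻¹) h
    rw [eval_add, eval_bethePotential, eval_C, eval_prod] at h1
    simp only [eval_sub, eval_X, eval_C] at h1
    have h2 : ∏ i, (1 - y i * v) = v ^ M * ∏ i, (v⁻¹ - y i) := by
      rw [show v ^ M = ∏ _i : Fin M, v by simp, ← Finset.prod_mul_distrib]
      refine Finset.prod_congr rfl fun i _ => ?_
      field_simp
    rw [h2, ← h1]
    obtain ⟨L, rfl⟩ := Nat.exists_eq_add_of_le hNM
    rw [add_tsub_cancel_left, show (1 + β * v) = v * (v⁻¹ + β) by field_simp, mul_pow, pow_add,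
      inv_pow]
    field_simp

theorem betheDenominator_inv {w : ℂ} (hw : w ≠ 0) :
    betheDenominator N M β w⁻¹ = invDenominator N M β w / w := by
  rw [betheDenominator, invDenominator]
  field_simp

theorem betheSumFactor_eq {z : Fin N → ℂ} (hz : ∀ j, z j ≠ 0) :
    betheSumFactor M β z = 1 + ∑ j, β / invDenominator N M β (z j)⁻¹ := by
  rw [betheSumFactor]
  congr 1
  refine Finset.sum_congr rfl fun j _ => ?_
  have h1 := betheDenominator_inv (N := N) (M := M) (β := β) (inv_ne_zero (hz j))
  rw [inv_inv, div_inv_eq_mul] at h1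
  rw [h1, mul_div_mul_right _ _ (hz j)]

theorem IsLevelList.ne_zero_of_twist_eq_one (hN : 1 ≤ N) {b : ℂ} (hb : b ≠ 0)
    (h : IsLevelList N M β b y) {S : Finset (Fin M)} (hS : twist N β S y = 1) :
    ∀ i ∈ S, y i ≠ 0 := by
  intro i hi h0
  have h1 := h.twist_mul hN S
  rw [Finset.prod_eq_zero hi h0, mul_zero, hS, one_mul] at h1
  exact Finset.prod_ne_zero_iff.2 (fun j _ => h.add_ne_zero hN hb j) h1

theorem IsLevelList.prod_one_add_inv (hN : 1 ≤ N) {b : ℂ} (hb : b ≠ 0)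
    (h : IsLevelList N M β b y) {S : Finset (Fin M)} (hS : twist N β S y = 1) :
    ∏ i ∈ S, (1 + β * (y i)⁻¹) = b := by
  have h0 := h.ne_zero_of_twist_eq_one hN hb hS
  have h1 := h.twist_mul hN S
  rw [hS, one_mul] at h1
  have h2 : ∏ i ∈ S, y i ≠ 0 := Finset.prod_ne_zero_iff.2 h0
  rw [Finset.prod_congr rfl fun i hi => show 1 + β * (y i)⁻¹ = (y i + β) / y i by
    have := h0 i hi
    field_simp, Finset.prod_div_distrib, h1, mul_div_cancel_right₀ _ h2]

/-- A subset of a level set whose twist is `1` is a solution of the Bethe equations in the sense of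
`BetheNondegenerate`, so that the denominators of the weight do not vanish there. -/
theorem IsLevelList.denominators_ne_zero (hN : 1 ≤ N) (hNM : N ≤ M) (hβ : BetheNondegenerate N M β)
    {b : ℂ} (hb : b ≠ 0) (h : IsLevelList N M β b y) {S : Finset (Fin M)} (hcard : S.card = N)
    (hS : twist N β S y = 1) :
    (∀ i ∈ S, invDenominator N M β (y i) ≠ 0) ∧
      1 + ∑ i ∈ S, β / invDenominator N M β (y i) ≠ 0 := by
  have h0 := h.ne_zero_of_twist_eq_one hN hb hS
  set e := S.equivFinOfCardEq hcard
  set z : Fin N → ℂ := fun j => (y (e.symm j))⁻¹ with hz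
  have hsum : ∀ g : ℂ → ℂ, ∑ j, g (z j) = ∑ i ∈ S, g (y i)⁻¹ := fun g => by
    rw [← Finset.sum_coe_sort S fun i => g (y i)⁻¹]
    exact Equiv.sum_comp e.symm fun i : S => g (y i)⁻¹
  have hprod : ∏ j, (1 + β * z j) = b := by
    rw [← h.prod_one_add_inv hN hb hS, ← Finset.prod_coe_sort S fun i => 1 + β * (y i)⁻¹]
    exact Equiv.prod_comp e.symm fun i : S => 1 + β * (y i)⁻¹
  have hdvd : ∏ j, (X - C (z j)) ∣ bethePolynomial M β z := by
    have h1 := h.reverse_eq hN hNM 1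
    simp only [one_mul, one_pow, mul_one] at h1
    rw [bethePolynomial, hprod, h1]
    refine dvd_trans ?_ (Finset.prod_dvd_prod_of_subset S univ _ (Finset.subset_univ _))
    have h2 : ∏ j, (X - C (z j)) = ∏ i ∈ S, (X - C (y i)⁻¹) := by
      rw [← Finset.prod_coe_sort S fun i => X - C (y i)⁻¹]
      exact Equiv.prod_comp e.symm fun i : S => X - C (y i)⁻¹
    rw [h2]
    refine Finset.prod_dvd_prod_of_dvd _ _ fun i hi => ⟨-C (y i), ?_⟩
    rw [mul_neg, sub_mul, ← C_mul, inv_mul_cancel₀ (h0 i hi), C_1]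
    ring
  have hreg : ∀ j, 1 + β * z j ≠ 0 := by
    intro j h5
    have h3 := h0 _ (e.symm j).2
    apply h.add_ne_zero hN hb (e.symm j)
    simp only [hz] at h5
    field_simp at h5
    rwa [mul_zero] at h5
  obtain ⟨h1, h2⟩ := hβ.denominators_ne_zero z hreg hdvd
  constructor
  · intro i hi
    have h3 := h1 (e ⟨i, hi⟩)
    simp only [hz, Equiv.symm_apply_apply] at h3
    rw [betheDenominator_inv (h0 i hi)] at h3
    exact fun h4 => h3 (by rw [h4, zero_div])
  · rw [betheSumFactor_eq fun j => inv_ne_zero (h0 _ (e.symm j).2),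
        hsum fun w => β / invDenominator N M β w⁻¹] at h2
    simpa using h2

/-- The level of a solution of the Bethe equations. -/
def betheLevel (β : ℂ) (Z : Finset ℂ) : ℂ := ∏ z ∈ Z, (1 + β * z)

/-- The summand of the orthogonality relation, written as a symmetric function of the
solution. -/
def betheSummand (M : ℕ) (β : ℂ) (lam mu : Fin N → ℕ) (Z : Finset ℂ) : ℂ :=
  (Matrix.of fun k l => ∑ z ∈ Z, (leftPoly β lam k).eval z⁻¹ * (rightPoly M β mu l).eval z⁻¹).det /
    (∏ z ∈ Z, (bethePotential N M β).derivative.eval z⁻¹) *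
    (betheLevel β Z / (1 + ∑ z ∈ Z, β / invDenominator N M β z⁻¹))

theorem IsBetheSolution.betheLevel_ne_zero {Z : Finset ℂ} (h : IsBetheSolution N M β Z) :
    betheLevel β Z ≠ 0 := Finset.prod_ne_zero_iff.2 h.regular

theorem IsBetheSolution.ne_zero (hN : 1 ≤ N) (hNM : N ≤ M) {Z : Finset ℂ}
    (h : IsBetheSolution N M β Z) : ∀ z ∈ Z, z ≠ 0 := by
  rintro z hz rfl
  have := h.equation 0 hz
  rw [mul_zero, add_zero, one_pow, zero_pow (by omega : M ≠ 0)] at this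
  simp at this

theorem IsBetheSolution.eval_inv (hN : 1 ≤ N) (hNM : N ≤ M) {Z : Finset ℂ}
    (h : IsBetheSolution N M β Z) {z : ℂ} (hz : z ∈ Z) :
    (bethePotential N M β).eval z⁻¹ = -((-1) ^ N * betheLevel β Z) := by
  have h0 := h.ne_zero hN hNM z hz
  have h1 := h.equation z hz
  obtain ⟨L, rfl⟩ := Nat.exists_eq_add_of_le hNM
  rw [eval_bethePotential, add_tsub_cancel_left, betheLevel]
  have h2 : z⁻¹ ^ L * (z⁻¹ + β) ^ N = (1 + β * z) ^ N / z ^ (N + L) := by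
    rw [show 1 + β * z = z * (z⁻¹ + β) by field_simp, mul_pow, pow_add, inv_pow]
    field_simp
  rw [h2, div_eq_iff (pow_ne_zero _ h0)]
  linear_combination h1

/-- A solution of the Bethe equations is a subset of twist `1` of the level set of its level. -/
theorem IsBetheSolution.exists_subset (hN : 1 ≤ N) (hNM : N ≤ M) {Z : Finset ℂ}
    (hZ : IsBetheSolution N M β Z) (h : IsLevelList N M β (betheLevel β Z) y) :
    ∃ S ∈ (univ : Finset (Fin M)).powersetCard N, twist N β S y = 1 ∧
      S.image (fun i => (y i)⁻¹) = Z := by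
  have hex : ∀ z ∈ Z, ∃ i, y i = z⁻¹ := fun z hz => exists_of_eval_eq h (hZ.eval_inv hN hNM hz)
  have : Nonempty (Fin M) := ⟨⟨0, by omega⟩⟩
  choose! ι hι using hex
  have hinj : Set.InjOn ι (Z : Set ℂ) := fun z hz w hw hzw => by
    have h1 := hι z hz
    rw [hzw, hι w hw] at h1
    exact (inv_injective h1).symm
  have hcard : (Z.image ι).card = N := by rw [Finset.card_image_of_injOn hinj, hZ.card_eq]
  have himage : (Z.image ι).image (fun i => (y i)⁻¹) = Z := by
    rw [Finset.image_image]
    conv_rhs => rw [← Finset.image_id (s := Z)]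
    refine Finset.image_congr fun z hz => ?_
    simp [hι z hz]
  refine ⟨Z.image ι, Finset.mem_powersetCard.2 ⟨Finset.subset_univ _, hcard⟩, ?_, himage⟩
  have h1 := h.twist_mul hN (Z.image ι)
  rw [Finset.prod_image hinj, Finset.prod_image hinj] at h1
  have h2 : ∏ z ∈ Z, (y (ι z) + β) = betheLevel β Z * ∏ z ∈ Z, y (ι z) := by
    rw [betheLevel, ← Finset.prod_mul_distrib]
    refine Finset.prod_congr rfl fun z hz => ?_
    have := hZ.ne_zero hN hNM z hz
    rw [hι z hz]
    field_simp
  have h3 : ∏ z ∈ Z, (y (ι z) + β) ≠ 0 :=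
    Finset.prod_ne_zero_iff.2 fun z _ => h.add_ne_zero hN hZ.betheLevel_ne_zero _
  rw [← h2] at h1
  exact mul_right_cancel₀ h3 (h1.trans (one_mul _).symm)

/-- The subsets of a level set with twist `1` correspond to the solutions with that level. -/
theorem sum_twist_eq_one (hN : 1 ≤ N) (hNM : N ≤ M) (hβ : BetheNondegenerate N M β)
    {b : ℂ} (hb : b ≠ 0) (h : IsLevelList N M β b y) {sols : Finset (Finset ℂ)}
    (hsols : ∀ Z, Z ∈ sols ↔ IsBetheSolution N M β Z) (g : Finset ℂ → ℂ) :
    ∑ S ∈ ((univ : Finset (Fin M)).powersetCard N).filter (fun S => twist N β S y = 1),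
      g (S.image fun i => (y i)⁻¹) = ∑ Z ∈ sols.filter (fun Z => betheLevel β Z = b), g Z := by
  have hsimple : ∀ S ∈ ((univ : Finset (Fin M)).powersetCard N).filter (fun S => twist N β S y = 1),
      ∀ i ∈ S, ∀ j, y i = y j → i = j := by
    intro S hS i hi j hij
    rw [Finset.mem_filter, Finset.mem_powersetCard] at hS
    exact injective_of_eval_derivative_ne_zero h (h.eval_derivative_ne_zero hNM hb
      ((h.denominators_ne_zero hN hNM hβ hb hS.1.2 hS.2).1 i hi)) hij
  refine Finset.sum_bij (fun S _ => S.image fun i => (y i)⁻¹) ?_ ?_ ?_ fun _ _ => rfl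
  · intro S hS
    have hinj : Set.InjOn (fun i => (y i)⁻¹) (S : Set (Fin M)) := fun i hi j _ hij =>
      hsimple S hS i hi j (inv_injective hij)
    rw [Finset.mem_filter, Finset.mem_powersetCard] at hS
    have h0 := h.ne_zero_of_twist_eq_one hN hb hS.2
    have hlev : betheLevel β (S.image fun i => (y i)⁻¹) = b := by
      rw [betheLevel, Finset.prod_image hinj, h.prod_one_add_inv hN hb hS.2]
    refine Finset.mem_filter.2 ⟨(hsols _).2 ⟨?_, ?_, ?_⟩, hlev⟩
    · rw [Finset.card_image_of_injOn hinj, hS.1.2]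
    · have h1 := h.prod_one_add_inv hN hb hS.2
      rw [← h1] at hb
      intro z hz
      obtain ⟨i, hi, rfl⟩ := Finset.mem_image.1 hz
      exact Finset.prod_ne_zero_iff.1 hb i hi
    · intro z hz
      obtain ⟨i, hi, rfl⟩ := Finset.mem_image.1 hz
      have h1 := congrArg (eval (y i)⁻¹) (h.reverse_eq hN hNM 1)
      simp only [one_mul, one_pow, mul_one, eval_add, eval_pow, eval_mul, eval_one, eval_C, eval_X,
        eval_prod, eval_sub] at h1
      rw [Finset.prod_eq_zero (mem_univ i) (by rw [mul_inv_cancel₀ (h0 i hi), sub_self])] at h1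
      change _ + _ * _ * betheLevel β _ = 0
      rw [hlev]
      linear_combination h1
  · intro S hS T hT hST
    have hsub : ∀ S ∈ ((univ : Finset (Fin M)).powersetCard N).filter
        (fun S => twist N β S y = 1), ∀ T : Finset (Fin M),
        (S.image fun i => (y i)⁻¹) = (T.image fun i => (y i)⁻¹) → S ⊆ T := by
      intro S hS T hST i hi
      have h1 : (y i)⁻¹ ∈ T.image fun i => (y i)⁻¹ := hST ▸ Finset.mem_image_of_mem _ hi
      obtain ⟨j, hj, hij⟩ := Finset.mem_image.1 h1
      rw [hsimple S hS i hi j (inv_injective hij.symm)]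
      exact hj
    exact Finset.Subset.antisymm (hsub S hS T hST) (hsub T hT S hST.symm)
  · intro Z hZ
    rw [Finset.mem_filter, hsols] at hZ
    obtain ⟨hZ, hlev⟩ := hZ
    obtain ⟨S, hS, h1, h2⟩ := hZ.exists_subset hN hNM (hlev.symm ▸ h)
    exact ⟨S, Finset.mem_filter.2 ⟨hS, h1⟩, h2⟩

theorem betheSummand_image (lam mu : Fin N → ℕ) {b : ℂ} {S : Finset (Fin M)}
    (hinj : Set.InjOn y S) (hlev : ∏ i ∈ S, (1 + β * (y i)⁻¹) = b) :
    betheSummand M β lam mu (S.image fun i => (y i)⁻¹) =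
      levelTerm β lam mu S y * (b / (1 + ∑ i ∈ S, β / invDenominator N M β (y i))) := by
  have hinj' : Set.InjOn (fun i => (y i)⁻¹) (S : Set (Fin M)) := fun i hi j hj hij =>
    hinj hi hj (inv_injective hij)
  simp only [betheSummand, betheLevel, Finset.sum_image hinj', Finset.prod_image hinj', inv_inv]
  rw [hlev]
  rfl

open Filter Topology in
/-- At a nonzero level the residue of `betheResolvent` is the sum of the summands of the
orthogonality relation over the solutions with that level. -/
theorem tendsto_sub_mul_betheResolvent (hN : 1 ≤ N) (hNM : N ≤ M) (hβ : BetheNondegenerate N M β)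
    {y : ℂ → Fin M → ℂ} (hy : ∀ c, IsLevelList N M β c (y c)) (lam mu : Fin N → ℕ) {b : ℂ}
    (hb : b ≠ 0) {sols : Finset (Finset ℂ)} (hsols : ∀ Z, Z ∈ sols ↔ IsBetheSolution N M β Z) :
    Tendsto (fun c => (c - b) * betheResolvent β lam mu (y c)) (𝓝[≠] b)
      (𝓝 (∑ Z ∈ sols.filter (fun Z => betheLevel β Z = b), betheSummand M β lam mu Z)) := by
  rw [tendsto_iff_ultrafilter]
  intro u hu
  obtain ⟨x, hxb, hx⟩ := exists_ultrafilter_limit hN hNM hy (hu.trans nhdsWithin_le_nhds)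
  rw [← sum_twist_eq_one hN hNM hβ hb hxb hsols, Finset.sum_filter]
  simp only [betheResolvent, Finset.mul_sum]
  refine tendsto_finsetSum _ fun S hS => ?_
  have hcard := (Finset.mem_powersetCard.1 hS).2
  have htw := (tendsto_twist (N := N) (β := β) hx S).sub_const 1
  split_ifs with h1
  · obtain ⟨h2, h3⟩ := hxb.denominators_ne_zero hN hNM hβ hb hcard h1
    have hd : ∀ i ∈ S, (bethePotential N M β).derivative.eval (x i) ≠ 0 := fun i hi =>
      hxb.eval_derivative_ne_zero hNM hb (h2 i hi)
    rw [betheSummand_image lam mu (b := b) (fun i hi j hj hij =>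
      injective_of_eval_derivative_ne_zero hxb (hd i hi) hij) (hxb.prod_one_add_inv hN hb h1)]
    have h4 := tendsto_twist_sub_one_div hN hNM hy hb hu hxb hx h1 h2
    have h5 : Tendsto (fun c => levelTerm β lam mu S (y c)) u (𝓝 (levelTerm β lam mu S x)) := by
      refine (tendsto_minorProduct hx lam mu S).div (tendsto_finsetProd _ fun i _ => ?_)
        (Finset.prod_ne_zero_iff.2 hd)
      exact ((bethePotential N M β).derivative.continuous.tendsto _).comp (tendsto_pi_nhds.1 hx i)
    have h6 := h5.mul (h4.inv₀ (mul_ne_zero (inv_ne_zero hb) h3))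
    rw [mul_inv, inv_inv, ← div_eq_mul_inv b] at h6
    refine h6.congr fun c => ?_
    rw [inv_div]
    ring
  · have h2 := (tendsto_sub_mul_levelTerm hN hNM hy hb hu hxb hx lam mu hcard).div htw
      (sub_ne_zero.2 h1)
    rw [zero_div] at h2
    refine h2.congr fun c => ?_
    rw [Pi.div_apply]
    ring

/-- There are finitely many solutions: their levels are roots of a nonzero polynomial, and the
points of a solution are among the inverse roots of a polynomial fixed by the level. -/
theorem finite_betheSolutions (hN : 1 ≤ N) (hNM : N ≤ M) (β : ℂ) :
    (betheSolutions N M β).Finite := by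
  obtain ⟨B, hB⟩ := exists_finset_generic hN hNM β
  choose y hy using exists_isLevelList (N := N) (M := M) hN hNM β
  refine (B.biUnion fun b =>
    ((univ : Finset (Fin M)).image fun i => (y b i)⁻¹).powerset).finite_toSet.subset ?_
  intro Z hZ
  obtain ⟨S, hS, h1, h2⟩ := IsBetheSolution.exists_subset hN hNM hZ (hy _)
  rw [Finset.mem_coe, Finset.mem_biUnion]
  refine ⟨betheLevel β Z, ?_, ?_⟩
  · by_contra h3
    exact (resolventDenominator_ne_zero_iff.1 (hB _ h3 _ (hy _))).2 S hS (sub_eq_zero.2 h1)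
  · rw [Finset.mem_powerset]
    exact h2.symm.subset.trans (Finset.image_subset_image (Finset.subset_univ S))

/-! ### The summand of the orthogonality relation -/

theorem differenceProduct_ne_zero {z : Fin N → ℂ} (hz : Function.Injective z) :
    differenceProduct z ≠ 0 :=
  Finset.prod_ne_zero_iff.2 fun _ _ => Finset.prod_ne_zero_iff.2 fun _ hk =>
    sub_ne_zero.2 fun h => (Finset.mem_Ioi.1 hk).ne (hz h)

/-- The difference products of the two Grothendieck polynomials cancel the product over `j ≠ k` in
the weight. -/
theorem differenceProduct_mul_inv {z : Fin N → ℂ} (hz : ∀ j, z j ≠ 0) :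
    differenceProduct z⁻¹ * differenceProduct z =
      (∏ j, ∏ k ∈ univ.erase j, (z j - z k)) * ∏ j, z j ^ (1 - (N : ℤ)) := by
  have h1 := Finset.prod_prod_Ioi_mul_eq_prod_prod_off_diag fun j k : Fin N => z k - z j
  have h2 := Finset.prod_prod_Ioi_mul_eq_prod_prod_off_diag fun j k : Fin N => (z k)⁻¹
  have hset : ∀ j : Fin N, univ.erase j = ({j} : Finset (Fin N))ᶜ := fun j => by
    ext k; simp
  simp_rw [hset]
  have h3 : ∀ j : Fin N, ∏ k ∈ ({j} : Finset (Fin N))ᶜ, (z j)⁻¹ = z j ^ (1 - (N : ℤ)) := by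
    intro j
    have hN : 0 < N := j.pos
    rw [Finset.prod_const, Finset.card_compl, Fintype.card_fin, Finset.card_singleton, inv_pow,
      ← zpow_natCast, ← zpow_neg, Nat.cast_sub (by omega)]
    congr 1
    push_cast
    ring
  rw [← h1, ← Finset.prod_congr rfl fun j _ => h3 j, ← h2, differenceProduct, differenceProduct,
    ← Finset.prod_mul_distrib, ← Finset.prod_mul_distrib]
  refine Finset.prod_congr rfl fun j _ => ?_
  rw [← Finset.prod_mul_distrib, ← Finset.prod_mul_distrib]
  refine Finset.prod_congr rfl fun k _ => ?_
  have := hz j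
  have := hz k
  simp only [Pi.inv_apply]
  field_simp

/-- The numerator of the dual Grothendieck polynomial at `w = z⁻¹`, in terms of `leftPoly`. -/
theorem det_dualGrothendieck (lam : Fin N → ℕ) {w : Fin N → ℂ} (hw : ∀ j, w j ≠ 0)
    (hx : ∀ j, w j + β ≠ 0) :
    (Matrix.of fun j k : Fin N => w j ^ (lam k + (N - 1 - (k : ℕ))) *
      (1 + β * (w j)⁻¹) ^ (-((k : ℕ) : ℤ))).det =
      (∏ j, (w j / (w j + β)) ^ (N - 1)) *
        (Matrix.of fun j k : Fin N => (leftPoly β lam k).eval (w j)).det := by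
  rw [← Matrix.det_mul_column]
  congr 1
  ext j k
  have h1 := hw j
  have h2 := hx j
  obtain ⟨n, hn⟩ : ∃ n, N - 1 = n + k := ⟨N - 1 - k, by have := k.2; omega⟩
  simp only [Matrix.of_apply, leftPoly, eval_mul, eval_pow, eval_X, eval_add, eval_C]
  rw [zpow_neg, zpow_natCast, show 1 + β * (w j)⁻¹ = (w j + β) / w j by field_simp, hn,
    Nat.add_sub_cancel, div_pow, div_pow, inv_div, pow_add _ n, pow_add _ n, pow_add]
  field_simp

/-- The numerator of the Grothendieck polynomial at `z = w⁻¹`, in terms of `rightPoly`. -/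
theorem det_grothendieck (hN : 1 ≤ N) (hNM : N ≤ M) (mu : Fin N → ℕ) (hmu : ∀ k, mu k ≤ M - N)
    {w : Fin N → ℂ} (hw : ∀ j, w j ≠ 0) :
    (Matrix.of fun j k : Fin N => (w j)⁻¹ ^ (mu k + (N - 1 - (k : ℕ))) *
      (1 + β * (w j)⁻¹) ^ (k : ℕ)).det =
      (∏ j, ((w j) ^ (M - 1))⁻¹) *
        (Matrix.of fun j k : Fin N => (rightPoly M β mu k).eval (w j)).det := by
  rw [← Matrix.det_mul_column]
  congr 1
  ext j k
  have h1 := hw j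
  have hk := k.2
  have h2 := hmu k
  simp only [Matrix.of_apply, rightPoly, eval_mul, eval_pow, eval_X, eval_add, eval_C]
  rw [show 1 + β * (w j)⁻¹ = (w j + β) / w j by field_simp,
    show M - 1 = (M - N - mu k) + ((mu k + (N - 1 - k)) + k) by omega, pow_add (w j), pow_add (w j),
    div_pow, inv_pow]
  field_simp

/-- The factors of the summand collected at one point of a solution. -/
theorem weight_factor_eq (hN : 1 ≤ N) (hNM : N ≤ M) {w : ℂ} (hw : w ≠ 0) (hx : w + β ≠ 0) :
    (w / (w + β)) ^ (N - 1) * (w ^ (M - 1))⁻¹ * (betheDenominator N M β w⁻¹)⁻¹ =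
      ((bethePotential N M β).derivative.eval w)⁻¹ := by
  have h1 := mul_eval_derivative_bethePotential (β := β) hNM w
  rw [eval_bethePotential] at h1
  have h2 : (bethePotential N M β).derivative.eval w =
      w ^ (M - N) * (w + β) ^ (N - 1) * (invDenominator N M β w / w) := by
    apply mul_left_cancel₀ (mul_ne_zero hw hx)
    rw [h1]
    obtain ⟨n, rfl⟩ := Nat.exists_eq_add_of_le' hN
    rw [Nat.add_sub_cancel, pow_succ]
    field_simp
  rw [h2, betheDenominator_inv hw, mul_inv _ (invDenominator N M β w / w)]
  congr 1
  rw [show M - 1 = (M - N) + (N - 1) by omega, pow_add, div_pow]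
  field_simp

theorem sum_bethePoints (Z : betheSolutions N M β) {E : Type*} [AddCommMonoid E] (g : ℂ → E) :
    ∑ j, g (bethePoints Z j) = ∑ z ∈ Z.1, g z := by
  rw [← Finset.sum_coe_sort Z.1 g]
  exact Equiv.sum_comp (Z.1.equivFinOfCardEq Z.2.card_eq).symm fun z : Z.1 => g z

theorem prod_bethePoints (Z : betheSolutions N M β) {E : Type*} [CommMonoid E] (g : ℂ → E) :
    ∏ j, g (bethePoints Z j) = ∏ z ∈ Z.1, g z := by
  rw [← Finset.prod_coe_sort Z.1 g]
  exact Equiv.prod_comp (Z.1.equivFinOfCardEq Z.2.card_eq).symm fun z : Z.1 => g z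

theorem bethePoints_mem (Z : betheSolutions N M β) (j : Fin N) : bethePoints Z j ∈ Z.1 :=
  ((Z.1.equivFinOfCardEq Z.2.card_eq).symm j).2

theorem bethePoints_injective (Z : betheSolutions N M β) : Function.Injective (bethePoints Z) :=
  Subtype.val_injective.comp (Equiv.injective _)

/-- The summand of the orthogonality relation is the `betheSummand` of the solution. -/
theorem weight_mul_eq_betheSummand (hN : 1 ≤ N) (hNM : N ≤ M) (lam mu : Fin N → ℕ)
    (hmu : ∀ k, mu k ≤ M - N) (Z : betheSolutions N M β) :
    betheWeight M β (bethePoints Z) * dualGrothendieck lam (bethePoints Z)⁻¹ β *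
      grothendieck mu (bethePoints Z) β = betheSummand M β lam mu Z.1 := by
  set p := bethePoints Z with hp
  set w : Fin N → ℂ := p⁻¹ with hw
  have hp0 : ∀ j, p j ≠ 0 := fun j => Z.2.ne_zero hN hNM _ (bethePoints_mem Z j)
  have hw0 : ∀ j, w j ≠ 0 := fun j => inv_ne_zero (hp0 j)
  have hpw : ∀ j, p j = (w j)⁻¹ := fun j => (inv_inv (p j)).symm
  have hx : ∀ j, w j + β ≠ 0 := by
    intro j h
    apply Z.2.regular _ (bethePoints_mem Z j)
    have h1 : 1 + β * p j = p j * (w j + β) := by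
      have := hp0 j
      simp only [hw, Pi.inv_apply]
      field_simp
    rw [← hp, h1, h, mul_zero]
  have hΔ : differenceProduct p ≠ 0 := differenceProduct_ne_zero (bethePoints_injective Z)
  have hΔ' : differenceProduct w ≠ 0 :=
    differenceProduct_ne_zero fun i j hij => bethePoints_injective Z (inv_injective hij)
  have h1 := differenceProduct_mul_inv hp0
  have hminor : (Matrix.of fun k l => ∑ z ∈ Z.1, (leftPoly β lam k).eval z⁻¹ *
      (rightPoly M β mu l).eval z⁻¹).det =
      (Matrix.of fun j k : Fin N => (leftPoly β lam k).eval (w j)).det *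
        (Matrix.of fun j k : Fin N => (rightPoly M β mu k).eval (w j)).det := by
    rw [← Matrix.det_transpose (Matrix.of fun j k : Fin N => (leftPoly β lam k).eval (w j)),
      ← Matrix.det_mul]
    congr 1
    ext k l
    simp only [Matrix.of_apply, Matrix.mul_apply, Matrix.transpose_apply]
    rw [← sum_bethePoints Z fun z => (leftPoly β lam k).eval z⁻¹ * (rightPoly M β mu l).eval z⁻¹]
    rfl
  have h2 : dualGrothendieck lam w β = (∏ j, (w j / (w j + β)) ^ (N - 1)) *
      (Matrix.of fun j k : Fin N => (leftPoly β lam k).eval (w j)).det / differenceProduct w := by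
    rw [dualGrothendieck, det_dualGrothendieck lam hw0 hx]
  have h3 : grothendieck mu p β = (∏ j, ((w j) ^ (M - 1))⁻¹) *
      (Matrix.of fun j k : Fin N => (rightPoly M β mu k).eval (w j)).det / differenceProduct p := by
    rw [grothendieck, ← det_grothendieck hN hNM mu hmu hw0]
    simp only [← hpw]
  have h4 : betheWeight M β p = (betheSumFactor M β p)⁻¹ * (differenceProduct w *
      differenceProduct p) * (betheLevel β Z.1 * ∏ j, (betheDenominator N M β (w j)⁻¹)⁻¹) := by
    rw [betheWeight, h1, betheLevel, ← prod_bethePoints Z fun z => 1 + β * z, ← hp]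
    simp only [div_eq_mul_inv, Finset.prod_mul_distrib, ← hpw]
    ring
  have h5 : ∏ z ∈ Z.1, (bethePotential N M β).derivative.eval z⁻¹ =
      ∏ j, (bethePotential N M β).derivative.eval (w j) :=
    (prod_bethePoints Z fun z => (bethePotential N M β).derivative.eval z⁻¹).symm
  have h6 : 1 + ∑ z ∈ Z.1, β / invDenominator N M β z⁻¹ = betheSumFactor M β p := by
    rw [betheSumFactor_eq hp0, ← sum_bethePoints Z fun z => β / invDenominator N M β z⁻¹]
  have h7 : (∏ j, (bethePotential N M β).derivative.eval (w j))⁻¹ =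
      (∏ j, (w j / (w j + β)) ^ (N - 1)) * (∏ j, ((w j) ^ (M - 1))⁻¹) *
        ∏ j, (betheDenominator N M β (w j)⁻¹)⁻¹ := by
    rw [← Finset.prod_mul_distrib, ← Finset.prod_mul_distrib, ← Finset.prod_inv_distrib]
    exact Finset.prod_congr rfl fun j _ => (weight_factor_eq hN hNM (hw0 j) (hx j)).symm
  rw [betheSummand, hminor, h5, h6, h2, h3, h4, div_eq_mul_inv _ (∏ j, _), h7]
  generalize (Matrix.of fun j k : Fin N => (leftPoly β lam k).eval (w j)).det = D₁
  generalize (Matrix.of fun j k : Fin N => (rightPoly M β mu k).eval (w j)).det = D₂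
  generalize ∏ j, (w j / (w j + β)) ^ (N - 1) = P₁
  generalize ∏ j, ((w j) ^ (M - 1))⁻¹ = P₂
  generalize ∏ j, (betheDenominator N M β (w j)⁻¹)⁻¹ = P₃
  field_simp

/-! ### The orthogonality relation -/

/-- The sum over all solutions is the sum of the residues of `betheResolvent`, hence the residue at
infinity. -/
theorem sum_betheSummand_eq (hN : 1 ≤ N) (hNM : N ≤ M) (hβ : BetheNondegenerate N M β)
    (lam mu : Fin N → ℕ) (hl : Antitone lam) (hlam : ∀ k, lam k ≤ M - N) (hm : Antitone mu)
    (hmu : ∀ k, mu k ≤ M - N) {sols : Finset (Finset ℂ)}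
    (hsols : ∀ Z, Z ∈ sols ↔ IsBetheSolution N M β Z) :
    ∑ Z ∈ sols, betheSummand M β lam mu Z = if lam = mu then 1 else 0 := by
  choose y hy using exists_isLevelList (N := N) (M := M) hN hNM β
  obtain ⟨D, hD⟩ := exists_polynomial_resolventDenominator N M β
  obtain ⟨P, hP⟩ := exists_polynomial_resolventNumerator β lam mu M
  obtain ⟨B₀, hB₀⟩ := exists_finset_generic hN hNM β
  -- all possible poles of the resolvent
  set B : Finset ℂ := insert 0 (B₀ ∪ sols.image (betheLevel β)) with hB
  have hdiff : ∀ c ∉ B, DifferentiableAt ℂ (fun c => betheResolvent β lam mu (y c)) c := by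
    intro c hc
    have hgen : ∀ c ∉ B, D.eval c ≠ 0 := fun c hc => by
      rw [← hD c _ (hy c)]
      refine hB₀ c (fun h => hc ?_) _ (hy c)
      simp [hB, h]
    have h1 : DifferentiableAt ℂ (fun c => P.eval c / D.eval c) c :=
      P.differentiable.differentiableAt.div D.differentiable.differentiableAt (hgen c hc)
    refine h1.congr_of_eventuallyEq ?_
    filter_upwards [B.finite_toSet.isClosed.isOpen_compl.mem_nhds (by simpa using hc)] with v hv
    have hv' := hgen v (by simpa using hv)
    rw [← hD v _ (hy v)] at hv'
    rw [betheResolvent_eq_div lam mu hv', hD v _ (hy v), hP v _ (hy v)]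
  rw [← sum_residues_eq_of_tendsto B (fun c => betheResolvent β lam mu (y c))
    (fun b => if b = 0 then 0 else
      ∑ Z ∈ sols.filter (fun Z => betheLevel β Z = b), betheSummand M β lam mu Z) _ hdiff
    (fun b _ => ?_) (tendsto_mul_betheResolvent hN hNM hy lam mu hl hlam hm hmu)]
  · rw [← Finset.sum_fiberwise_of_maps_to (s := sols) (t := B) (g := betheLevel β) fun Z hZ => by
      simp only [hB, Finset.mem_insert, Finset.mem_union]
      exact Or.inr (Or.inr (Finset.mem_image_of_mem _ hZ))]
    refine Finset.sum_congr rfl fun b _ => ?_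
    split_ifs with hb
    · refine Finset.sum_eq_zero fun Z hZ => ?_
      rw [Finset.mem_filter, hsols] at hZ
      exact absurd (hZ.2.trans hb) hZ.1.betheLevel_ne_zero
    · rfl
  · split_ifs with hb
    · subst hb
      simpa using tendsto_mul_betheResolvent_zero hN hNM hβ.pow_ne_one hy lam mu
    · exact tendsto_sub_mul_betheResolvent hN hNM hβ hy lam mu hb hsols

/-! ### All but finitely many parameters are nondegenerate -/

/-- The roots of a divisor of `∏ (1 - w_i X)`, with multiplicities, are inverses of some `w_i`. -/
theorem exists_subset_map_inv_of_prod_dvd {ι : Type*} [DecidableEq ι] {w : ι → ℂ} (m : Multiset ℂ)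
    (F : Finset ι) (h : (m.map fun x => X - C x).prod ∣ ∏ i ∈ F, (1 - C (w i) * X)) :
    ∃ S ⊆ F, (∀ i ∈ S, w i ≠ 0) ∧ m = S.val.map fun i => (w i)⁻¹ := by
  induction m using Multiset.induction_on generalizing F with
  | empty => exact ⟨∅, Finset.empty_subset _, by simp, by simp⟩
  | cons x m ih =>
    rw [Multiset.map_cons, Multiset.prod_cons] at h
    have h1 : (∏ i ∈ F, (1 - C (w i) * X)).eval x = 0 := by
      obtain ⟨q, hq⟩ := h
      rw [hq]; simp
    rw [eval_prod, Finset.prod_eq_zero_iff] at h1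
    obtain ⟨i, hi, h2⟩ := h1
    simp only [eval_sub, eval_one, eval_mul, eval_C, eval_X, sub_eq_zero] at h2
    have hw : w i ≠ 0 := left_ne_zero_of_mul_eq_one h2.symm
    have hx : x = (w i)⁻¹ := eq_inv_of_mul_eq_one_right h2.symm
    have h3 : (1 - C (w i) * X : ℂ[X]) = (X - C x) * C (-w i) := by
      have h4 : (1 : ℂ[X]) = C (w i) * C x := by rw [← C_mul, ← h2, C_1]
      rw [C_neg]
      linear_combination h4
    have h5 : (m.map fun x => X - C x).prod ∣ ∏ j ∈ F.erase i, (1 - C (w j) * X) := by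
      rw [← Finset.mul_prod_erase F _ hi, h3, mul_assoc] at h
      have h6 := (mul_dvd_mul_iff_left (X_sub_C_ne_zero x)).1 h
      exact ((isUnit_C.2 (neg_ne_zero.2 hw).isUnit).dvd_mul_left).1 h6
    obtain ⟨S, hS, h7, h8⟩ := ih _ h5
    have hiS : i ∉ S := fun h => Finset.notMem_erase i F (hS h)
    refine ⟨insert i S, Finset.insert_subset hi (hS.trans (Finset.erase_subset _ _)), ?_, ?_⟩
    · intro j hj
      rcases Finset.mem_insert.1 hj with rfl | hj
      · exact hw
      · exact h7 j hj
    · rw [Finset.insert_val_of_notMem hiS, Multiset.map_cons, ← h8, hx]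

/-- The symmetric function of a level list for `β = 1` that vanishes when a denominator of the
weight vanishes at one of the `N`-element subsets. -/
def degeneracyProduct (N : ℕ) {M : ℕ} (y : Fin M → ℂ) : ℂ :=
  ∏ S ∈ (univ : Finset (Fin M)).powersetCard N, ((∏ i ∈ S, invDenominator N M 1 (y i)) *
    (∏ i ∈ S, invDenominator N M 1 (y i) +
      ∑ i ∈ S, ∏ j ∈ S.erase i, invDenominator N M 1 (y j)))

theorem exists_polynomial_degeneracyProduct (N M : ℕ) :
    ∃ R : ℂ[X], ∀ (c : ℂ) (y : Fin M → ℂ), IsLevelList N M 1 c y →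
      degeneracyProduct N y = R.eval c := by
  have hd : ∀ i : Fin M, (fun y : Fin M → ℂ => invDenominator N M 1 (y i)) ∈
      coordinateAlgebra M := fun i =>
    Subalgebra.add_mem _ (Subalgebra.mul_mem _ (const_mem _) (coord_mem i)) (const_mem _)
  refine exists_polynomial_of_symmetric (F := degeneracyProduct N) (prod_fun_mem fun S _ =>
    Subalgebra.mul_mem _ (prod_fun_mem fun i _ => hd i) (Subalgebra.add_mem _
      (prod_fun_mem fun i _ => hd i) (sum_fun_mem fun i _ => prod_fun_mem fun j _ => hd j))) ?_ N 1
  intro σ y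
  rw [degeneracyProduct, degeneracyProduct]
  refine Eq.trans ?_ (prod_powersetCard_map σ _)
  refine Finset.prod_congr rfl fun S _ => ?_
  simp only [Finset.prod_map, Finset.sum_map, ← Finset.map_erase]
  rfl

theorem degeneracyProduct_ne_zero_iff : degeneracyProduct N y ≠ 0 ↔
    ∀ S ∈ (univ : Finset (Fin M)).powersetCard N, (∀ i ∈ S, invDenominator N M 1 (y i) ≠ 0) ∧
      1 + ∑ i ∈ S, 1 / invDenominator N M 1 (y i) ≠ 0 := by
  rw [degeneracyProduct, Finset.prod_ne_zero_iff]
  refine forall₂_congr fun S _ => ?_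
  rw [mul_ne_zero_iff, Finset.prod_ne_zero_iff]
  refine and_congr_right fun h => ?_
  have h1 : ∑ i ∈ S, ∏ j ∈ S.erase i, invDenominator N M 1 (y j) =
      (∏ i ∈ S, invDenominator N M 1 (y i)) * ∑ i ∈ S, 1 / invDenominator N M 1 (y i) := by
    rw [Finset.mul_sum]
    refine Finset.sum_congr rfl fun i hi => ?_
    rw [← Finset.mul_prod_erase S _ hi]
    have := h i hi
    field_simp
  rw [h1, ← mul_one_add, mul_ne_zero_iff, and_iff_right (Finset.prod_ne_zero_iff.2 h)]

/-- For large roots each denominator exceeds `N` in absolute value, so that the `N` inverses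
cannot add up to `-1`. -/
theorem degeneracyProduct_ne_zero_of_lt (hN : 1 ≤ N) (hNM : N ≤ M) (hy : ∀ i, 2 < ‖y i‖) :
    degeneracyProduct N y ≠ 0 := by
  have hN' : (0 : ℝ) < N := by exact_mod_cast hN
  have hbig : ∀ i, (N : ℝ) < ‖invDenominator N M 1 (y i)‖ := by
    intro i
    have h1 : ‖(M : ℂ) * y i‖ ≤ ‖invDenominator N M 1 (y i)‖ + ‖((M : ℂ) - N) * 1‖ := by
      rw [invDenominator]
      simpa using norm_sub_le ((M : ℂ) * y i + (M - N) * 1) ((M - N) * 1)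
    rw [← Nat.cast_sub hNM, mul_one, norm_mul, Complex.norm_natCast, Complex.norm_natCast,
      Nat.cast_sub hNM] at h1
    have h2 : (N : ℝ) ≤ M := by exact_mod_cast hNM
    nlinarith [hy i]
  rw [degeneracyProduct_ne_zero_iff]
  intro S hS
  refine ⟨fun i _ h => ?_, fun h => ?_⟩
  · have := hbig i
    rw [h, norm_zero] at this
    linarith
  · have hSc := (Finset.mem_powersetCard.1 hS).2
    have h1 : ‖∑ i ∈ S, 1 / invDenominator N M 1 (y i)‖ < ∑ _i ∈ S, 1 / (N : ℝ) := by
      refine (norm_sum_le _ _).trans_lt (Finset.sum_lt_sum_of_nonempty ?_ fun i _ => ?_)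
      · rw [← Finset.card_pos, hSc]; exact hN
      · rw [norm_div, norm_one]
        exact one_div_lt_one_div_of_lt hN' (hbig i)
    rw [← neg_eq_of_add_eq_zero_right h, norm_neg, norm_one, Finset.sum_const, hSc, nsmul_eq_mul,
      mul_one_div_cancel hN'.ne'] at h1
    exact lt_irrefl _ h1

/-- Rescaling `y` by `β` turns the level lists for `β` into those for `1`, so a degenerate `β ≠ 0`
gives a zero `κ` of a fixed polynomial, and `β ^ M` is determined by `κ` and a subset. -/
theorem finite_degenerate (hN : 1 ≤ N) (hNM : N ≤ M) :
    {β : ℂ | ¬ BetheNondegenerate N M β}.Finite := by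
  have hM : 0 < M := by omega
  obtain ⟨R, hR⟩ := exists_polynomial_degeneracyProduct N M
  choose y hy using exists_isLevelList (N := N) (M := M) hN hNM 1
  have hR0 : R ≠ 0 := by
    rintro rfl
    obtain ⟨c, hc⟩ := (eventually_lt_norm_levelList N M 1 2).exists
    refine degeneracyProduct_ne_zero_of_lt hN hNM (hc _ (hy c)) ?_
    rw [hR c _ (hy c), eval_zero]
  refine (((insert (0 : ℂ) ((nthRoots M (1 : ℂ)).toFinset.image Neg.neg)) ∪
    R.roots.toFinset.biUnion fun κ => ((univ : Finset (Fin M)).powersetCard N).biUnion fun S =>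
      (nthRoots M ((∏ i ∈ S, (1 + (y κ i)⁻¹)) / κ)).toFinset).finite_toSet).subset ?_
  intro β hβ
  by_contra hmem
  simp only [Finset.coe_union, Set.mem_union, Finset.mem_coe, Finset.mem_insert, Finset.mem_image,
    Multiset.mem_toFinset, mem_nthRoots hM, Finset.mem_biUnion, not_or, not_exists, not_and] at hmem
  obtain ⟨⟨hβ0, h1⟩, h2⟩ := hmem
  refine hβ ⟨fun h => h1 (-β) h (neg_neg β), fun z hz hdvd => ?_⟩
  have hβM := pow_ne_zero M hβ0
  set κ : ℂ := (∏ j, (1 + β * z j)) / β ^ M with hκ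
  have hκ0 : κ ≠ 0 := div_ne_zero (Finset.prod_ne_zero_iff.2 fun j _ => hz j) hβM
  have hκβ : κ * β ^ M = ∏ j, (1 + β * z j) := div_mul_cancel₀ _ hβM
  have h3 := (hy κ).reverse_eq hN hNM β
  rw [mul_one, hκβ] at h3
  rw [bethePolynomial, h3] at hdvd
  obtain ⟨S, -, h4, h5⟩ := exists_subset_map_inv_of_prod_dvd (univ.val.map z) univ (by
    rw [Multiset.map_map]; exact hdvd)
  have hSc : S.card = N := by simpa using (congrArg Multiset.card h5).symm
  have hS : S ∈ (univ : Finset (Fin M)).powersetCard N :=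
    Finset.mem_powersetCard.2 ⟨Finset.subset_univ S, hSc⟩
  have hy0 : ∀ i ∈ S, y κ i ≠ 0 := fun i hi => right_ne_zero_of_mul (h4 i hi)
  have hden : ∀ i ∈ S, betheDenominator N M β (β * y κ i)⁻¹ =
      invDenominator N M 1 (y κ i) / y κ i := by
    intro i hi
    have := hy0 i hi
    rw [betheDenominator, invDenominator]
    field_simp
  have hprod : ∏ j, (1 + β * z j) = ∏ i ∈ S, (1 + (y κ i)⁻¹) := by
    have := congrArg (fun m => (m.map fun x => 1 + β * x).prod) h5
    simp only [Multiset.map_map] at this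
    refine Eq.trans this (Finset.prod_congr rfl fun i hi => ?_)
    have := hy0 i hi
    simp only [Function.comp_apply]
    field_simp
  have hsum : betheSumFactor M β z = 1 + ∑ i ∈ S, 1 / invDenominator N M 1 (y κ i) := by
    have := congrArg (fun m => (m.map fun x => β * x / betheDenominator N M β x).sum) h5
    simp only [Multiset.map_map] at this
    refine congrArg (1 + ·) (Eq.trans this (Finset.sum_congr rfl fun i hi => ?_))
    have := hy0 i hi
    simp only [Function.comp_apply]
    rw [hden i hi, mul_inv, mul_inv_cancel_left₀ hβ0, div_eq_mul_inv, inv_div,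
      div_eq_mul_inv _ (invDenominator _ _ _ _),
      inv_mul_cancel_left₀ this, one_div]
  have hroot : R.eval κ ≠ 0 := by
    intro h
    refine h2 κ ((mem_roots hR0).2 h) S hS ?_
    rw [← hprod, ← hκβ, mul_div_cancel_left₀ _ hκ0]
  rw [← hR κ _ (hy κ), degeneracyProduct_ne_zero_iff] at hroot
  obtain ⟨h6, h7⟩ := hroot S hS
  refine ⟨fun j => ?_, hsum ▸ h7⟩
  have hj : z j ∈ univ.val.map z := Multiset.mem_map_of_mem z (Finset.mem_univ_val j)
  rw [h5, Multiset.mem_map] at hj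
  obtain ⟨i, hi, hij⟩ := hj
  rw [← hij, hden i hi]
  exact div_ne_zero (h6 i hi) (hy0 i hi)

end

theorem mainTheorem5 (N M : ℕ) (hN : 1 ≤ N) (hNM : N ≤ M) :
    {β : ℂ | ¬ BetheNondegenerate N M β}.Finite ∧
    ∀ β : ℂ, BetheNondegenerate N M β →
      (betheSolutions N M β).Finite ∧
      ∀ lam mu : Fin N → ℕ,
        Antitone lam → (∀ j, lam j ≤ M - N) →
        Antitone mu → (∀ j, mu j ≤ M - N) →
        ∑ᶠ Z : betheSolutions N M β,
            betheWeight M β (bethePoints Z) *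
              dualGrothendieck lam (bethePoints Z)⁻¹ β * grothendieck mu (bethePoints Z) β =
          if lam = mu then 1 else 0 := by
  refine ⟨finite_degenerate hN hNM, fun β hβ => ?_⟩
  have hfin := finite_betheSolutions hN hNM β
  refine ⟨hfin, fun lam mu hl hlam hm hmu => ?_⟩
  rw [finsum_congr fun Z => weight_mul_eq_betheSummand hN hNM lam mu hmu Z,
    ← sum_betheSummand_eq hN hNM hβ lam mu hl hlam hm hmu (sols := hfin.toFinset) fun Z =>
      hfin.mem_toFinset,
    finsum_set_coe_eq_finsum_mem, finsum_mem_eq_finite_toFinset_sum _ hfin]
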